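/- **Theorem (the spectral dimension of the Cuntz algebra is infinite).** Let $n\ge 2$ and let $Q\in M_n(\mathbb C)$ be positive definite with $\operatorname{Tr}Q=1$. Let $\mathcal O_n$ be the Cuntz algebra, i.e. the universal unital $C^*$-algebra generated by isometries $S_1,\dots,S_n$ with $\sum_k S_kS_k^*=1$. Let $A_u(Q)$ be the universal unital $C^*$-algebra generated by the entries of $u=(u_{ij})_{i,j\le n}$ subject to $u^*u=I_n=uu^*$ and $u^tQ\bar uQ^{-1}=I_n=Q\bar uQ^{-1}u^t$, with comultiplication $\Delta(u_{ij})=\sum_k u_{ik}\otimes u_{kj}$. Let $\tau:\mathcal O_n\to\mathcal O_n\otimes A_u(Q)$ be Wang's ergodic action, $\tau(S_j)=\sum_i S_i\otimes u_{ij}$ (minimal tensor products). *Terminology.* Let $\rho$ be the invariant state of $\tau$, $(\rho\otimes\mathrm{id})\tau(a)=\rho(a)1$, with GNS representation $(H_\rho,\pi_\rho,\eta)$, and let $u_\tau$ be the induced unitary representation on $H_\rho$, $u_\tau(\eta(a)\otimes 1)=(\eta\otimes\mathrm{id})\tau(a)$. Let $A(G)\subseteq A_u(Q)$ be the $*$-subalgebra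 generated by the matrix entries of the irreducible finite-dimensional unitary representations, and let $\mathcal A=\{a\in\mathcal O_n:\tau(a)\in\mathcal O_n\otimes_{\rm alg}A(G)\}$. An *equivariant spectral triple* is given by a self-adjoint operator $D$ on $H_\rho$ with compact resolvent, such that $[D,\pi_\rho(a)]$ is bounded for all $a\in\mathcal A$ and $D\otimes 1$ commutes with $u_\tau$. It is *$p$-summable* if $(1+D^2)^{-p/2}$ is trace class. The *spectral dimension* of the system is the infimum of all $p>0$ for which there is a $p$-summable equivariant spectral triple ($\inf\emptyset=\infty$). For multi-indices $\alpha=(i_1,\dots,i_r)$, $\beta$ put $S_\alpha=S_{i_1}\cdots S_{i_r}$, $\ell(\alpha)=r$, and $H_{rs}=\operatorname{span}\{\eta(S_\alpha S_\beta^*):\ell(\alpha)=r,\ \ell(\beta)=s\}$. Then $H_{r-1,s-1}\subseteq H_{rs}$ for $r,s\ge1$. Put $K_{rs}=H_{rs}\ominus H_{r-1,s-1}$ for $r,s\ge 1$, and $K_{rs}=H_{rs}$ if $rs=0$. 1. The subspaces $K_{rs}$ ($r,s\ge0$) are pairwise orthogonal and their span is dense in $H_\rho$. Moreover $\dim K_{rs}=n^{r+s}$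 if $rs=0$, and $\dim K_{rs}=n^{r+s}-n^{r+s-2}$ if $r,s\ge1$. 2. Let $D$ define an equivariant spectral triple. Then the commutators $[D,\pi_\rho(S_i)]$ are bounded. There are real numbers $d(r,s)$ such that $K_{rs}$ is contained in the domain of $D$ and $D=d(r,s)$ on $K_{rs}$. If $\|[D,\pi_\rho(S_i)]\|\le M$ for $1\le i\le n$, then for all $r,s\ge0$ $$|d(r,s)|\le |d(0,0)|+M\,(r+\sqrt n\,s).$$ 3. No equivariant spectral triple is $p$-summable for any $p>0$. 4. The spectral dimension of $(\mathcal O_n,A_u(Q),\tau)$ is $\infty$. -/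

import Mathlib

noncomputable section

namespace NCG

open scoped ComplexOrder InnerProductSpace TensorProduct
open UniformSpace

section FreeStar

variable (X : Type)

/-- The free unital complex `*`-algebra on `X`: the free algebra on the letters `x` and `x*`. -/
def FreeStarAlg : Type := FreeAlgebra ℂ (X ⊕ X)

instance : Ring (FreeStarAlg X) := inferInstanceAs (Ring (FreeAlgebra ℂ (X ⊕ X)))
instance : Algebra ℂ (FreeStarAlg X) := inferInstanceAs (Algebra ℂ (FreeAlgebra ℂ (X ⊕ X)))

/-- The opposite of the free `*`-algebra with conjugated scalars; only used to define the
involution of `FreeStarAlg X` as an algebra homomorphism. -/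
def FreeStarConjOp : Type := (FreeStarAlg X)ᵐᵒᵖ

instance : Ring (FreeStarConjOp X) := inferInstanceAs (Ring (FreeStarAlg X)ᵐᵒᵖ)
instance : Algebra ℂ (FreeStarConjOp X) :=
  RingHom.toAlgebra' ((algebraMap ℂ (FreeStarAlg X)ᵐᵒᵖ).comp (starRingEnd ℂ))
    (fun c x => Algebra.commutes (A := (FreeStarAlg X)ᵐᵒᵖ) (starRingEnd ℂ c) x)

variable {X}

/-- The letter `x` for `Sum.inl x`, the letter `x*` for `Sum.inr x`. -/
def FreeStarAlg.letter (y : X ⊕ X) : FreeStarAlg X := FreeAlgebra.ι ℂ y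

/-- The conjugate-linear anti-automorphism exchanging `x` and `x*`. -/
def FreeStarAlg.starHom : FreeStarAlg X →ₐ[ℂ] FreeStarConjOp X :=
  FreeAlgebra.lift ℂ (fun y => (MulOpposite.op (FreeStarAlg.letter y.swap) : (FreeStarAlg X)ᵐᵒᵖ))

def FreeStarAlg.starFun (x : FreeStarAlg X) : FreeStarAlg X :=
  MulOpposite.unop (α := FreeStarAlg X) (FreeStarAlg.starHom x)

theorem FreeStarAlg.starFun_letter (y : X ⊕ X) :
    starFun (letter y) = letter y.swap := by
  unfold starFun starHom
  have h := FreeAlgebra.lift_ι_apply (R := ℂ) (A := FreeStarConjOp X)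
    (fun y => (MulOpposite.op (FreeStarAlg.letter y.swap) : (FreeStarAlg X)ᵐᵒᵖ)) y
  exact congrArg (MulOpposite.unop (α := FreeStarAlg X)) h

theorem FreeStarAlg.starFun_mul (x y : FreeStarAlg X) :
    starFun (x * y) = starFun y * starFun x := 
  congrArg (MulOpposite.unop (α := FreeStarAlg X)) (map_mul starHom x y)

theorem FreeStarAlg.starFun_add (x y : FreeStarAlg X) :
    starFun (x + y) = starFun x + starFun y :=
  congrArg (MulOpposite.unop (α := FreeStarAlg X)) (map_add starHom x y)

theorem FreeStarAlg.starFun_algebraMap (c : ℂ) :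
    starFun (algebraMap ℂ (FreeStarAlg X) c) = algebraMap ℂ (FreeStarAlg X) (star c) :=
  congrArg (MulOpposite.unop (α := FreeStarAlg X)) (starHom.commutes c)

theorem FreeStarAlg.induction {P : FreeStarAlg X → Prop}
    (hc : ∀ c : ℂ, P (algebraMap ℂ (FreeStarAlg X) c)) (hl : ∀ y, P (letter y))
    (hm : ∀ a b, P a → P b → P (a * b)) (ha : ∀ a b, P a → P b → P (a + b)) (x) : P x :=
  FreeAlgebra.induction ℂ (X ⊕ X) (motive := P) hc hl hm ha x

instance : StarRing (FreeStarAlg X) where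
  star := FreeStarAlg.starFun
  star_involutive := by
    intro x
    induction x using FreeStarAlg.induction with
    | hc c => simp [FreeStarAlg.starFun_algebraMap]
    | hl y => simp [FreeStarAlg.starFun_letter]
    | hm a b h1 h2 => rw [FreeStarAlg.starFun_mul, FreeStarAlg.starFun_mul, h1, h2]
    | ha a b h1 h2 => rw [FreeStarAlg.starFun_add, FreeStarAlg.starFun_add, h1, h2]
  star_mul := FreeStarAlg.starFun_mul
  star_add := FreeStarAlg.starFun_add

theorem FreeStarAlg.star_letter (y : X ⊕ X) : star (letter y) = letter y.swap :=
  starFun_letter y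

theorem FreeStarAlg.star_algebraMap (c : ℂ) :
    star (algebraMap ℂ (FreeStarAlg X) c) = algebraMap ℂ (FreeStarAlg X) (star c) :=
  starFun_algebraMap c

instance : StarModule ℂ (FreeStarAlg X) where
  star_smul c x := by
    rw [Algebra.smul_def, Algebra.smul_def, star_mul, FreeStarAlg.star_algebraMap,
      Algebra.commutes]

/-- The `*`-homomorphism determined by a family of elements of a C*-algebra. -/
def FreeStarAlg.lift {E : Type*} [CStarAlgebra E] (g : X → E) : FreeStarAlg X →⋆ₐ[ℂ] E :=
  { (FreeAlgebra.lift ℂ (Sum.elim g (fun x => star (g x))) : FreeAlgebra ℂ (X ⊕ X) →ₐ[ℂ] E) with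
    map_star' := by
      intro x
      set f : FreeStarAlg X →ₐ[ℂ] E :=
        (FreeAlgebra.lift ℂ (Sum.elim g (fun x => star (g x))) : FreeAlgebra ℂ (X ⊕ X) →ₐ[ℂ] E)
      have hf : ∀ y, f (letter y) = Sum.elim g (fun x => star (g x)) y := fun y =>
        FreeAlgebra.lift_ι_apply _ y
      change f (star x) = star (f x)
      induction x using FreeStarAlg.induction with
      | hc c => rw [star_algebraMap, AlgHom.commutes, AlgHom.commutes, algebraMap_star_comm]
      | hl y => rw [star_letter, hf, hf]; cases y <;> simp
      | hm a b h1 h2 => rw [star_mul, map_mul, map_mul, h1, h2, star_mul]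
      | ha a b h1 h2 => rw [star_add, map_add, map_add, h1, h2, star_add] }

theorem FreeStarAlg.lift_inl {E : Type*} [CStarAlgebra E] (g : X → E) (x : X) :
    lift g (letter (Sum.inl x)) = g x :=
  FreeAlgebra.lift_ι_apply (R := ℂ) (Sum.elim g (fun x => star (g x))) (Sum.inl x)

theorem FreeStarAlg.lift_inr {E : Type*} [CStarAlgebra E] (g : X → E) (x : X) :
    lift g (letter (Sum.inr x)) = star (g x) :=
  FreeAlgebra.lift_ι_apply (R := ℂ) (Sum.elim g (fun x => star (g x))) (Sum.inr x)

end FreeStar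

section Completion

variable {F : Type*} [Ring F] [StarRing F] [Algebra ℂ F]
  {ι : Type*} {E : ι → Type*} [∀ i, CStarAlgebra (E i)]

/-- A pointwise bounded family of `*`-homomorphisms of `F` into C*-algebras. -/
structure RepFamily (F : Type*) [Ring F] [StarRing F] [Algebra ℂ F]
    {ι : Type*} (E : ι → Type*) [∀ i, CStarAlgebra (E i)] where
  rep : ∀ i, F →⋆ₐ[ℂ] E i
  bdd : ∀ x, BddAbove (Set.range fun i => ‖rep i x‖)

/-- The algebra `F` with the C*-seminorm `‖x‖ = sup_i ‖Φ_i x‖`. -/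
def RepFamily.Pre (_Φ : RepFamily F E) := F

variable (Φ : RepFamily F E)

instance : Ring Φ.Pre := inferInstanceAs (Ring F)
instance : StarRing Φ.Pre := inferInstanceAs (StarRing F)
instance : Algebra ℂ Φ.Pre := inferInstanceAs (Algebra ℂ F)

/-- The C*-seminorm `sup_i ‖Φ_i x‖`. -/
def RepFamily.seminorm (x : F) : ℝ := ⨆ i, ‖Φ.rep i x‖

theorem RepFamily.le_seminorm (i : ι) (x : F) : ‖Φ.rep i x‖ ≤ Φ.seminorm x :=
  le_ciSup (Φ.bdd x) i

theorem RepFamily.seminorm_nonneg (x : F) : 0 ≤ Φ.seminorm x :=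
  Real.iSup_nonneg fun _ => norm_nonneg _

theorem RepFamily.seminorm_le {x : F} {C : ℝ} (hC : 0 ≤ C) (h : ∀ i, ‖Φ.rep i x‖ ≤ C) :
    Φ.seminorm x ≤ C := Real.iSup_le h hC

def RepFamily.ringSeminorm : RingSeminorm Φ.Pre where
  toFun := Φ.seminorm
  map_zero' := le_antisymm
    (Φ.seminorm_le le_rfl fun i => (norm_eq_zero.2 (map_zero (Φ.rep i))).le) (Φ.seminorm_nonneg _)
  add_le' x y := Φ.seminorm_le (add_nonneg (Φ.seminorm_nonneg _) (Φ.seminorm_nonneg _)) fun i =>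
    (congrArg norm (map_add (Φ.rep i) x y)).trans_le ((norm_add_le _ _).trans
      (add_le_add (Φ.le_seminorm i x) (Φ.le_seminorm i y)))
  neg' x := by
    unfold RepFamily.seminorm
    congr 1
    funext i
    exact (congrArg norm (map_neg (Φ.rep i) x)).trans (norm_neg _)
  mul_le' x y := Φ.seminorm_le (mul_nonneg (Φ.seminorm_nonneg _) (Φ.seminorm_nonneg _)) fun i =>
    (congrArg norm (map_mul (Φ.rep i) x y)).trans_le ((norm_mul_le _ _).trans
      (mul_le_mul (Φ.le_seminorm i x) (Φ.le_seminorm i y) (norm_nonneg _) (Φ.seminorm_nonneg _)))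

instance : SeminormedRing Φ.Pre := Φ.ringSeminorm.toSeminormedRing

theorem RepFamily.norm_def (x : Φ.Pre) : ‖x‖ = Φ.seminorm x := rfl

instance : NormedAlgebra ℂ Φ.Pre where
  norm_smul_le c x := Φ.seminorm_le (mul_nonneg (norm_nonneg c) (Φ.seminorm_nonneg x)) fun i =>
    (congrArg norm (map_smul (Φ.rep i) c x)).trans_le ((norm_smul_le _ _).trans
      (mul_le_mul_of_nonneg_left (Φ.le_seminorm i x) (norm_nonneg _)))

theorem RepFamily.norm_star (x : Φ.Pre) : ‖star x‖ = ‖x‖ := by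
  change (⨆ i, ‖Φ.rep i (star (x : F))‖) = ⨆ i, ‖Φ.rep i (x : F)‖
  congr 1
  funext i
  exact (congrArg norm (map_star (Φ.rep i) (x : F))).trans (_root_.norm_star _)

theorem RepFamily.norm_mul_self_le (x : Φ.Pre) : ‖x‖ * ‖x‖ ≤ ‖star x * x‖ := by
  have h0 : 0 ≤ ‖star x * x‖ := norm_nonneg _
  have h1 : ‖x‖ ≤ √‖star x * x‖ := Φ.seminorm_le (Real.sqrt_nonneg _) fun i => by
    refine Real.le_sqrt_of_sq_le ?_
    have h2 : ‖Φ.rep i x‖ * ‖Φ.rep i x‖ = ‖Φ.rep i (star (x : F) * (x : F))‖ :=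
      CStarRing.norm_star_mul_self.symm.trans (congrArg norm
        ((map_mul (Φ.rep i) (star (x : F)) (x : F)).trans
          (congrArg (· * Φ.rep i x) (map_star (Φ.rep i) (x : F)))).symm)
    rw [pow_two, h2]
    exact Φ.le_seminorm i _
  calc ‖x‖ * ‖x‖ ≤ √‖star x * x‖ * √‖star x * x‖ :=
        mul_le_mul h1 h1 (norm_nonneg _) (Real.sqrt_nonneg _)
    _ = ‖star x * x‖ := Real.mul_self_sqrt h0

/-- The C*-algebra obtained by separating and completing `F` for the seminorm `sup_i ‖Φ_i x‖`. -/
def RepFamily.Alg : Type _ := UniformSpace.Completion Φ.Pre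

instance : NormedRing Φ.Alg := inferInstanceAs (NormedRing (UniformSpace.Completion Φ.Pre))
instance : Algebra ℂ Φ.Alg := inferInstanceAs (Algebra ℂ (UniformSpace.Completion Φ.Pre))
instance : CompleteSpace Φ.Alg := inferInstanceAs (CompleteSpace (UniformSpace.Completion Φ.Pre))

/-- The canonical map of `F` into its completion. -/
def RepFamily.ofPre (x : F) : Φ.Alg := UniformSpace.Completion.coe' (α := Φ.Pre) x

theorem RepFamily.norm_ofPre (x : F) : ‖Φ.ofPre x‖ = Φ.seminorm x :=
  UniformSpace.Completion.norm_coe (E := Φ.Pre) x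
theorem RepFamily.ofPre_mul (x y : F) : Φ.ofPre (x * y) = Φ.ofPre x * Φ.ofPre y :=
  UniformSpace.Completion.coe_mul (α := Φ.Pre) x y
theorem RepFamily.ofPre_add (x y : F) : Φ.ofPre (x + y) = Φ.ofPre x + Φ.ofPre y :=
  UniformSpace.Completion.coe_add (α := Φ.Pre) x y
theorem RepFamily.ofPre_smul (c : ℂ) (x : F) : Φ.ofPre (c • x) = c • Φ.ofPre x :=
  UniformSpace.Completion.coe_smul (X := Φ.Pre) c x
theorem RepFamily.ofPre_algebraMap (c : ℂ) :
    Φ.ofPre (algebraMap ℂ F c) = algebraMap ℂ Φ.Alg c :=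
  rfl

theorem RepFamily.isometry_star : Isometry (star : Φ.Pre → Φ.Pre) :=
  AddMonoidHomClass.isometry_of_norm (starAddEquiv : Φ.Pre ≃+ Φ.Pre) Φ.norm_star

instance : Star Φ.Alg := ⟨UniformSpace.Completion.map (star : Φ.Pre → Φ.Pre)⟩

theorem RepFamily.ofPre_star (x : F) : Φ.ofPre (star x) = star (Φ.ofPre x) :=
  (UniformSpace.Completion.map_coe Φ.isometry_star.uniformContinuous (x : Φ.Pre)).symm

theorem RepFamily.continuous_star : Continuous (star : Φ.Alg → Φ.Alg) :=
  UniformSpace.Completion.continuous_map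

theorem RepFamily.induction {P : Φ.Alg → Prop} (hc : IsClosed {x | P x})
    (h : ∀ x : F, P (Φ.ofPre x)) (x : Φ.Alg) : P x :=
  UniformSpace.Completion.induction_on (α := Φ.Pre) x hc h

theorem RepFamily.induction₂ {P : Φ.Alg → Φ.Alg → Prop}
    (hc : IsClosed {x : Φ.Alg × Φ.Alg | P x.1 x.2})
    (h : ∀ x y : F, P (Φ.ofPre x) (Φ.ofPre y)) (x y : Φ.Alg) : P x y :=
  UniformSpace.Completion.induction_on₂ (α := Φ.Pre) (β := Φ.Pre) x y hc h

instance : StarRing Φ.Alg where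
  star_involutive := Φ.induction
    (isClosed_eq (Φ.continuous_star.comp Φ.continuous_star) continuous_id) fun x => by
      rw [← Φ.ofPre_star, ← Φ.ofPre_star, star_star]
  star_mul := Φ.induction₂
    (isClosed_eq (Φ.continuous_star.comp continuous_mul)
      ((Φ.continuous_star.comp continuous_snd).mul (Φ.continuous_star.comp continuous_fst)))
    fun x y => by
      rw [← Φ.ofPre_mul, ← Φ.ofPre_star, ← Φ.ofPre_star, ← Φ.ofPre_star, ← Φ.ofPre_mul, star_mul]
  star_add := Φ.induction₂
    (isClosed_eq (Φ.continuous_star.comp continuous_add)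
      ((Φ.continuous_star.comp continuous_fst).add (Φ.continuous_star.comp continuous_snd)))
    fun x y => by
      rw [← Φ.ofPre_add, ← Φ.ofPre_star, ← Φ.ofPre_star, ← Φ.ofPre_star, ← Φ.ofPre_add, star_add]

instance : NormedAlgebra ℂ Φ.Alg where
  norm_smul_le c := Φ.induction
    (isClosed_le (continuous_norm.comp (continuous_const_smul (T := Φ.Alg) c)) (by fun_prop))
    fun x => by
      rw [← Φ.ofPre_smul, Φ.norm_ofPre, Φ.norm_ofPre]
      exact norm_smul_le (α := ℂ) (β := Φ.Pre) c x

instance [StarModule ℂ F] : CStarAlgebra Φ.Alg where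
  norm_mul_self_le := Φ.induction (isClosed_le (by fun_prop)
      (continuous_norm.comp (Φ.continuous_star.mul continuous_id))) fun x => by
    rw [← Φ.ofPre_star, ← Φ.ofPre_mul, Φ.norm_ofPre, Φ.norm_ofPre]
    exact Φ.norm_mul_self_le x
  star_smul c := Φ.induction
    (isClosed_eq (Φ.continuous_star.comp (continuous_const_smul (T := Φ.Alg) c))
      ((continuous_const_smul (T := Φ.Alg) (star c)).comp Φ.continuous_star)) fun x => by
    rw [← Φ.ofPre_smul, ← Φ.ofPre_star, ← Φ.ofPre_star, ← Φ.ofPre_smul, star_smul]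

section Extend

variable [StarModule ℂ F]

/-- The canonical `*`-homomorphism of `F` into its completion. -/
def RepFamily.incl : F →⋆ₐ[ℂ] Φ.Alg where
  toFun := Φ.ofPre
  map_one' := UniformSpace.Completion.coe_one Φ.Pre
  map_mul' := Φ.ofPre_mul
  map_zero' := UniformSpace.Completion.coe_zero
  map_add' := Φ.ofPre_add
  commutes' := Φ.ofPre_algebraMap
  map_star' := Φ.ofPre_star

theorem RepFamily.incl_eq {x y : F} (h : ∀ i, Φ.rep i x = Φ.rep i y) :
    Φ.incl x = Φ.incl y := by
  rw [← sub_eq_zero, ← map_sub, ← norm_le_zero_iff]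
  refine (Φ.norm_ofPre _).trans_le (Φ.seminorm_le le_rfl fun i => ?_)
  rw [map_sub, h i, sub_self, norm_zero]

def RepFamily.repCLM (i : ι) : Φ.Pre →L[ℂ] E i :=
  LinearMap.mkContinuous
    { toFun := fun x => Φ.rep i x
      map_add' := fun x y => map_add (Φ.rep i) x y
      map_smul' := fun c x => map_smul (Φ.rep i) c x } 1
    (fun x => (Φ.le_seminorm i x).trans_eq (one_mul _).symm)

def RepFamily.extendCLM (i : ι) : Φ.Alg →L[ℂ] E i := (Φ.repCLM i).fromCompletion

theorem RepFamily.extendCLM_ofPre (i : ι) (x : F) : Φ.extendCLM i (Φ.ofPre x) = Φ.rep i x :=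
  (Φ.repCLM i).fromCompletion_apply_coe x

/-- Each member of the family extends to the completion. -/
def RepFamily.extend (i : ι) : Φ.Alg →⋆ₐ[ℂ] E i where
  toFun := Φ.extendCLM i
  map_one' := (Φ.extendCLM_ofPre i 1).trans (map_one _)
  map_mul' := Φ.induction₂ (isClosed_eq (by fun_prop) (by fun_prop)) fun x y => by
    rw [← Φ.ofPre_mul, extendCLM_ofPre, extendCLM_ofPre, extendCLM_ofPre, map_mul]
  map_zero' := map_zero _
  map_add' := map_add _
  commutes' c := by
    rw [← Φ.ofPre_algebraMap, extendCLM_ofPre, AlgHomClass.commutes]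
  map_star' := Φ.induction
    (isClosed_eq ((Φ.extendCLM i).continuous.comp Φ.continuous_star) (by fun_prop)) fun x => by
    rw [← Φ.ofPre_star, extendCLM_ofPre, extendCLM_ofPre, map_star]

theorem RepFamily.extend_incl (i : ι) (x : F) : Φ.extend i (Φ.incl x) = Φ.rep i x :=
  Φ.extendCLM_ofPre i x

end Extend

end Completion

section Universal

/-- A family `(gen x)` of contractions satisfying the relations `rel` in some C*-algebra. -/
structure UnivRep (X : Type) (rel : ∀ (E : Type) [CStarAlgebra E], (X → E) → Prop) where
  carrier : Type
  [inst : CStarAlgebra carrier]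
  gen : X → carrier
  norm_le : ∀ x, ‖gen x‖ ≤ 1
  holds : rel carrier gen

attribute [instance] UnivRep.inst

variable (X : Type) (rel : ∀ (E : Type) [CStarAlgebra E], (X → E) → Prop)

/-- All contractive families satisfying `rel`, as representations of the free `*`-algebra. -/
def univFamily : RepFamily (FreeStarAlg X) (fun r : UnivRep X rel => r.carrier) where
  rep r := FreeStarAlg.lift r.gen
  bdd x := by
    suffices h : ∃ C : ℝ, 0 ≤ C ∧ ∀ r : UnivRep X rel, ‖FreeStarAlg.lift r.gen x‖ ≤ C by
      obtain ⟨C, -, hC⟩ := h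
      exact ⟨C, by rintro _ ⟨r, rfl⟩; exact hC r⟩
    induction x using FreeStarAlg.induction with
    | hc c =>
      refine ⟨‖c‖, norm_nonneg _, fun r => ?_⟩
      rw [AlgHomClass.commutes, Algebra.algebraMap_eq_smul_one]
      refine (norm_smul_le _ _).trans (mul_le_of_le_one_right (norm_nonneg _) ?_)
      rcases subsingleton_or_nontrivial r.carrier with _ | _
      · rw [Subsingleton.elim (1 : r.carrier) 0, norm_zero]; exact zero_le_one
      · exact CStarRing.norm_one.le
    | hl y =>
      refine ⟨1, zero_le_one, fun r => ?_⟩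
      rcases y with x | x
      · rw [FreeStarAlg.lift_inl]; exact r.norm_le x
      · rw [FreeStarAlg.lift_inr, norm_star]; exact r.norm_le x
    | hm a b h1 h2 =>
      obtain ⟨C, hC, h1⟩ := h1
      obtain ⟨C', hC', h2⟩ := h2
      refine ⟨C * C', mul_nonneg hC hC', fun r => ?_⟩
      rw [map_mul]
      exact (norm_mul_le _ _).trans (mul_le_mul (h1 r) (h2 r) (norm_nonneg _) hC)
    | ha a b h1 h2 =>
      obtain ⟨C, hC, h1⟩ := h1
      obtain ⟨C', hC', h2⟩ := h2
      refine ⟨C + C', add_nonneg hC hC', fun r => ?_⟩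
      rw [map_add]
      exact (norm_add_le _ _).trans (add_le_add (h1 r) (h2 r))

/-- The universal unital C*-algebra generated by contractions `x ∈ X` subject to `rel`: the
completion of the free `*`-algebra for the supremum of the norms in all representations. -/
def UnivCStar : Type := (univFamily X rel).Alg

instance : CStarAlgebra (UnivCStar X rel) := inferInstanceAs (CStarAlgebra (univFamily X rel).Alg)

variable {X}

/-- The canonical generators. -/
def UnivCStar.gen (x : X) : UnivCStar X rel :=
  (univFamily X rel).incl (FreeStarAlg.letter (Sum.inl x))

variable {rel}

/-- The universal property. -/
def UnivCStar.lift {E : Type} [CStarAlgebra E] (g : X → E) (hn : ∀ x, ‖g x‖ ≤ 1)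
    (hg : rel E g) : UnivCStar X rel →⋆ₐ[ℂ] E :=
  (univFamily X rel).extend (UnivRep.mk E g hn hg)

theorem UnivCStar.lift_gen {E : Type} [CStarAlgebra E] (g : X → E) (hn : ∀ x, ‖g x‖ ≤ 1)
    (hg : rel E g) (x : X) : UnivCStar.lift g hn hg (UnivCStar.gen rel x) = g x :=
  ((univFamily X rel).extend_incl (UnivRep.mk E g hn hg) _).trans (FreeStarAlg.lift_inl g x)

/-- The canonical map of the free `*`-algebra onto a dense subalgebra. -/
def UnivCStar.incl : FreeStarAlg X →⋆ₐ[ℂ] UnivCStar X rel := (univFamily X rel).incl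

theorem UnivCStar.incl_eq {a b : FreeStarAlg X}
    (h : ∀ r : UnivRep X rel, FreeStarAlg.lift r.gen a = FreeStarAlg.lift r.gen b) :
    UnivCStar.incl (rel := rel) a = UnivCStar.incl b := (univFamily X rel).incl_eq h

end Universal


section HilbertTensor

variable (H K : Type*) [NormedAddCommGroup H] [InnerProductSpace ℂ H]
  [NormedAddCommGroup K] [InnerProductSpace ℂ K]

/-- The Hilbert space tensor product, the completion of the algebraic one. -/
def HilbertTensor : Type _ := UniformSpace.Completion (H ⊗[ℂ] K)

instance : NormedAddCommGroup (HilbertTensor H K) :=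
  inferInstanceAs (NormedAddCommGroup (UniformSpace.Completion (H ⊗[ℂ] K)))
instance : InnerProductSpace ℂ (HilbertTensor H K) :=
  inferInstanceAs (InnerProductSpace ℂ (UniformSpace.Completion (H ⊗[ℂ] K)))
instance : CompleteSpace (HilbertTensor H K) :=
  inferInstanceAs (CompleteSpace (UniformSpace.Completion (H ⊗[ℂ] K)))

variable {H K}

/-- The inclusion of the algebraic tensor product. -/
def HilbertTensor.incl : H ⊗[ℂ] K →ₗᵢ[ℂ] HilbertTensor H K :=
  UniformSpace.Completion.toComplₗᵢ (𝕜 := ℂ) (E := H ⊗[ℂ] K)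

theorem HilbertTensor.induction {P : HilbertTensor H K → Prop} (hc : IsClosed {x | P x})
    (h : ∀ x : H ⊗[ℂ] K, P (HilbertTensor.incl x)) (x : HilbertTensor H K) : P x :=
  UniformSpace.Completion.induction_on (α := H ⊗[ℂ] K) x hc h

theorem HilbertTensor.induction₂ {P : HilbertTensor H K → HilbertTensor H K → Prop}
    (hc : IsClosed {x : HilbertTensor H K × HilbertTensor H K | P x.1 x.2})
    (h : ∀ x y : H ⊗[ℂ] K, P (HilbertTensor.incl x) (HilbertTensor.incl y))
    (x y : HilbertTensor H K) : P x y :=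
  UniformSpace.Completion.induction_on₂ (α := H ⊗[ℂ] K) (β := H ⊗[ℂ] K) x y hc h

/-- The elementary tensor `x ⊗ y`. -/
def htmul (x : H) (y : K) : HilbertTensor H K := HilbertTensor.incl (x ⊗ₜ[ℂ] y)

/-- The bounded operator `S ⊗ T`. -/
def opTensor (S : H →L[ℂ] H) (T : K →L[ℂ] K) : HilbertTensor H K →L[ℂ] HilbertTensor H K :=
  (TensorProduct.mapL S T).completion

theorem opTensor_incl (S : H →L[ℂ] H) (T : K →L[ℂ] K) (x : H ⊗[ℂ] K) :
    opTensor S T (HilbertTensor.incl x) = HilbertTensor.incl (TensorProduct.mapL S T x) :=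
  (TensorProduct.mapL S T).completion_apply_coe x

theorem opTensor_htmul (S : H →L[ℂ] H) (T : K →L[ℂ] K) (x : H) (y : K) :
    opTensor S T (htmul x y) = htmul (S x) (T y) :=
  opTensor_incl S T (x ⊗ₜ y)

theorem clm_ext_htmul {L : Type*} [NormedAddCommGroup L] [NormedSpace ℂ L]
    {U V : HilbertTensor H K →L[ℂ] L} (h : ∀ x y, U (htmul x y) = V (htmul x y)) : U = V := by
  ext z
  induction z using HilbertTensor.induction with
  | hc => exact isClosed_eq U.continuous V.continuous
  | h z =>
    induction z using TensorProduct.induction_on with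
    | zero => rw [map_zero, map_zero, map_zero]
    | tmul x y => exact h x y
    | add a b ha hb => rw [map_add, map_add, map_add, ha, hb]

theorem htmul_add_left (x x' : H) (y : K) : htmul (x + x') y = htmul x y + htmul x' y := by
  unfold htmul; rw [TensorProduct.add_tmul, map_add]

theorem htmul_add_right (x : H) (y y' : K) : htmul x (y + y') = htmul x y + htmul x y' := by
  unfold htmul; rw [TensorProduct.tmul_add, map_add]

theorem htmul_smul_left (c : ℂ) (x : H) (y : K) : htmul (c • x) y = c • htmul x y := by
  unfold htmul; rw [← TensorProduct.smul_tmul', map_smul]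

theorem htmul_smul_right (c : ℂ) (x : H) (y : K) : htmul x (c • y) = c • htmul x y := by
  unfold htmul; rw [TensorProduct.tmul_smul, map_smul]

theorem inner_htmul (x x' : H) (y y' : K) :
    inner ℂ (htmul x y) (htmul x' y') = inner ℂ x x' * inner ℂ y y' := by
  unfold htmul; rw [LinearIsometry.inner_map_map, TensorProduct.inner_tmul]

theorem opTensor_one : opTensor (1 : H →L[ℂ] H) (1 : K →L[ℂ] K) = 1 :=
  clm_ext_htmul fun x y => opTensor_htmul _ _ x y

theorem opTensor_mul (S S' : H →L[ℂ] H) (T T' : K →L[ℂ] K) :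
    opTensor S T * opTensor S' T' = opTensor (S * S') (T * T') :=
  clm_ext_htmul fun x y => by
    change opTensor S T (opTensor S' T' _) = _
    rw [opTensor_htmul, opTensor_htmul, opTensor_htmul]; rfl

theorem opTensor_add_left (S S' : H →L[ℂ] H) (T : K →L[ℂ] K) :
    opTensor (S + S') T = opTensor S T + opTensor S' T :=
  clm_ext_htmul fun x y => by
    rw [add_apply, opTensor_htmul, opTensor_htmul, opTensor_htmul,
      add_apply, htmul_add_left]

theorem opTensor_add_right (S : H →L[ℂ] H) (T T' : K →L[ℂ] K) :
    opTensor S (T + T') = opTensor S T + opTensor S T' :=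
  clm_ext_htmul fun x y => by
    rw [add_apply, opTensor_htmul, opTensor_htmul, opTensor_htmul,
      add_apply, htmul_add_right]

theorem opTensor_smul_left (c : ℂ) (S : H →L[ℂ] H) (T : K →L[ℂ] K) :
    opTensor (c • S) T = c • opTensor S T :=
  clm_ext_htmul fun x y => by
    rw [smul_apply, opTensor_htmul, opTensor_htmul,
      smul_apply, htmul_smul_left]

theorem opTensor_smul_right (c : ℂ) (S : H →L[ℂ] H) (T : K →L[ℂ] K) :
    opTensor S (c • T) = c • opTensor S T :=
  clm_ext_htmul fun x y => by
    rw [smul_apply, opTensor_htmul, opTensor_htmul,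
      smul_apply, htmul_smul_right]

theorem norm_opTensor_le (S : H →L[ℂ] H) (T : K →L[ℂ] K) : ‖opTensor S T‖ ≤ ‖S‖ * ‖T‖ := by
  refine ContinuousLinearMap.opNorm_le_bound _ (by positivity) fun z => ?_
  induction z using HilbertTensor.induction with
  | hc => apply isClosed_le <;> fun_prop
  | h z =>
    rw [opTensor_incl, LinearIsometry.norm_map, LinearIsometry.norm_map]
    exact (TensorProduct.mapL S T).le_of_opNorm_le (TensorProduct.norm_mapL_le S T) z

theorem opTensor_star [CompleteSpace H] [CompleteSpace K] (S : H →L[ℂ] H) (T : K →L[ℂ] K) :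
    star (opTensor S T) = opTensor (star S) (star T) := by
  symm
  refine (ContinuousLinearMap.eq_adjoint_iff (opTensor (star S) (star T)) (opTensor S T)).2 ?_
  intro z w
  induction z, w using HilbertTensor.induction₂ with
  | hc => apply isClosed_eq <;> fun_prop
  | h z w =>
    induction z using TensorProduct.induction_on with
    | zero => simp
    | add a b ha hb =>
      rw [map_add, map_add, inner_add_left, inner_add_left, ha, hb]
    | tmul x y =>
      induction w using TensorProduct.induction_on with
      | zero => simp
      | add a b ha hb =>
        rw [map_add, map_add, inner_add_right, inner_add_right, ha, hb]
      | tmul x' y' =>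
        change inner ℂ (opTensor _ _ (htmul x y)) (htmul x' y') =
          inner ℂ (htmul x y) (opTensor _ _ (htmul x' y'))
        rw [opTensor_htmul, opTensor_htmul, inner_htmul, inner_htmul,
          ContinuousLinearMap.star_eq_adjoint, ContinuousLinearMap.star_eq_adjoint,
          ContinuousLinearMap.adjoint_inner_left, ContinuousLinearMap.adjoint_inner_left]

variable [CompleteSpace H] [CompleteSpace K]

/-- The tensor product `π ⊗ σ` of two representations, on the algebraic tensor product. -/
def repTensor {A C : Type*} [CStarAlgebra A] [CStarAlgebra C]
    (π : A →⋆ₐ[ℂ] (H →L[ℂ] H)) (σ : C →⋆ₐ[ℂ] (K →L[ℂ] K)) :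
    A ⊗[ℂ] C →⋆ₐ[ℂ] (HilbertTensor H K →L[ℂ] HilbertTensor H K) :=
  let f : A ⊗[ℂ] C →ₗ[ℂ] (HilbertTensor H K →L[ℂ] HilbertTensor H K) :=
    TensorProduct.lift (LinearMap.mk₂ ℂ (fun a c => opTensor (π a) (σ c))
      (fun a a' c => by rw [map_add, opTensor_add_left])
      (fun r a c => by rw [map_smul, opTensor_smul_left])
      (fun a c c' => by rw [map_add, opTensor_add_right])
      (fun r a c => by rw [map_smul, opTensor_smul_right]))
  let g : A ⊗[ℂ] C →ₐ[ℂ] (HilbertTensor H K →L[ℂ] HilbertTensor H K) :=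
    Algebra.TensorProduct.algHomOfLinearMapTensorProduct f
      (fun a a' c c' => by
        change opTensor _ _ = opTensor _ _ * opTensor _ _
        rw [opTensor_mul, map_mul, map_mul])
      (by change opTensor _ _ = _; rw [map_one, map_one, opTensor_one])
  { g with
    map_star' := fun x => by
      change g (star x) = star (g x)
      induction x using TensorProduct.induction_on with
      | zero => rw [star_zero, map_zero, star_zero]
      | add a b ha hb => rw [star_add, map_add, map_add, star_add, ha, hb]
      | tmul a c =>
        rw [TensorProduct.star_tmul]
        change opTensor _ _ = star (opTensor _ _)
        rw [opTensor_star, map_star, map_star] }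

theorem repTensor_tmul {A C : Type*} [CStarAlgebra A] [CStarAlgebra C]
    (π : A →⋆ₐ[ℂ] (H →L[ℂ] H)) (σ : C →⋆ₐ[ℂ] (K →L[ℂ] K)) (a : A) (c : C) :
    repTensor π σ (a ⊗ₜ c) = opTensor (π a) (σ c) := rfl

end HilbertTensor

section MinTensor

attribute [local instance] CStarAlgebra.spectralOrder CStarAlgebra.spectralOrderedRing

/-- The states of a unital C*-algebra: the positive linear functionals `φ` with `φ(1) = 1`. -/
structure CStarState (A : Type*) [CStarAlgebra A] where
  toPLM : A →ₚ[ℂ] ℂ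
  map_one : toPLM 1 = 1

variable {A C : Type*} [CStarAlgebra A] [CStarAlgebra C]

/-- The value `φ(a)` of a state. -/
def CStarState.eval (φ : CStarState A) (a : A) : ℂ := φ.toPLM a

/-- The GNS Hilbert space of a state. -/
def CStarState.GNS (φ : CStarState A) : Type _ := φ.toPLM.GNS

instance (φ : CStarState A) : NormedAddCommGroup φ.GNS :=
  inferInstanceAs (NormedAddCommGroup φ.toPLM.GNS)
instance (φ : CStarState A) : InnerProductSpace ℂ φ.GNS :=
  inferInstanceAs (InnerProductSpace ℂ φ.toPLM.GNS)
instance (φ : CStarState A) : CompleteSpace φ.GNS :=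
  inferInstanceAs (CompleteSpace φ.toPLM.GNS)

/-- The GNS map `η : A → H_φ`. -/
def CStarState.η (φ : CStarState A) : A →ₗ[ℂ] φ.GNS :=
  (UniformSpace.Completion.toComplₗᵢ (𝕜 := ℂ) (E := φ.toPLM.PreGNS)).toLinearMap ∘ₗ
    φ.toPLM.toPreGNS.toLinearMap

/-- The GNS representation. -/
def CStarState.π (φ : CStarState A) : A →⋆ₐ[ℂ] (φ.GNS →L[ℂ] φ.GNS) := φ.toPLM.gnsStarAlgHom

theorem CStarState.inner_η (φ : CStarState A) (a b : A) :
    inner ℂ (φ.η a) (φ.η b) = φ.eval (star a * b) :=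
  UniformSpace.Completion.inner_coe (φ.toPLM.toPreGNS a) (φ.toPLM.toPreGNS b)

theorem CStarState.π_η (φ : CStarState A) (a b : A) : φ.π a (φ.η b) = φ.η (a * b) :=
  φ.toPLM.gnsNonUnitalStarAlgHom_apply_coe

theorem CStarState.denseRange_η (φ : CStarState A) : DenseRange φ.η :=
  UniformSpace.Completion.denseRange_coe (α := φ.toPLM.PreGNS)

variable (A C)

/-- The representations `π_φ ⊗ π_ψ` of the algebraic tensor product, `φ` and `ψ` running through
all states. -/
def minFamily : RepFamily (A ⊗[ℂ] C)
    (fun p : CStarState A × CStarState C =>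
      HilbertTensor p.1.GNS p.2.GNS →L[ℂ] HilbertTensor p.1.GNS p.2.GNS) where
  rep p := repTensor p.1.π p.2.π
  bdd x := by
    suffices h : ∃ B : ℝ, ∀ p : CStarState A × CStarState C, ‖repTensor p.1.π p.2.π x‖ ≤ B by
      obtain ⟨B, hB⟩ := h
      exact ⟨B, by rintro _ ⟨p, rfl⟩; exact hB p⟩
    induction x using TensorProduct.induction_on with
    | zero => exact ⟨0, fun p => by rw [map_zero, norm_zero]⟩
    | tmul a c =>
      refine ⟨‖a‖ * ‖c‖, fun p => ?_⟩
      rw [repTensor_tmul]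
      exact (norm_opTensor_le _ _).trans (mul_le_mul (NonUnitalStarAlgHom.norm_apply_le p.1.π a)
        (NonUnitalStarAlgHom.norm_apply_le p.2.π c) (norm_nonneg _) (norm_nonneg _))
    | add a b ha hb =>
      obtain ⟨B, h1⟩ := ha
      obtain ⟨B', h2⟩ := hb
      refine ⟨B + B', fun p => ?_⟩
      rw [map_add]
      exact (norm_add_le _ _).trans (add_le_add (h1 p) (h2 p))

/-- The minimal (spatial) C*-tensor product: the completion of the algebraic tensor product in
the tensor product of the two universal representations `⊕_φ π_φ` and `⊕_ψ π_ψ`. -/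
def MinTensor : Type _ := (minFamily A C).Alg

instance : CStarAlgebra (MinTensor A C) := inferInstanceAs (CStarAlgebra (minFamily A C).Alg)

variable {A C}

/-- The inclusion of the algebraic tensor product. -/
def MinTensor.incl : A ⊗[ℂ] C →⋆ₐ[ℂ] MinTensor A C := (minFamily A C).incl

/-- The elementary tensor `a ⊗ c`. -/
def MinTensor.tmul (a : A) (c : C) : MinTensor A C := MinTensor.incl (a ⊗ₜ c)

/-- The representation `π_φ ⊗ π_ψ` of the minimal tensor product. -/
def MinTensor.rep (φ : CStarState A) (ψ : CStarState C) :
    MinTensor A C →⋆ₐ[ℂ] (HilbertTensor φ.GNS ψ.GNS →L[ℂ] HilbertTensor φ.GNS ψ.GNS) :=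
  (minFamily A C).extend (φ, ψ)

theorem MinTensor.rep_tmul (φ : CStarState A) (ψ : CStarState C) (a : A) (c : C) :
    MinTensor.rep φ ψ (MinTensor.tmul a c) = opTensor (φ.π a) (ψ.π c) :=
  (minFamily A C).extend_incl (φ, ψ) (a ⊗ₜ c)

/-- The inclusion `a ↦ a ⊗ 1`. -/
def MinTensor.inl : A →⋆ₐ[ℂ] MinTensor A C where
  toFun a := MinTensor.tmul a 1
  map_one' := map_one (MinTensor.incl (A := A) (C := C))
  map_mul' a b := by
    unfold MinTensor.tmul
    rw [← map_mul, Algebra.TensorProduct.tmul_mul_tmul, mul_one]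
  map_zero' := by unfold MinTensor.tmul; rw [TensorProduct.zero_tmul, map_zero]
  map_add' a b := by unfold MinTensor.tmul; rw [TensorProduct.add_tmul, map_add]
  commutes' r := by
    unfold MinTensor.tmul
    exact AlgHomClass.commutes (MinTensor.incl (A := A) (C := C)) r
  map_star' a := by unfold MinTensor.tmul; rw [← map_star, TensorProduct.star_tmul, star_one]

/-- The inclusion `c ↦ 1 ⊗ c`. -/
def MinTensor.inr : C →⋆ₐ[ℂ] MinTensor A C where
  toFun c := MinTensor.tmul 1 c
  map_one' := map_one (MinTensor.incl (A := A) (C := C))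
  map_mul' a b := by
    unfold MinTensor.tmul
    rw [← map_mul, Algebra.TensorProduct.tmul_mul_tmul, mul_one]
  map_zero' := by unfold MinTensor.tmul; rw [TensorProduct.tmul_zero, map_zero]
  map_add' a b := by unfold MinTensor.tmul; rw [TensorProduct.tmul_add, map_add]
  commutes' r := by
    unfold MinTensor.tmul
    rw [Algebra.algebraMap_eq_smul_one, Algebra.algebraMap_eq_smul_one, TensorProduct.tmul_smul,
      map_smul]
    exact congrArg (r • ·) (map_one (MinTensor.incl (A := A) (C := C)))
  map_star' a := by unfold MinTensor.tmul; rw [← map_star, TensorProduct.star_tmul, star_one]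

theorem MinTensor.inl_mul_inr (a : A) (c : C) :
    (MinTensor.inl a * MinTensor.inr c : MinTensor A C) = MinTensor.tmul a c := by
  change MinTensor.tmul a 1 * MinTensor.tmul 1 c = _
  unfold MinTensor.tmul
  rw [← map_mul, Algebra.TensorProduct.tmul_mul_tmul, mul_one, one_mul]

theorem MinTensor.inr_mul_inl (a : A) (c : C) :
    (MinTensor.inr c * MinTensor.inl a : MinTensor A C) = MinTensor.tmul a c := by
  change MinTensor.tmul 1 c * MinTensor.tmul a 1 = _
  unfold MinTensor.tmul
  rw [← map_mul, Algebra.TensorProduct.tmul_mul_tmul, mul_one, one_mul]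

/-- A column of a matrix with `Uᴴ U = 1` consists of contractions. -/
theorem norm_entry_le_one {n : Type*} [Fintype n] (u : n → A) (h : ∑ k, star (u k) * u k = 1)
    (i : n) : ‖u i‖ ≤ 1 := by
  rcases subsingleton_or_nontrivial A with _ | _
  · rw [Subsingleton.elim (u i) 0, norm_zero]; exact zero_le_one
  have h1 : star (u i) * u i ≤ 1 := by
    rw [← h]
    exact Finset.single_le_sum (f := fun k => star (u k) * u k)
      (fun k _ => star_mul_self_nonneg (u k)) (Finset.mem_univ i)
  have h2 := CStarAlgebra.norm_le_norm_of_nonneg_of_le (star_mul_self_nonneg (u i)) h1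
  rw [CStarRing.norm_star_mul_self, CStarRing.norm_one] at h2
  nlinarith [norm_nonneg (u i)]

/-- Isometries whose range projections sum to `1` have orthogonal ranges. -/
theorem isometry_orthogonal {n : Type*} [Fintype n] [DecidableEq n] (S : n → A)
    (h1 : ∀ i, star (S i) * S i = 1) (h2 : ∑ k, S k * star (S k) = 1) (i j : n) (hij : i ≠ j) :
    star (S i) * S j = 0 := by
  have h3 : ∑ k, star (star (S k) * S j) * (star (S k) * S j) = 1 := by
    calc ∑ k, star (star (S k) * S j) * (star (S k) * S j)
        = star (S j) * (∑ k, S k * star (S k)) * S j := by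
          rw [Finset.mul_sum, Finset.sum_mul]
          refine Finset.sum_congr rfl fun k _ => ?_
          rw [star_mul, star_star]; noncomm_ring
      _ = 1 := by rw [h2, mul_one, h1]
  rw [← Finset.add_sum_erase _ _ (Finset.mem_univ j), h1 j, star_one, mul_one,
    add_eq_left, Finset.sum_eq_zero_iff_of_nonneg (fun k _ => star_mul_self_nonneg _)] at h3
  exact CStarRing.star_mul_self_eq_zero_iff _ |>.1
    (h3 i (Finset.mem_erase.2 ⟨hij, Finset.mem_univ i⟩))

end MinTensor

section Cuntz

variable (n : ℕ)

/-- `S_1, …, S_n` are isometries with `∑ S_k S_k* = 1`. -/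
def CuntzRel (E : Type) [CStarAlgebra E] (S : Fin n → E) : Prop :=
  (∀ k, star (S k) * S k = 1) ∧ ∑ k, S k * star (S k) = 1

/-- The Cuntz algebra `O_n`. (Isometries are contractions, so the universal C*-algebra of
contractions satisfying the relations is the universal C*-algebra of the relations.) -/
def Cuntz : Type := UnivCStar (Fin n) (CuntzRel n)

instance : CStarAlgebra (Cuntz n) := inferInstanceAs (CStarAlgebra (UnivCStar (Fin n) (CuntzRel n)))

variable {n}

/-- The generating isometries `S_1, …, S_n`. -/
def Cuntz.S (k : Fin n) : Cuntz n := UnivCStar.gen (CuntzRel n) k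

theorem Cuntz.rel : CuntzRel n (Cuntz n) Cuntz.S := by
  let s : Fin n → FreeStarAlg (Fin n) := fun k => FreeStarAlg.letter (Sum.inl k)
  let f : FreeStarAlg (Fin n) →⋆ₐ[ℂ] Cuntz n := UnivCStar.incl
  have hs : ∀ k, Cuntz.S k = f (s k) := fun k => rfl
  have hl : ∀ (r : UnivRep (Fin n) (CuntzRel n)) k, FreeStarAlg.lift r.gen (s k) = r.gen k :=
    fun r k => FreeStarAlg.lift_inl _ _
  constructor
  · intro k
    rw [hs, ← map_star, ← map_mul, ← map_one f]
    refine UnivCStar.incl_eq fun r => ?_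
    rw [map_mul, map_star, hl, map_one, r.holds.1]
  · simp_rw [hs, ← map_star, ← map_mul]
    rw [← map_sum, ← map_one f]
    refine UnivCStar.incl_eq fun r => ?_
    simp_rw [map_sum, map_mul, map_star, hl, map_one]
    exact r.holds.2

end Cuntz

section FreeUnitary

variable {n : ℕ} (Q : Matrix (Fin n) (Fin n) ℂ)

open Matrix in
/-- `u* u = 1 = u u*` and `uᵗ Q ū Q⁻¹ = 1 = Q ū Q⁻¹ uᵗ`, where `ū` is the matrix of adjoints. -/
def FreeUnitaryRel {E : Type} [Ring E] [StarRing E] [Algebra ℂ E]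
    (u : Matrix (Fin n) (Fin n) E) : Prop :=
  uᴴ * u = 1 ∧ u * uᴴ = 1 ∧
    uᵀ * Q.map (algebraMap ℂ E) * u.map star * (Q⁻¹).map (algebraMap ℂ E) = 1 ∧
    Q.map (algebraMap ℂ E) * u.map star * (Q⁻¹).map (algebraMap ℂ E) * uᵀ = 1

/-- The relations of `A_u(Q)` for a family indexed by pairs. -/
def FreeUnitaryRelFam (E : Type) [CStarAlgebra E] (v : Fin n × Fin n → E) : Prop :=
  FreeUnitaryRel Q (Matrix.of fun i j => v (i, j))

/-- The C*-algebra `A_u(Q)` of the free (universal) unitary quantum group, generated by the `n²`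
entries of `u`. (The entries of a unitary matrix are contractions.) -/
def FreeUnitary : Type :=
  UnivCStar (Fin n × Fin n) (FreeUnitaryRelFam Q)

instance : CStarAlgebra (FreeUnitary Q) :=
  inferInstanceAs (CStarAlgebra (UnivCStar (Fin n × Fin n) (FreeUnitaryRelFam Q)))

/-- The fundamental unitary `u = (u_ij)`. -/
def FreeUnitary.u : Matrix (Fin n) (Fin n) (FreeUnitary Q) :=
  Matrix.of fun i j => UnivCStar.gen (FreeUnitaryRelFam Q) (i, j)

theorem FreeUnitary.rel : FreeUnitaryRel Q (FreeUnitary.u Q) := by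
  let U : Matrix (Fin n) (Fin n) (FreeStarAlg (Fin n × Fin n)) :=
    Matrix.of fun i j => FreeStarAlg.letter (Sum.inl (i, j))
  let f : FreeStarAlg (Fin n × Fin n) →⋆ₐ[ℂ] FreeUnitary Q := UnivCStar.incl
  have hu : FreeUnitary.u Q = U.map f := rfl
  have key : ∀ W W' : Matrix (Fin n) (Fin n) (FreeStarAlg (Fin n × Fin n)),
      (∀ r : UnivRep (Fin n × Fin n) (FreeUnitaryRelFam Q),
        W.map (FreeStarAlg.lift r.gen) = W'.map (FreeStarAlg.lift r.gen)) → W.map f = W'.map f := by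
    intro W W' h
    ext i j
    exact UnivCStar.incl_eq fun r => congrFun (congrFun (h r) i) j
  have hmap : ∀ {E : Type} [CStarAlgebra E] (g : FreeStarAlg (Fin n × Fin n) →⋆ₐ[ℂ] E),
      ((U.conjTranspose * U).map g = (U.map g).conjTranspose * U.map g) ∧
      ((U * U.conjTranspose).map g = U.map g * (U.map g).conjTranspose) ∧
      ((U.transpose * Q.map (algebraMap ℂ (FreeStarAlg (Fin n × Fin n))) * U.map star *
          (Q⁻¹).map (algebraMap ℂ (FreeStarAlg (Fin n × Fin n)))).map g =
        (U.map g).transpose * Q.map (algebraMap ℂ E) * (U.map g).map star *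
          (Q⁻¹).map (algebraMap ℂ E)) ∧
      ((Q.map (algebraMap ℂ (FreeStarAlg (Fin n × Fin n))) * U.map star *
          (Q⁻¹).map (algebraMap ℂ (FreeStarAlg (Fin n × Fin n))) * U.transpose).map g =
        Q.map (algebraMap ℂ E) * (U.map g).map star *
          (Q⁻¹).map (algebraMap ℂ E) * (U.map g).transpose) ∧
      ((1 : Matrix (Fin n) (Fin n) (FreeStarAlg (Fin n × Fin n))).map g = 1) := by
    intro E _ g
    have hQ : ∀ P : Matrix (Fin n) (Fin n) ℂ,
        (P.map (algebraMap ℂ (FreeStarAlg (Fin n × Fin n)))).map g = P.map (algebraMap ℂ E) := by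
      intro P; ext i j; exact AlgHomClass.commutes g _
    have hst : (U.map star).map g = (U.map g).map star := by
      ext i j; exact map_star g _
    have hct : U.conjTranspose.map g = (U.map g).conjTranspose := by
      ext i j; exact map_star g _
    have htr : U.transpose.map g = (U.map g).transpose := rfl
    refine ⟨?_, ?_, ?_, ?_, ?_⟩
    · rw [Matrix.map_mul, hct]
    · rw [Matrix.map_mul, hct]
    · rw [Matrix.map_mul, Matrix.map_mul, Matrix.map_mul, hQ, hQ, hst, htr]
    · rw [Matrix.map_mul, Matrix.map_mul, Matrix.map_mul, hQ, hQ, hst, htr]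
    · exact Matrix.map_one _ (map_zero g) (map_one g)
  have hr : ∀ r : UnivRep (Fin n × Fin n) (FreeUnitaryRelFam Q),
      FreeUnitaryRel Q (U.map (FreeStarAlg.lift r.gen)) := by
    intro r
    have h := r.holds
    have e : U.map (FreeStarAlg.lift r.gen) = Matrix.of fun i j => r.gen (i, j) := by
      ext i j; exact FreeStarAlg.lift_inl _ _
    rw [e]; exact h
  obtain ⟨h1, h2, h3, h4, h5⟩ := hmap f
  rw [hu]
  refine ⟨?_, ?_, ?_, ?_⟩
  · rw [← h1, ← h5]
    refine key _ _ fun r => ?_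
    obtain ⟨g1, g2, g3, g4, g5⟩ := hmap (FreeStarAlg.lift r.gen)
    rw [g1, g5]; exact (hr r).1
  · rw [← h2, ← h5]
    refine key _ _ fun r => ?_
    obtain ⟨g1, g2, g3, g4, g5⟩ := hmap (FreeStarAlg.lift r.gen)
    rw [g2, g5]; exact (hr r).2.1
  · rw [← h3, ← h5]
    refine key _ _ fun r => ?_
    obtain ⟨g1, g2, g3, g4, g5⟩ := hmap (FreeStarAlg.lift r.gen)
    rw [g3, g5]; exact (hr r).2.2.1
  · rw [← h4, ← h5]
    refine key _ _ fun r => ?_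
    obtain ⟨g1, g2, g3, g4, g5⟩ := hmap (FreeStarAlg.lift r.gen)
    rw [g4, g5]; exact (hr r).2.2.2

theorem FreeUnitary.norm_le_one {E : Type} [CStarAlgebra E] {v : Matrix (Fin n) (Fin n) E}
    (h : FreeUnitaryRel Q v) (i j : Fin n) : ‖v i j‖ ≤ 1 := by
  refine norm_entry_le_one (fun k => v k j) ?_ i
  have := congrFun (congrFun h.1 j) j
  rw [Matrix.mul_apply, Matrix.one_apply_eq] at this
  exact this

/-- The universal property of `A_u(Q)`. -/
def FreeUnitary.lift {E : Type} [CStarAlgebra E] (v : Matrix (Fin n) (Fin n) E)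
    (h : FreeUnitaryRel Q v) : FreeUnitary Q →⋆ₐ[ℂ] E :=
  UnivCStar.lift (fun p => v p.1 p.2) (fun p => norm_le_one Q h p.1 p.2) h

theorem FreeUnitary.lift_u {E : Type} [CStarAlgebra E] (v : Matrix (Fin n) (Fin n) E)
    (h : FreeUnitaryRel Q v) (i j : Fin n) : FreeUnitary.lift Q v h (FreeUnitary.u Q i j) = v i j :=
  UnivCStar.lift_gen _ _ _ (i, j)

/-- A `*`-homomorphism preserves the relations. -/
theorem FreeUnitaryRel.map {E E' : Type} [CStarAlgebra E] [CStarAlgebra E']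
    {u : Matrix (Fin n) (Fin n) E} (hu : FreeUnitaryRel Q u) (f : E →⋆ₐ[ℂ] E') :
    FreeUnitaryRel Q (u.map f) := by
  have hQ : ∀ P : Matrix (Fin n) (Fin n) ℂ,
      (P.map (algebraMap ℂ E)).map f = P.map (algebraMap ℂ E') := by
    intro P; ext i j; exact AlgHomClass.commutes f _
  have hst : (u.map star).map f = (u.map f).map star := by
    ext i j; exact map_star f _
  have hct : u.conjTranspose.map f = (u.map f).conjTranspose := by
    ext i j; exact map_star f _
  have htr : u.transpose.map f = (u.map f).transpose := rfl
  have h1 : (1 : Matrix (Fin n) (Fin n) E).map f = 1 :=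
    Matrix.map_one _ (map_zero f) (map_one f)
  obtain ⟨a1, a2, a3, a4⟩ := hu
  refine ⟨?_, ?_, ?_, ?_⟩
  · rw [← hct, ← Matrix.map_mul, a1, h1]
  · rw [← hct, ← Matrix.map_mul, a2, h1]
  · rw [← hst, ← htr, ← hQ, ← hQ, ← Matrix.map_mul, ← Matrix.map_mul, ← Matrix.map_mul, a3, h1]
  · rw [← hst, ← htr, ← hQ, ← hQ, ← Matrix.map_mul, ← Matrix.map_mul, ← Matrix.map_mul, a4, h1]

/-- The product of two solutions with commuting entries is a solution. -/
theorem FreeUnitaryRel.mul {E : Type} [CStarAlgebra E] {u v : Matrix (Fin n) (Fin n) E}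
    (hu : FreeUnitaryRel Q u) (hv : FreeUnitaryRel Q v)
    (hc : ∀ i j k l, Commute (u i j) (v k l)) : FreeUnitaryRel Q (u * v) := by
  obtain ⟨a1, a2, a3, a4⟩ := hu
  obtain ⟨b1, b2, b3, b4⟩ := hv
  have hbar : (u * v).map star = u.map star * v.map star := by
    ext i j
    simp only [Matrix.map_apply, Matrix.mul_apply, star_sum, star_mul]
    refine Finset.sum_congr rfl fun k _ => ?_
    rw [← star_mul, ← star_mul, (hc i k k j).eq]
  have htr : (u * v).transpose = v.transpose * u.transpose := by
    ext i j
    simp only [Matrix.transpose_apply, Matrix.mul_apply]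
    exact Finset.sum_congr rfl fun k _ => (hc j k k i).eq
  have hqq : ∀ P R : Matrix (Fin n) (Fin n) ℂ, P * R = 1 →
      P.map (algebraMap ℂ E) * R.map (algebraMap ℂ E) = 1 := by
    intro P R h
    rw [← Matrix.map_mul, h]
    exact Matrix.map_one _ (map_zero _) (map_one _)
  have hq : Q⁻¹.map (algebraMap ℂ E) * Q.map (algebraMap ℂ E) = 1 ∧
      Q.map (algebraMap ℂ E) * Q⁻¹.map (algebraMap ℂ E) = 1 := by
    by_cases hd : IsUnit Q.det
    · exact ⟨hqq _ _ (Matrix.nonsing_inv_mul Q hd), hqq _ _ (Matrix.mul_nonsing_inv Q hd)⟩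
    · have h0 : Q⁻¹.map (algebraMap ℂ E) = 0 := by
        rw [Matrix.nonsing_inv_apply_not_isUnit Q hd]
        exact Matrix.map_zero _ (map_zero _)
      rw [h0, mul_zero] at a3
      rw [h0, mul_zero, zero_mul]
      exact ⟨a3, a3⟩
  refine ⟨?_, ?_, ?_, ?_⟩
  · rw [Matrix.conjTranspose_mul, Matrix.mul_assoc, ← Matrix.mul_assoc _ u v, a1, Matrix.one_mul, b1]
  · rw [Matrix.conjTranspose_mul, Matrix.mul_assoc, ← Matrix.mul_assoc v, b2, Matrix.one_mul, a2]
  · rw [hbar, htr]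
    generalize Q.map (algebraMap ℂ E) = q at *
    generalize Q⁻¹.map (algebraMap ℂ E) = q' at *
    have h : u.transpose * q * u.map star = q := by
      calc _ = (u.transpose * q * u.map star * q') * q := by
            rw [Matrix.mul_assoc _ q' q, hq.1, Matrix.mul_one]
        _ = q := by rw [a3, Matrix.one_mul]
    calc _ = v.transpose * (u.transpose * q * u.map star) * v.map star * q' := by
          simp only [Matrix.mul_assoc]
      _ = 1 := by rw [h, b3]
  · rw [hbar, htr]
    generalize Q.map (algebraMap ℂ E) = q at *
    generalize Q⁻¹.map (algebraMap ℂ E) = q' at *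
    have h : v.map star * q' * v.transpose = q' := by
      calc _ = q' * (q * v.map star * q' * v.transpose) := by
            simp only [← Matrix.mul_assoc]
            rw [hq.1, Matrix.one_mul]
        _ = q' := by rw [b4, Matrix.mul_one]
    calc _ = q * u.map star * (v.map star * q' * v.transpose) * u.transpose := by
          simp only [Matrix.mul_assoc]
      _ = 1 := by rw [h, a4]

end FreeUnitary

section Actions

variable {n : ℕ} (Q : Matrix (Fin n) (Fin n) ℂ)

/-- The comultiplication of `A_u(Q)`, `Δ(u_ij) = ∑_k u_ik ⊗ u_kj`. -/
def FreeUnitary.comul : FreeUnitary Q →⋆ₐ[ℂ] MinTensor (FreeUnitary Q) (FreeUnitary Q) :=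
  FreeUnitary.lift Q
    (Matrix.of fun i j => ∑ k, MinTensor.tmul (FreeUnitary.u Q i k) (FreeUnitary.u Q k j)) (by
      have h := FreeUnitaryRel.mul Q
        (FreeUnitaryRel.map Q (FreeUnitary.rel Q)
          (MinTensor.inl (A := FreeUnitary Q) (C := FreeUnitary Q)))
        (FreeUnitaryRel.map Q (FreeUnitary.rel Q)
          (MinTensor.inr (A := FreeUnitary Q) (C := FreeUnitary Q)))
        (fun i j k l => (MinTensor.inl_mul_inr _ _).trans (MinTensor.inr_mul_inl _ _).symm)
      have e : (Matrix.of fun i j => ∑ k,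
          MinTensor.tmul (FreeUnitary.u Q i k) (FreeUnitary.u Q k j)) =
          (FreeUnitary.u Q).map (MinTensor.inl (A := FreeUnitary Q) (C := FreeUnitary Q)) *
          (FreeUnitary.u Q).map (MinTensor.inr (A := FreeUnitary Q) (C := FreeUnitary Q)) := by
        ext i j
        simp only [Matrix.of_apply, Matrix.mul_apply, Matrix.map_apply, MinTensor.inl_mul_inr]
      rw [e]; exact h)

theorem FreeUnitary.comul_u (i j : Fin n) : FreeUnitary.comul Q (FreeUnitary.u Q i j) =
    ∑ k, MinTensor.tmul (FreeUnitary.u Q i k) (FreeUnitary.u Q k j) :=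
  FreeUnitary.lift_u Q _ _ i j

theorem cuntzAction_rel : CuntzRel n (MinTensor (Cuntz n) (FreeUnitary Q))
    (fun j => ∑ i, MinTensor.tmul (Cuntz.S i) (FreeUnitary.u Q i j)) := by
  let f := MinTensor.inl (A := Cuntz n) (C := FreeUnitary Q)
  let g := MinTensor.inr (A := Cuntz n) (C := FreeUnitary Q)
  have hfg : ∀ a c, g c * f a = f a * g c := fun a c =>
    (MinTensor.inr_mul_inl _ _).trans (MinTensor.inl_mul_inr _ _).symm
  have hS : ∀ i l, star (Cuntz.S i) * Cuntz.S l = if i = l then (1 : Cuntz n) else 0 := by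
    intro i l
    split_ifs with h
    · rw [h, Cuntz.rel.1]
    · exact isometry_orthogonal _ Cuntz.rel.1 Cuntz.rel.2 i l h
  obtain ⟨u1, u2, -, -⟩ := FreeUnitary.rel Q
  have hu1 : ∀ j, ∑ i, star (FreeUnitary.u Q i j) * FreeUnitary.u Q i j = 1 := by
    intro j
    have := congrFun (congrFun u1 j) j
    rw [Matrix.mul_apply, Matrix.one_apply_eq] at this
    exact this
  have hu2 : ∀ i l, ∑ j, FreeUnitary.u Q i j * star (FreeUnitary.u Q l j) =
      if i = l then 1 else 0 := by
    intro i l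
    have := congrFun (congrFun u2 i) l
    rw [Matrix.mul_apply, Matrix.one_apply] at this
    exact this
  simp_rw [← MinTensor.inl_mul_inr]
  change (∀ k, star (∑ i, f (Cuntz.S i) * g (FreeUnitary.u Q i k)) *
    (∑ i, f (Cuntz.S i) * g (FreeUnitary.u Q i k)) = 1) ∧
    ∑ k, (∑ i, f (Cuntz.S i) * g (FreeUnitary.u Q i k)) *
      star (∑ i, f (Cuntz.S i) * g (FreeUnitary.u Q i k)) = 1
  constructor
  · intro j
    rw [star_sum, Finset.sum_mul_sum]
    calc _ = ∑ i, ∑ l, f (star (Cuntz.S i) * Cuntz.S l) *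
          g (star (FreeUnitary.u Q i j) * FreeUnitary.u Q l j) := by
          refine Finset.sum_congr rfl fun i _ => Finset.sum_congr rfl fun l _ => ?_
          rw [star_mul, ← map_star, ← map_star, map_mul, map_mul, hfg, mul_assoc, mul_assoc,
            ← mul_assoc (g _) (f _), hfg, mul_assoc]
      _ = ∑ i, g (star (FreeUnitary.u Q i j) * FreeUnitary.u Q i j) := by
          refine Finset.sum_congr rfl fun i _ => ?_
          rw [Finset.sum_eq_single i]
          · rw [hS, if_pos rfl, map_one, one_mul]
          · intro l _ hl
            rw [hS, if_neg (Ne.symm hl), map_zero, zero_mul]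
          · intro h; exact absurd (Finset.mem_univ i) h
      _ = 1 := by rw [← map_sum, hu1, map_one]
  · calc _ = ∑ j, ∑ i, ∑ l, f (Cuntz.S i * star (Cuntz.S l)) *
          g (FreeUnitary.u Q i j * star (FreeUnitary.u Q l j)) := by
          refine Finset.sum_congr rfl fun j _ => ?_
          rw [star_sum, Finset.sum_mul_sum]
          refine Finset.sum_congr rfl fun i _ => Finset.sum_congr rfl fun l _ => ?_
          rw [star_mul, ← map_star, ← map_star, map_mul, map_mul, hfg, mul_assoc, mul_assoc,
            ← mul_assoc (g _) (f _), hfg, mul_assoc]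
      _ = ∑ i, ∑ l, f (Cuntz.S i * star (Cuntz.S l)) *
          g (∑ j, FreeUnitary.u Q i j * star (FreeUnitary.u Q l j)) := by
          rw [Finset.sum_comm]
          refine Finset.sum_congr rfl fun i _ => ?_
          rw [Finset.sum_comm]
          refine Finset.sum_congr rfl fun l _ => ?_
          rw [map_sum, Finset.mul_sum]
      _ = ∑ i, f (Cuntz.S i * star (Cuntz.S i)) := by
          refine Finset.sum_congr rfl fun i _ => ?_
          rw [Finset.sum_eq_single i]
          · rw [hu2, if_pos rfl, map_one, mul_one]
          · intro l _ hl
            rw [hu2, if_neg (Ne.symm hl), map_zero, mul_zero]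
          · intro h; exact absurd (Finset.mem_univ i) h
      _ = 1 := by rw [← map_sum, Cuntz.rel.2, map_one]

/-- The action of `A_u(Q)` on `O_n`, `τ(S_j) = ∑_i S_i ⊗ u_ij`. -/
def cuntzAction : Cuntz n →⋆ₐ[ℂ] MinTensor (Cuntz n) (FreeUnitary Q) :=
  UnivCStar.lift (fun j => ∑ i, MinTensor.tmul (Cuntz.S i) (FreeUnitary.u Q i j))
    (fun j => norm_entry_le_one (fun _ : Unit => _)
      (by rw [Fintype.sum_unique]; exact (cuntzAction_rel Q).1 j) ())
    (cuntzAction_rel Q)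

theorem cuntzAction_S (j : Fin n) :
    cuntzAction Q (Cuntz.S j) = ∑ i, MinTensor.tmul (Cuntz.S i) (FreeUnitary.u Q i j) :=
  UnivCStar.lift_gen _ _ _ j

end Actions

section SpectralTriple

variable {H : Type*} [NormedAddCommGroup H] [InnerProductSpace ℂ H] [CompleteSpace H]

/-- `R = (D - z)⁻¹` for the (unbounded) operator `D`. -/
structure IsResolventAt (D : H →ₗ.[ℂ] H) (z : ℂ) (R : H →L[ℂ] H) : Prop where
  mem : ∀ x, R x ∈ D.domain
  right_inv : ∀ x, D ⟨R x, mem x⟩ - z • R x = x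
  left_inv : ∀ x : D.domain, R (D x - z • (x : H)) = x

/-- `T` preserves the domain of `D`, and `[D, T]` is bounded there by `M`. As the domain is dense,
this says that `[D, T]` extends to a bounded operator of norm at most `M`. -/
def HasCommutatorBound (D : H →ₗ.[ℂ] H) (T : H →L[ℂ] H) (M : ℝ) : Prop :=
  ∃ hT : ∀ x ∈ D.domain, T x ∈ D.domain,
    ∀ x : D.domain, ‖D ⟨T x, hT x x.2⟩ - T (D x)‖ ≤ M * ‖(x : H)‖

/-- `(H, π, D)` is a spectral triple for the `*`-algebra `𝒜 ⊆ A`: `D` is self-adjoint with compact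
resolvent and has bounded commutators with `π(a)`, `a ∈ 𝒜`. -/
structure IsSpectralTriple {A : Type*} [CStarAlgebra A] (𝒜 : Set A)
    (π : A →⋆ₐ[ℂ] (H →L[ℂ] H)) (D : H →ₗ.[ℂ] H) : Prop where
  selfAdjoint : IsSelfAdjoint D
  compact_resolvent : ∃ z R, IsResolventAt D z R ∧ IsCompactOperator R
  bounded_commutator : ∀ a ∈ 𝒜, ∃ M, HasCommutatorBound D (π a) M

/-- `T` is trace class: `∑ ⟪b_i, |T| b_i⟫ < ∞` for orthonormal bases `b`. -/
def IsTraceClass (T : H →L[ℂ] H) : Prop :=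
  ∀ (w : Set H) (b : HilbertBasis w ℂ H),
    Summable fun i => (inner ℂ (b i) (CFC.abs T (b i))).re

/-- The self-adjoint operator `D` is `p`-summable: `(1 + D²)^(-p/2)` is trace class. Here
`(1 + D²)⁻¹ = R* R` with `R = (D - i)⁻¹`. -/
def IsPSummable (D : H →ₗ.[ℂ] H) (p : ℝ) : Prop :=
  ∃ R, IsResolventAt D Complex.I R ∧ IsTraceClass ((star R * R) ^ (p / 2))

end SpectralTriple

section Dynamics

variable {A C : Type*} [CStarAlgebra A] [CStarAlgebra C]
  (Δ : C →⋆ₐ[ℂ] MinTensor C C) (τ : A →⋆ₐ[ℂ] MinTensor A C)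

/-- The cyclic vector of the GNS representation. -/
def CStarState.Ω (φ : CStarState A) : φ.GNS := φ.η 1

/-- The product functional `φ ⊗ ψ` on the minimal tensor product. -/
def productState (φ : CStarState A) (ψ : CStarState C) (x : MinTensor A C) : ℂ :=
  inner ℂ (htmul φ.Ω ψ.Ω) (MinTensor.rep φ ψ x (htmul φ.Ω ψ.Ω))

/-- The state `ρ` is invariant: `(ρ ⊗ id) τ(a) = ρ(a) 1` for all `a`, an identity in `C` tested
against the states `ψ` of `C`. -/
def IsInvariantState (ρ : CStarState A) : Prop :=
  ∀ (a : A) (ψ : CStarState C), productState ρ ψ (τ a) = ρ.eval a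

/-- `v` is (the matrix of) an irreducible finite-dimensional unitary representation of the quantum
group with comultiplication `Δ`. -/
structure IsIrreducibleUnitaryRep {m : ℕ} (v : Matrix (Fin m) (Fin m) C) : Prop where
  pos : 0 < m
  star_mul : v.conjTranspose * v = 1
  mul_star : v * v.conjTranspose = 1
  comul : ∀ i j, Δ (v i j) = ∑ k, MinTensor.tmul (v i k) (v k j)
  irreducible : ∀ T : Matrix (Fin m) (Fin m) ℂ,
    T.map (algebraMap ℂ C) * v = v * T.map (algebraMap ℂ C) → ∃ c : ℂ, T = c • 1

/-- The `*`-subalgebra `A(G) ⊆ C(G)` generated by the matrix entries of the irreducible unitary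
representations. -/
def matrixCoefficients : StarSubalgebra ℂ C :=
  StarAlgebra.adjoin ℂ {c | ∃ (m : ℕ) (v : Matrix (Fin m) (Fin m) C),
    IsIrreducibleUnitaryRep Δ v ∧ ∃ i j, c = v i j}

/-- The dense `*`-subalgebra `𝒜 = {a ∈ A : τ(a) ∈ A ⊗_alg A(G)}`. -/
def algebraicElements : Set A :=
  {a | τ a ∈ Submodule.span ℂ
    {x : MinTensor A C | ∃ b : A, ∃ c ∈ matrixCoefficients Δ, x = MinTensor.tmul b c}}

/-- `u` is the unitary `u_τ` on `H_ρ ⊗ C(G)` induced by `τ`, that is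
`u_τ (η(a) ⊗ 1) = (η ⊗ id) τ(a)`. It is given by its images `u ψ` in the GNS representations of
all states `ψ` of `C(G)`, which are jointly faithful: `u ψ` is the unitary on `H_ρ ⊗ H_ψ` with
`η(a) ⊗ ξ ↦ (π_ρ ⊗ π_ψ)(τ(a)) (Ω ⊗ ξ)`. -/
def IsInducedUnitary (ρ : CStarState A)
    (u : ∀ ψ : CStarState C, HilbertTensor ρ.GNS ψ.GNS →L[ℂ] HilbertTensor ρ.GNS ψ.GNS) : Prop :=
  ∀ ψ : CStarState C, u ψ ∈ unitary (HilbertTensor ρ.GNS ψ.GNS →L[ℂ] HilbertTensor ρ.GNS ψ.GNS) ∧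
    ∀ (a : A) (ξ : ψ.GNS), u ψ (htmul (ρ.η a) ξ) = MinTensor.rep ρ ψ (τ a) (htmul ρ.Ω ξ)

/-- The self-adjoint operator `D` on `H_ρ` is equivariant: `D ⊗ 1` commutes with `u_τ`. For the
unbounded operator `D` this means that `(D - i)⁻¹ ⊗ 1` commutes with `u_τ`. -/
def IsEquivariant (ρ : CStarState A) (D : ρ.GNS →ₗ.[ℂ] ρ.GNS) : Prop :=
  ∃ u, IsInducedUnitary τ ρ u ∧ ∃ R, IsResolventAt D Complex.I R ∧
    ∀ ψ : CStarState C, Commute (opTensor R (1 : ψ.GNS →L[ℂ] ψ.GNS)) (u ψ)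

/-- The class of equivariant spectral triples `(H_ρ, π_ρ, D)` for `𝒜`. -/
structure IsEquivariantSpectralTriple (ρ : CStarState A) (D : ρ.GNS →ₗ.[ℂ] ρ.GNS) : Prop where
  spectralTriple : IsSpectralTriple (algebraicElements Δ τ) ρ.π D
  equivariant : IsEquivariant τ ρ D

/-- The spectral dimension of the system `(A, G, τ)`: the infimum of all `p > 0` for which some
equivariant spectral triple on the GNS space of the invariant state is `p`-summable
(`∞` if there is none). -/
def spectralDimension : ENNReal :=
  sInf {p | ∃ q : ℝ, 0 < q ∧ p = ENNReal.ofReal q ∧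
    ∃ ρ : CStarState A, IsInvariantState τ ρ ∧
      ∃ D : ρ.GNS →ₗ.[ℂ] ρ.GNS, IsEquivariantSpectralTriple Δ τ ρ D ∧ IsPSummable D q}

end Dynamics

section SpectralSubspaces

variable {n : ℕ}

/-- `S_α = S_{i_1} ⋯ S_{i_r}` for the multi-index `α = (i_1, …, i_r)`. -/
def Cuntz.word {r : ℕ} (α : Fin r → Fin n) : Cuntz n := (List.ofFn fun k => Cuntz.S (α k)).prod

/-- The span `H_{rs}` of the vectors `S_α S_β*`, `ℓ(α) = r`, `ℓ(β) = s`, in the GNS space. -/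
def Cuntz.levelSpan (ρ : CStarState (Cuntz n)) (r s : ℕ) : Submodule ℂ ρ.GNS :=
  Submodule.span ℂ (Set.range fun p : (Fin r → Fin n) × (Fin s → Fin n) =>
    ρ.η (Cuntz.word p.1 * star (Cuntz.word p.2)))

/-- The spectral subspaces. Since `S_α S_β* = ∑_i S_α S_i S_i* S_β*`, the space `H_{rs}` is contained
in `H_{r+1,s+1}`; the spectral subspace is the part of `H_{rs}` orthogonal to `H_{r-1,s-1}`. -/
def Cuntz.spectralSubspace (ρ : CStarState (Cuntz n)) : ℕ → ℕ → Submodule ℂ ρ.GNS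
  | r + 1, s + 1 => Cuntz.levelSpan ρ (r + 1) (s + 1) ⊓ (Cuntz.levelSpan ρ r s)ᗮ
  | r, s => Cuntz.levelSpan ρ r s

end SpectralSubspaces

end NCG

end

open NCG
open scoped ComplexOrder

/-! Equivariance leaves `D` a single number on each `K_{rs}`, bounded commutators let these numbers
grow at most linearly in `r` and `s`, and the dimensions grow exponentially. Already the `n^r`
orthonormal vectors `S_α Ω` with `|α| = r` then make the trace of `(1+D²)^(-p/2)` diverge for every
`p`.

Scalarity on `K_{rs}`. `D` is replaced by the bounded operator `R = (D - i)⁻¹`. Instead of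
decomposing tensor products of `u` and its conjugate into irreducibles, equivariance is tested
against explicit representations of `A_u(Q)`. A unitary change of generators makes `Q` diagonal with
entries `q_i`; a representation is then a matrix `v` of operators with `IsModel q v`. Write `s_i`
for the represented new generators. Three models suffice. (1) The diagonal model from the regular
representation of the free group. It attaches to `s_α s_β* Ω` the group element `x_α x_β⁻¹`; vectors
with different group elements are orthogonal and `R` does not connect them
(`IsCovariant.inner_eq_zero`). (2) A model that mixes two letters `i`, `j` only, built from a
representation of `SU_z(2)` with `z² = q_j / q_i` (`exists_isMixing`). (3) The level model over a
given `v`. Every letter moves a counter in `ℤ` one step up, every adjoint one step down, and `v`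
acts only between levels `0` and `1`. The initial level therefore selects which letter of `α`, or of
`β`, or which pair of opposite letters, is altered.

Applying (3) to the last letters and using `∑ q_k v_ki v_kj* = 0` shows that removing a common last
letter `i` costs the factor `q_i` in suitable inner products, with or without `R`
(`IsCovariantSystem.inner_concat`). This determines the inner products of words with left parts of
equal length, hence orthogonality and dimensions of the `K_{rs}`. It also shows that words whose
last letters differ (reduced pairs) give eigenvectors of `R`
(`IsCovariantSystem.exists_eigenvalue`). Altering single letters carries the eigenvalue to all
reduced pairs of the same lengths (`IsCovariantSystem.eigen_reduced`) and to the vectors `s_{αi}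
s_{βi}* Ω - q_i s_α s_β* Ω` (`IsCovariantSystem.eigen_diagonal`). These vectors span `K_{rs}`, so
`R`, and with it `D`, is scalar there.

Growth. For suitable `x ∈ K_{rs}` the vector `S_i x` lies in `K_{r+1,s}`, and `[D,S_i]x = (d(r+1,s)
- d(r,s)) S_i x` bounds one step by `M`. For a step in `s` with `r = 0` one uses all `S_i* x ∈
K_{0,s+1}` together with `∑ ‖S_i* x‖² = ‖x‖²`, which gives `√n M`. That the commutators with `S_i`
are bounded at all comes from the irreducibility of `u`, again read off from the models. -/

noncomputable section

namespace NCG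

open scoped InnerProductSpace TensorProduct

/-! ### Words in operators and their adjoints. -/

section WordVec

variable {n : ℕ} {H : Type*} [NormedAddCommGroup H] [InnerProductSpace ℂ H] [CompleteSpace H]

/-- The vector `t_α t_β* x` for a family of operators `t` and words `α`, `β`. -/
def wordVec (t : Fin n → H →L[ℂ] H) (α β : List (Fin n)) (x : H) : H :=
  (α.map t).prod (star (β.map t).prod x)

theorem wordVec_nil_nil (t : Fin n → H →L[ℂ] H) (x : H) : wordVec t [] [] x = x := by
  simp [wordVec]

theorem wordVec_cons_left (t : Fin n → H →L[ℂ] H) (i : Fin n) (α β : List (Fin n)) (x : H) :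
    wordVec t (i :: α) β x = t i (wordVec t α β x) := by
  simp [wordVec]

theorem wordVec_append_left (t : Fin n → H →L[ℂ] H) (α α' β : List (Fin n)) (x : H) :
    wordVec t (α ++ α') β x = wordVec t α [] (wordVec t α' β x) := by
  simp [wordVec]

/-- The adjoint reverses the order: the first letter of `β` acts first on `x`, and the last letters
of `α` and `β` are neighbours in the middle of `t_α t_β*`. -/
theorem wordVec_append_right (t : Fin n → H →L[ℂ] H) (α β β' : List (Fin n)) (x : H) :
    wordVec t α (β ++ β') x = wordVec t α β' (wordVec t [] β x) := by
  simp [wordVec, star_mul]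

theorem wordVec_nil_cons (t : Fin n → H →L[ℂ] H) (j : Fin n) (β : List (Fin n)) (x : H) :
    wordVec t [] (j :: β) x = wordVec t [] β (star (t j) x) := by
  simp [wordVec, star_mul]

theorem wordVec_sum {ι : Type*} (F : Finset ι) (t : Fin n → H →L[ℂ] H) (α β : List (Fin n))
    (x : ι → H) : wordVec t α β (∑ k ∈ F, x k) = ∑ k ∈ F, wordVec t α β (x k) := by
  simp [wordVec, map_sum]

theorem wordVec_left_right (t : Fin n → H →L[ℂ] H) (α β : List (Fin n)) (x : H) :
    wordVec t α β x = wordVec t α [] (wordVec t [] β x) := by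
  simp [wordVec]

end WordVec

/-! ### Hilbert space representations of `A_u(diag q)` and the operators they induce. -/

section Models

variable {n : ℕ}

/-- A matrix over `B(L)` satisfying the relations of `A_u(diag q)`. -/
structure IsModel (q : Fin n → ℝ) {L : Type*} [NormedAddCommGroup L] [InnerProductSpace ℂ L]
    [CompleteSpace L] (v : Fin n → Fin n → (L →L[ℂ] L)) : Prop where
  star_mul : ∀ i j, ∑ k, star (v k i) * v k j = if i = j then 1 else 0
  mul_star : ∀ i j, ∑ k, v i k * star (v j k) = if i = j then 1 else 0
  weight_mul_star : ∀ i j, ∑ k, (q k : ℂ) • (v k i * star (v k j)) =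
    if i = j then (q i : ℂ) • (1 : L →L[ℂ] L) else 0
  weight_star_mul : ∀ i j, ∑ k, (q k : ℂ)⁻¹ • (star (v i k) * v j k) =
    if i = j then (q i : ℂ)⁻¹ • (1 : L →L[ℂ] L) else 0

variable {H L : Type*} [NormedAddCommGroup H] [InnerProductSpace ℂ H] [CompleteSpace H]
  [NormedAddCommGroup L] [InnerProductSpace ℂ L] [CompleteSpace L]

/-- The operators `∑ i, s_i ⊗ v_ij`. -/
def coact (s : Fin n → (H →L[ℂ] H)) (v : Fin n → Fin n → (L →L[ℂ] L)) (j : Fin n) :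
    HilbertTensor H L →L[ℂ] HilbertTensor H L :=
  ∑ i, opTensor (s i) (v i j)

theorem coact_htmul (s : Fin n → (H →L[ℂ] H)) (v : Fin n → Fin n → (L →L[ℂ] L)) (j : Fin n)
    (x : H) (ξ : L) : coact s v j (htmul x ξ) = ∑ i, htmul (s i x) (v i j ξ) := by
  simp [coact, opTensor_htmul]

theorem star_coact_htmul (s : Fin n → (H →L[ℂ] H)) (v : Fin n → Fin n → (L →L[ℂ] L)) (j : Fin n)
    (x : H) (ξ : L) :
    star (coact s v j) (htmul x ξ) = ∑ i, htmul (star (s i) x) (star (v i j) ξ) := by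
  simp [coact, opTensor_htmul, opTensor_star, star_sum]

end Models

/-! ### Weighted shifts, permutations and projections on `ℓ²`. -/

section SquareSummable

/-- The Hilbert space `ℓ²(I)`. -/
abbrev l2 (I : Type*) := lp (fun _ : I => ℂ) 2

variable {I : Type*}

/-- Injectivity is needed only where the weight is nonzero: each `|f i|²` is then counted at most
once. -/
theorem memlp_weighted (τ : I → I) (w : I → ℂ) (hτ : Set.InjOn τ {j | w j ≠ 0})
    (hw : ∀ j, ‖w j‖ ≤ 1) (f : l2 I) (F : Finset I) :
    ∑ j ∈ F, ‖w j * f (τ j)‖ ^ (2 : ENNReal).toReal ≤ ‖f‖ ^ (2 : ENNReal).toReal := by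
  classical
  have h2 : (0 : ℝ) < (2 : ENNReal).toReal := by norm_num
  calc ∑ j ∈ F, ‖w j * f (τ j)‖ ^ (2 : ENNReal).toReal
      = ∑ j ∈ F with w j ≠ 0, ‖w j * f (τ j)‖ ^ (2 : ENNReal).toReal := by
        refine (Finset.sum_filter_of_ne (p := fun j => w j ≠ 0) fun j _ hj h0 => hj ?_).symm
        rw [h0, zero_mul, norm_zero, Real.zero_rpow h2.ne']
    _ ≤ ∑ j ∈ F with w j ≠ 0, ‖f (τ j)‖ ^ (2 : ENNReal).toReal := by
        refine Finset.sum_le_sum fun j _ => Real.rpow_le_rpow (norm_nonneg _) ?_ h2.le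
        rw [norm_mul]
        exact mul_le_of_le_one_left (norm_nonneg _) (hw j)
    _ = ∑ i ∈ (F.filter fun j => w j ≠ 0).image τ, ‖f i‖ ^ (2 : ENNReal).toReal := by
        rw [Finset.sum_image]
        intro a ha b hb hab
        exact hτ (by simpa using (Finset.mem_filter.1 ha).2)
          (by simpa using (Finset.mem_filter.1 hb).2) hab
    _ ≤ _ := lp.sum_rpow_le_norm_rpow h2 f _

/-- The operator `f ↦ (j ↦ w j * f (τ j))` on `ℓ²(I)`. -/
def l2.weighted (τ : I → I) (w : I → ℂ) (hτ : Set.InjOn τ {j | w j ≠ 0})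
    (hw : ∀ j, ‖w j‖ ≤ 1) : l2 I →L[ℂ] l2 I :=
  LinearMap.mkContinuous
    { toFun := fun f => ⟨fun j => w j * f (τ j), memℓp_gen' (memlp_weighted τ w hτ hw f)⟩
      map_add' := fun f g => by ext j; exact mul_add (w j) (f (τ j)) (g (τ j))
      map_smul' := fun c f => by ext j; exact mul_left_comm (w j) c (f (τ j)) } 1
    (fun f => by
      rw [one_mul]
      exact lp.norm_le_of_forall_sum_le (by norm_num) (norm_nonneg _)
        (memlp_weighted τ w hτ hw f))

theorem l2.weighted_apply (τ : I → I) (w : I → ℂ) (hτ : Set.InjOn τ {j | w j ≠ 0})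
    (hw : ∀ j, ‖w j‖ ≤ 1) (f : l2 I) (j : I) : l2.weighted τ w hτ hw f j = w j * f (τ j) := rfl

/-- The basis vectors of `ℓ²(I)`. -/
def l2.e [DecidableEq I] (i : I) : l2 I := lp.single 2 i (1 : ℂ)

theorem l2.e_apply [DecidableEq I] (i j : I) : l2.e i j = if j = i then (1 : ℂ) else 0 := by
  unfold l2.e
  rw [lp.single_apply, Pi.single_apply]

theorem l2.inner_e_left [DecidableEq I] (i : I) (f : l2 I) : inner ℂ (l2.e i) f = f i := by
  unfold l2.e
  rw [lp.inner_single_left]; simp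

theorem l2.inner_e_e [DecidableEq I] (i j : I) :
    inner ℂ (l2.e i) (l2.e j) = if i = j then (1 : ℂ) else 0 := by
  rw [l2.inner_e_left, l2.e_apply]

theorem l2.clm_ext {E : Type*} [NormedAddCommGroup E] [NormedSpace ℂ E] [DecidableEq I]
    {f g : l2 I →L[ℂ] E} (h : ∀ i, f (l2.e i) = g (l2.e i)) : f = g := by
  refine lp.ext_continuousLinearMap (by norm_num) fun i => ?_
  ext
  exact h i

theorem l2.star_eq [DecidableEq I] {f g : l2 I →L[ℂ] l2 I}
    (h : ∀ i j, g (l2.e i) j = star (f (l2.e j) i)) : star f = g := by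
  refine l2.clm_ext fun i => ?_
  ext j
  rw [← l2.inner_e_left j, ContinuousLinearMap.star_eq_adjoint,
    ContinuousLinearMap.adjoint_inner_right, ← inner_conj_symm, l2.inner_e_left, h]
  rfl

/-- The unitary on `ℓ²(I)` induced by a permutation of `I`. -/
def l2.perm (σ : Equiv.Perm I) : l2 I →L[ℂ] l2 I :=
  l2.weighted σ.symm (fun _ => 1) σ.symm.injective.injOn (by simp)

theorem l2.perm_e [DecidableEq I] (σ : Equiv.Perm I) (i : I) :
    l2.perm σ (l2.e i) = l2.e (σ i) := by
  ext j
  unfold l2.perm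
  rw [l2.weighted_apply, l2.e_apply, l2.e_apply, one_mul]
  simp [Equiv.symm_apply_eq]

theorem l2.star_perm (σ : Equiv.Perm I) : star (l2.perm σ) = l2.perm σ.symm := by
  classical
  refine l2.star_eq fun i j => ?_
  rw [l2.perm_e, l2.perm_e, l2.e_apply, l2.e_apply]
  by_cases h : j = σ.symm i
  · simp [h]
  · rw [if_neg h, if_neg, star_zero]
    rintro rfl
    simp at h

theorem l2.perm_mul (σ σ' : Equiv.Perm I) : l2.perm σ * l2.perm σ' = l2.perm (σ * σ') := by
  classical
  refine l2.clm_ext fun i => ?_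
  change l2.perm σ (l2.perm σ' _) = _
  rw [l2.perm_e, l2.perm_e, l2.perm_e]; rfl

theorem l2.perm_one : l2.perm (1 : Equiv.Perm I) = 1 := by
  classical
  refine l2.clm_ext fun i => ?_
  rw [l2.perm_e]; rfl

/-- The rank one projection onto a basis vector. -/
def l2.proj [DecidableEq I] (i : I) : l2 I →L[ℂ] l2 I :=
  l2.weighted id (fun j => if j = i then 1 else 0) (Function.injective_id.injOn)
    (fun j => by split_ifs <;> simp)

theorem l2.proj_e [DecidableEq I] (i j : I) :
    l2.proj i (l2.e j) = if j = i then l2.e j else 0 := by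
  ext k
  unfold l2.proj
  rw [l2.weighted_apply, l2.e_apply, id]
  by_cases h : j = i
  · rw [if_pos h, l2.e_apply]; subst h; simp
  · rw [if_neg h]
    by_cases hk : k = j
    · subst hk; simp [h]
    · simp [hk]

theorem l2.proj_mul_self [DecidableEq I] (i : I) : l2.proj i * l2.proj i = l2.proj i := by
  refine l2.clm_ext fun j => ?_
  change l2.proj i (l2.proj i _) = _
  rw [l2.proj_e]
  split_ifs with h
  · rw [l2.proj_e, if_pos h]
  · rw [map_zero]

theorem l2.star_proj [DecidableEq I] (i : I) : star (l2.proj i) = l2.proj i := by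
  refine l2.star_eq fun j k => ?_
  rw [l2.proj_e, l2.proj_e]
  by_cases h : j = i <;> by_cases h' : k = i
  · subst h h'; simp [l2.e_apply]
  · subst h; simp [l2.e_apply, h']
  · subst h'; simp [l2.e_apply, h]
  · simp [h, h']

end SquareSummable

/-- Generators of a representation of the quantum group `SU_q(2)` on `ℓ²(ℕ)`. -/
theorem exists_quantum_su2 (q : ℝ) (hq : 0 < q) (hq1 : q ≤ 1) :
    ∃ a c : l2 ℕ →L[ℂ] l2 ℕ, star c = c ∧ star a * a + c * c = 1 ∧
      a * star a + ((q : ℂ) ^ 2) • (c * c) = 1 ∧ a * c = (q : ℂ) • (c * a) ∧ a * c ≠ 0 := by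
  have hne : (l2.e 0 : l2 ℕ) ≠ 0 := by
    intro h
    have := l2.e_apply (0 : ℕ) 0
    rw [h] at this
    simp at this
  -- At `q = 1` the weights `√(1 - q^(2k))` used below all vanish, which would give `a = 0`.
  -- Commuting scalars with `(4/5)² + (3/5)² = 1` serve instead.
  rcases hq1.eq_or_lt with rfl | hq1
  · refine ⟨(4 / 5 : ℂ) • 1, (3 / 5 : ℂ) • 1, ?_, ?_, ?_, ?_, ?_⟩
    · simp [star_smul]
    · rw [star_smul, star_one, smul_mul_smul_comm, smul_mul_smul_comm, ← add_smul]; norm_num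
    · rw [star_smul, star_one, smul_mul_smul_comm, smul_mul_smul_comm, smul_smul, ← add_smul]
      norm_num
    · rw [smul_mul_smul_comm, smul_mul_smul_comm]; norm_num
    · rw [smul_mul_smul_comm, mul_one]
      intro h
      have h1 := congrArg (fun T : l2 ℕ →L[ℂ] l2 ℕ => T (l2.e 0)) h
      simp only [smul_apply, one_apply_eq_self, zero_apply, smul_eq_zero] at h1
      exact h1.elim (by norm_num) hne
  have hle : ∀ k : ℕ, q ^ (2 * k) ≤ 1 := fun k => pow_le_one₀ hq.le hq1.le
  have hsq : ∀ k : ℕ, ((√(1 - q ^ (2 * k)) : ℝ) : ℂ) * (√(1 - q ^ (2 * k)) : ℝ) =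
      1 - (q : ℂ) ^ (2 * k) := by
    intro k
    rw [← Complex.ofReal_mul, Real.mul_self_sqrt (sub_nonneg.2 (hle k))]
    push_cast; rfl
  have hb : ∀ k : ℕ, ‖((√(1 - q ^ (2 * k)) : ℝ) : ℂ)‖ ≤ 1 := by
    intro k
    rw [Complex.norm_real, Real.norm_of_nonneg (Real.sqrt_nonneg _)]
    refine Real.sqrt_le_one.2 ?_
    have := pow_pos hq (2 * k)
    linarith
  -- The standard representation `a e_k = √(1 - q^(2k)) e_{k-1}`, `c e_k = q^k e_k`, with the circle
  -- parameter equal to `1` so that `c` is self-adjoint.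
  let a : l2 ℕ →L[ℂ] l2 ℕ := l2.weighted Nat.succ
    (fun k => ((√(1 - q ^ (2 * (k + 1))) : ℝ) : ℂ)) Nat.succ_injective.injOn (fun k => hb _)
  -- The predecessor identifies `0` and `1`, but the weight at `0` is zero, so the injectivity
  -- condition holds.
  let a' : l2 ℕ →L[ℂ] l2 ℕ := l2.weighted Nat.pred
    (fun k => ((√(1 - q ^ (2 * k)) : ℝ) : ℂ)) (by
      have h0 : ∀ k ∈ {k : ℕ | ((√(1 - q ^ (2 * k)) : ℝ) : ℂ) ≠ 0}, k ≠ 0 := by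
        rintro k hk rfl
        simp at hk
      intro x hx y hy hxy
      have h1 := h0 x hx
      have h2 := h0 y hy
      simp only [Nat.pred_eq_sub_one] at hxy
      omega) (fun k => hb _)
  let c : l2 ℕ →L[ℂ] l2 ℕ := l2.weighted id (fun k => (q : ℂ) ^ k) Function.injective_id.injOn
    (fun k => by
      rw [norm_pow, Complex.norm_real, Real.norm_of_nonneg hq.le]
      exact pow_le_one₀ hq.le hq1.le)
  have ea : ∀ f k, a f k = ((√(1 - q ^ (2 * (k + 1))) : ℝ) : ℂ) * f (k + 1) := fun _ _ => rfl
  have ea' : ∀ f k, a' f k = ((√(1 - q ^ (2 * k)) : ℝ) : ℂ) * f (k - 1) := fun _ _ => rfl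
  have ec : ∀ f k, c f k = (q : ℂ) ^ k * f k := fun _ _ => rfl
  have ha' : star a = a' := by
    refine l2.star_eq fun i j => ?_
    rw [ea, ea', l2.e_apply, l2.e_apply]
    rcases j with _ | j
    · simp
    · by_cases h : j = i
      · subst h; simp
      · simp [h, Ne.symm h]
  have hac : a * c = (q : ℂ) • (c * a) := by
    ext f k
    change a (c f) k = (q : ℂ) * c (a f) k
    rw [ea, ec, ec, ea, pow_succ]
    ring
  refine ⟨a, c, ?_, ?_, ?_, hac, ?_⟩
  · refine l2.star_eq fun i j => ?_
    rw [ec, ec, l2.e_apply, l2.e_apply]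
    by_cases h : j = i
    · subst h; simp
    · simp [h, Ne.symm h]
  · rw [ha']
    ext f k
    change a' (a f) k + c (c f) k = f k
    rw [ea', ea, ec, ec]
    rcases k with _ | k
    · simp
    · rw [Nat.add_sub_cancel, ← mul_assoc, hsq]
      ring
  · rw [ha']
    ext f k
    change a (a' f) k + (q : ℂ) ^ 2 * c (c f) k = f k
    rw [ea, ea', ec, ec, Nat.add_sub_cancel, ← mul_assoc, hsq]
    ring
  · intro h
    have h1 := congrArg (fun T : l2 ℕ →L[ℂ] l2 ℕ => T (l2.e 1) 0) h
    have h2 : (a * c) (l2.e 1) 0 = ((√(1 - q ^ (2 * (0 + 1))) : ℝ) : ℂ) * ((q : ℂ) ^ 1 * 1) := by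
      change a (c (l2.e 1)) 0 = _
      rw [ea, ec, l2.e_apply]; rfl
    simp only [h2] at h1
    have h3 : √(1 - q ^ (2 * (0 + 1))) ≠ 0 := by
      refine (Real.sqrt_pos.2 ?_).ne'
      have : q ^ (2 * (0 + 1)) < 1 := pow_lt_one₀ hq.le hq1 (by norm_num)
      linarith
    have h4 : (q : ℂ) ≠ 0 := by exact_mod_cast hq.ne'
    have h5 : ((√(1 - q ^ (2 * (0 + 1))) : ℝ) : ℂ) ≠ 0 := by exact_mod_cast h3
    exact (mul_ne_zero h5 (mul_ne_zero (pow_ne_zero _ h4) one_ne_zero)) h1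

/-! ### Models that mix two letters. -/

section Mixing

variable {n : ℕ} {q : Fin n → ℝ} {L : Type*} [NormedAddCommGroup L] [InnerProductSpace ℂ L]
  [CompleteSpace L]

/-- The matrix which is `!![a, -z c; c, a*]` in the rows and columns `i`, `j` and the identity
elsewhere. -/
def rotationBlock (i j : Fin n) (z : ℂ) (a c : L →L[ℂ] L) (k l : Fin n) : L →L[ℂ] L :=
  if k = i then (if l = i then a else if l = j then -(z • c) else 0)
  else if k = j then (if l = i then c else if l = j then star a else 0)
  else if k = l then 1 else 0

theorem rotationBlock_left {i j k : Fin n} (hi : k ≠ i) (hj : k ≠ j) (z : ℂ) (a c : L →L[ℂ] L)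
    (l : Fin n) : rotationBlock i j z a c k l = if k = l then 1 else 0 := by
  simp [rotationBlock, hi, hj]

theorem rotationBlock_right {i j l : Fin n} (hi : l ≠ i) (hj : l ≠ j) (z : ℂ) (a c : L →L[ℂ] L)
    (k : Fin n) : rotationBlock i j z a c k l = if k = l then 1 else 0 := by
  unfold rotationBlock
  rw [if_neg hi, if_neg hj, if_neg hi, if_neg hj]
  by_cases hki : k = i
  · rw [if_pos hki, if_neg (by rintro rfl; exact hi hki)]
  · rw [if_neg hki]
    by_cases hkj : k = j
    · rw [if_pos hkj, if_neg (by rintro rfl; exact hj hkj)]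
    · rw [if_neg hkj]

theorem sum_pair_or_single {M : Type*} [AddCommMonoid M] {i j : Fin n} (hij : i ≠ j)
    (f : Fin n → M) (h : ∀ k, k ≠ i → k ≠ j → f k = 0) : ∑ k, f k = f i + f j :=
  Finset.sum_eq_add i j hij (fun k _ hk => h k hk.1 hk.2) (by simp) (by simp)

set_option linter.unusedSimpArgs false in
theorem isModel_rotationBlock (hq : ∀ i, 0 < q i) {i j : Fin n} (hij : i ≠ j) {z : ℝ}
    (hz : z ^ 2 * q i = q j) {a c : L →L[ℂ] L} (hc : star c = c)
    (h1 : star a * a + c * c = 1) (h2 : a * star a + ((z : ℂ) ^ 2) • (c * c) = 1)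
    (h3 : a * c = (z : ℂ) • (c * a)) : IsModel q (rotationBlock i j (z : ℂ) a c) := by
  have h3' : c * star a = (z : ℂ) • (star a * c) := by
    have := congrArg star h3
    rwa [star_mul, star_smul, star_mul, hc, RCLike.star_def, Complex.conj_ofReal] at this
  have hzi : (q j : ℂ) = (z : ℂ) ^ 2 * q i := by rw [← hz]; push_cast; rfl
  have hqi : (q i : ℂ) ≠ 0 := by exact_mod_cast (hq i).ne'
  have hqj : (q j : ℂ) ≠ 0 := by exact_mod_cast (hq j).ne'
  have hz0 : (z : ℂ) ≠ 0 := by rintro h; rw [h] at hzi; simp [hqj] at hzi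
  have hji := hij.symm
  -- The block is the identity outside the rows and columns `i`, `j`. Each of the four families of
  -- relations thus reduces to its four entries with indices in `{i, j}`; `g x y k` is the `k`-th
  -- summand of entry `(x, y)`.
  have key : ∀ (g : Fin n → Fin n → Fin n → (L →L[ℂ] L)) (r : Fin n → (L →L[ℂ] L)),
      (∀ x y, (x ≠ i → x ≠ j → y ≠ x → ∀ k, g x y k = 0)) →
      (∀ x y, (y ≠ i → y ≠ j → x ≠ y → ∀ k, g x y k = 0)) →
      (∀ x, x ≠ i → x ≠ j → ∀ k, k ≠ x → g x x k = 0) →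
      (∀ x, x ≠ i → x ≠ j → g x x x = r x) →
      (∀ x y, (x = i ∨ x = j) → (y = i ∨ y = j) → ∀ k, k ≠ i → k ≠ j → g x y k = 0) →
      g i i i + g i i j = r i → g j j i + g j j j = r j → g i j i + g i j j = 0 →
      g j i i + g j i j = 0 → ∀ x y, ∑ k, g x y k = if x = y then r x else 0 := by
    intro g r k1 k2 k3 k4 k5 gii gjj gij gji x y
    by_cases hx : x = i ∨ x = j
    · by_cases hy : y = i ∨ y = j
      · rw [sum_pair_or_single hij _ (k5 x y hx hy)]
        rcases hx with rfl | rfl <;> rcases hy with rfl | rfl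
        · rw [gii, if_pos rfl]
        · rw [gij, if_neg hij]
        · rw [gji, if_neg hji]
        · rw [gjj, if_pos rfl]
      · rw [not_or] at hy
        have hxy : x ≠ y := by rintro rfl; exact hx.elim hy.1 hy.2
        rw [if_neg hxy]
        exact Finset.sum_eq_zero fun k _ => k2 x y hy.1 hy.2 hxy k
    · rw [not_or] at hx
      by_cases hxy : x = y
      · subst hxy
        rw [if_pos rfl, Finset.sum_eq_single x (fun k _ hk => k3 x hx.1 hx.2 k hk) (by simp),
          k4 x hx.1 hx.2]
      · rw [if_neg hxy]
        exact Finset.sum_eq_zero fun k _ => k1 x y hx.1 hx.2 (Ne.symm hxy) k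
  constructor
  · refine key _ (fun _ => 1) ?_ ?_ ?_ ?_ ?_ ?_ ?_ ?_ ?_
    · intro x y hx hx' hyx k
      rcases eq_or_ne k x with rfl | hk
      · simp [rotationBlock_left hx hx', rotationBlock_right hx hx', hyx, hyx.symm]
      · simp [rotationBlock_left hx hx', rotationBlock_right hx hx', hk, hk.symm]
    · intro x y hx hx' hyx k
      rcases eq_or_ne k y with rfl | hk
      · simp [rotationBlock_left hx hx', rotationBlock_right hx hx', hyx, hyx.symm]
      · simp [rotationBlock_left hx hx', rotationBlock_right hx hx', hk, hk.symm]
    · intro x hx hx' k hk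
      simp [rotationBlock_left hx hx', rotationBlock_right hx hx', hk, hk.symm]
    · intro x hx hx'
      simp [rotationBlock_left hx hx']
    · intro x y hx hy k hk hk'
      have hxk : x ≠ k := by rintro rfl; exact hx.elim hk hk'
      simp [rotationBlock_left hk hk', rotationBlock_right hk hk', hxk, hxk.symm]
    all_goals simp only [rotationBlock, if_true, if_neg hij, if_neg hji, star_neg, star_smul,
      star_star, hc, RCLike.star_def, Complex.conj_ofReal]
    all_goals try simp only [neg_mul, mul_neg, smul_mul_assoc, mul_smul_comm, smul_smul, neg_neg,
      h3, h3', hzi, mul_inv]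
    · linear_combination (norm := skip) (1 : ℂ) • h1
      match_scalars <;> field_simp <;> ring
    · linear_combination (norm := skip) (1 : ℂ) • h2
      match_scalars <;> field_simp <;> ring
    · match_scalars <;> field_simp <;> ring
    · match_scalars <;> field_simp <;> ring
  · refine key _ (fun _ => 1) ?_ ?_ ?_ ?_ ?_ ?_ ?_ ?_ ?_
    · intro x y hx hx' hyx k
      rcases eq_or_ne k x with rfl | hk
      · simp [rotationBlock_left hx hx', rotationBlock_right hx hx', hyx, hyx.symm]
      · simp [rotationBlock_left hx hx', rotationBlock_right hx hx', hk, hk.symm]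
    · intro x y hx hx' hyx k
      rcases eq_or_ne k y with rfl | hk
      · simp [rotationBlock_left hx hx', rotationBlock_right hx hx', hyx, hyx.symm]
      · simp [rotationBlock_left hx hx', rotationBlock_right hx hx', hk, hk.symm]
    · intro x hx hx' k hk
      simp [rotationBlock_left hx hx', rotationBlock_right hx hx', hk, hk.symm]
    · intro x hx hx'
      simp [rotationBlock_left hx hx']
    · intro x y hx hy k hk hk'
      have hxk : x ≠ k := by rintro rfl; exact hx.elim hk hk'
      simp [rotationBlock_left hk hk', rotationBlock_right hk hk', hxk, hxk.symm]
    all_goals simp only [rotationBlock, if_true, if_neg hij, if_neg hji, star_neg, star_smul,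
      star_star, hc, RCLike.star_def, Complex.conj_ofReal]
    all_goals try simp only [neg_mul, mul_neg, smul_mul_assoc, mul_smul_comm, smul_smul, neg_neg,
      h3, h3', hzi, mul_inv]
    · linear_combination (norm := skip) (1 : ℂ) • h2
      match_scalars <;> field_simp <;> ring
    · linear_combination (norm := skip) (1 : ℂ) • h1
      match_scalars <;> field_simp <;> ring
    · match_scalars <;> field_simp <;> ring
    · match_scalars <;> field_simp <;> ring
  · refine key _ (fun x => (q x : ℂ) • 1) ?_ ?_ ?_ ?_ ?_ ?_ ?_ ?_ ?_
    · intro x y hx hx' hyx k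
      rcases eq_or_ne k x with rfl | hk
      · simp [rotationBlock_left hx hx', rotationBlock_right hx hx', hyx, hyx.symm]
      · simp [rotationBlock_left hx hx', rotationBlock_right hx hx', hk, hk.symm]
    · intro x y hx hx' hyx k
      rcases eq_or_ne k y with rfl | hk
      · simp [rotationBlock_left hx hx', rotationBlock_right hx hx', hyx, hyx.symm]
      · simp [rotationBlock_left hx hx', rotationBlock_right hx hx', hk, hk.symm]
    · intro x hx hx' k hk
      simp [rotationBlock_left hx hx', rotationBlock_right hx hx', hk, hk.symm]
    · intro x hx hx'
      simp [rotationBlock_left hx hx']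
    · intro x y hx hy k hk hk'
      have hxk : x ≠ k := by rintro rfl; exact hx.elim hk hk'
      simp [rotationBlock_left hk hk', rotationBlock_right hk hk', hxk, hxk.symm]
    all_goals simp only [rotationBlock, if_true, if_neg hij, if_neg hji, star_neg, star_smul,
      star_star, hc, RCLike.star_def, Complex.conj_ofReal]
    all_goals try simp only [neg_mul, mul_neg, smul_mul_assoc, mul_smul_comm, smul_smul, neg_neg,
      h3, h3', hzi, mul_inv]
    -- This is where `z` has to be tuned to the weights: `q_i a a* + q_j c² = q_i (a a* + z² c²)`.
    · linear_combination (norm := skip) ((q i) : ℂ) • h2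
      match_scalars <;> field_simp <;> ring
    · linear_combination (norm := skip) (((z:ℂ)^2*(q i)) : ℂ) • h1
      match_scalars <;> field_simp <;> ring
    · match_scalars <;> field_simp <;> ring
    · match_scalars <;> field_simp <;> ring
  · refine key _ (fun x => (q x : ℂ)⁻¹ • 1) ?_ ?_ ?_ ?_ ?_ ?_ ?_ ?_ ?_
    · intro x y hx hx' hyx k
      rcases eq_or_ne k x with rfl | hk
      · simp [rotationBlock_left hx hx', rotationBlock_right hx hx', hyx, hyx.symm]
      · simp [rotationBlock_left hx hx', rotationBlock_right hx hx', hk, hk.symm]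
    · intro x y hx hx' hyx k
      rcases eq_or_ne k y with rfl | hk
      · simp [rotationBlock_left hx hx', rotationBlock_right hx hx', hyx, hyx.symm]
      · simp [rotationBlock_left hx hx', rotationBlock_right hx hx', hk, hk.symm]
    · intro x hx hx' k hk
      simp [rotationBlock_left hx hx', rotationBlock_right hx hx', hk, hk.symm]
    · intro x hx hx'
      simp [rotationBlock_left hx hx']
    · intro x y hx hy k hk hk'
      have hxk : x ≠ k := by rintro rfl; exact hx.elim hk hk'
      simp [rotationBlock_left hk hk', rotationBlock_right hk hk', hxk, hxk.symm]
    all_goals simp only [rotationBlock, if_true, if_neg hij, if_neg hji, star_neg, star_smul,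
      star_star, hc, RCLike.star_def, Complex.conj_ofReal]
    all_goals try simp only [neg_mul, mul_neg, smul_mul_assoc, mul_smul_comm, smul_smul, neg_neg,
      h3, h3', hzi, mul_inv]
    · linear_combination (norm := skip) ((q i)⁻¹ : ℂ) • h1
      match_scalars <;> field_simp <;> ring
    · linear_combination (norm := skip) (((z:ℂ)^2*(q i))⁻¹ : ℂ) • h2
      match_scalars <;> field_simp <;> ring
    · match_scalars <;> field_simp <;> ring
    · match_scalars <;> field_simp <;> ring

/-- A model mixing the letters `i` and `j` only. -/
structure IsMixing (q : Fin n → ℝ) (i j : Fin n) (v : Fin n → Fin n → (L →L[ℂ] L)) : Prop where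
  isModel : IsModel q v
  left : ∀ k, k ≠ i → k ≠ j → ∀ l, v k l = if k = l then 1 else 0
  right : ∀ k, k ≠ i → k ≠ j → ∀ l, v l k = if l = k then 1 else 0
  mul_diag : ∀ b, v j i * star (v b b) ≠ 0
  mul_diag' : ∀ b, v i j * star (v b b) ≠ 0
  mul_swap : v j i * star (v i j) ≠ 0
  mul_swap' : v i j * star (v j i) ≠ 0

theorem IsMixing.symm {i j : Fin n} {v : Fin n → Fin n → (L →L[ℂ] L)} (h : IsMixing q i j v) :
    IsMixing q j i v where
  isModel := h.isModel
  left k hk hk' := h.left k hk' hk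
  right k hk hk' := h.right k hk' hk
  mul_diag := h.mul_diag'
  mul_diag' := h.mul_diag
  mul_swap := h.mul_swap'
  mul_swap' := h.mul_swap

theorem exists_isMixing (hq : ∀ i, 0 < q i) {i j : Fin n} (hij : i ≠ j) :
    ∃ v : Fin n → Fin n → (l2 ℕ →L[ℂ] l2 ℕ), IsMixing q i j v := by
  -- The representation of `SU_z(2)` is available for `z ≤ 1`; exchanging the two letters arranges
  -- this.
  wlog hle : q j ≤ q i generalizing i j
  · obtain ⟨v, hv⟩ := this hij.symm (le_of_not_ge hle)
    exact ⟨v, hv.symm⟩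
  have hz0 : 0 < √(q j / q i) := Real.sqrt_pos.2 (div_pos (hq j) (hq i))
  obtain ⟨a, c, hc, h1, h2, h3, hac⟩ := exists_quantum_su2 (√(q j / q i)) hz0
    (Real.sqrt_le_one.2 ((div_le_one (hq i)).2 hle))
  set z := √(q j / q i) with hz
  have hz2 : z ^ 2 * q i = q j := by
    rw [hz, Real.sq_sqrt (div_pos (hq j) (hq i)).le, div_mul_cancel₀ _ (hq i).ne']
  have hz0' : (z : ℂ) ≠ 0 := by exact_mod_cast hz0.ne'
  -- All nonvanishing products required of a mixing model follow from `a c ≠ 0`, by the commutation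
  -- relation and by taking adjoints.
  have hca : c * a ≠ 0 := by rintro h; rw [h3, h, smul_zero] at hac; exact hac rfl
  have hca' : c * star a ≠ 0 := by
    intro h
    apply hac
    rw [← star_star (a * c), star_mul, hc, h, star_zero]
  have hc0 : c ≠ 0 := by rintro rfl; simp at hca
  have hcc : c * c ≠ 0 := by
    intro h
    apply hc0
    rw [← CStarRing.star_mul_self_eq_zero_iff, hc, h]
  have hji := hij.symm
  have vii : rotationBlock i j (z : ℂ) a c i i = a := by simp [rotationBlock]
  have vij : rotationBlock i j (z : ℂ) a c i j = -((z : ℂ) • c) := by simp [rotationBlock, hji]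
  have vji : rotationBlock i j (z : ℂ) a c j i = c := by simp [rotationBlock, hji]
  have vjj : rotationBlock i j (z : ℂ) a c j j = star a := by simp [rotationBlock, hji]
  have hneg : ∀ x : l2 ℕ →L[ℂ] l2 ℕ, c * x ≠ 0 → -((z : ℂ) • c) * x ≠ 0 := by
    intro x hx
    rw [neg_mul, smul_mul_assoc, neg_ne_zero]
    exact smul_ne_zero hz0' hx
  have hdiag : ∀ b, c * star (rotationBlock i j (z : ℂ) a c b b) ≠ 0 := by
    intro b
    by_cases hb : b = i
    · rw [hb, vii]; exact hca'
    by_cases hb' : b = j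
    · rw [hb', vjj, star_star]; exact hca
    · rw [rotationBlock_left hb hb', if_pos rfl, star_one, mul_one]; exact hc0
  refine ⟨rotationBlock i j z a c, isModel_rotationBlock hq hij hz2 hc h1 ?_ h3,
    fun k hk hk' => rotationBlock_left hk hk' _ _ _, fun k hk hk' => rotationBlock_right hk hk' _ _ _,
    ?_, ?_, ?_, ?_⟩
  · exact h2
  · intro b; rw [vji]; exact hdiag b
  · intro b; rw [vij]; exact hneg _ (hdiag b)
  · rw [vji, vij, star_neg, star_smul, hc, mul_neg, neg_ne_zero, mul_smul_comm]
    refine smul_ne_zero ?_ hcc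
    simpa using hz0'
  · rw [vji, vij, hc]; exact hneg _ hcc

/-- The diagonal model given by unitaries. -/
theorem isModel_diagonal (q : Fin n → ℝ) (x : Fin n → (L →L[ℂ] L)) (h1 : ∀ i, star (x i) * x i = 1)
    (h2 : ∀ i, x i * star (x i) = 1) : IsModel q (fun i j => if i = j then x i else 0) := by
  constructor
  · intro i j
    rw [Finset.sum_eq_single i (fun k _ hk => by simp [hk]) (by simp)]
    by_cases h : i = j
    · subst h; simp [h1]
    · simp [h]
  · intro i j
    rw [Finset.sum_eq_single i (fun k _ hk => by simp [hk.symm]) (by simp)]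
    by_cases h : i = j
    · subst h; simp [h2]
    · simp [h, Ne.symm h]
  · intro i j
    rw [Finset.sum_eq_single i (fun k _ hk => by simp [hk]) (by simp)]
    by_cases h : i = j
    · subst h; simp [h2]
    · simp [h]
  · intro i j
    rw [Finset.sum_eq_single i (fun k _ hk => by simp [hk.symm]) (by simp)]
    by_cases h : i = j
    · subst h; simp [h1]
    · simp [h, Ne.symm h]

/-- The model on `ℓ²(ℤ) ⊗ L` which shifts `ℤ` and applies `v` on the step from `0` to `1`. -/
def levelModel (v : Fin n → Fin n → (L →L[ℂ] L)) (k l : Fin n) :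
    HilbertTensor (l2 ℤ) L →L[ℂ] HilbertTensor (l2 ℤ) L :=
  opTensor (l2.perm (Equiv.addRight 1)) 1 *
    ((if k = l then 1 - opTensor (l2.proj 0) 1 else 0) + opTensor (l2.proj 0) (v k l))

end Mixing

/-! ### The level model: a given model switched on at a single step of a counter. -/

section LevelModel

variable {n : ℕ} {q : Fin n → ℝ} {L : Type*} [NormedAddCommGroup L] [InnerProductSpace ℂ L]
  [CompleteSpace L]

/-- One computation for all four relations: `a` and `b` stand for `v` or its adjoint, transposed or
not, and `c` for the weights `1`, `q` or `q⁻¹`. The ranges of `P` and `1 - P` do not interact; on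
the first the hypothesis on `v` applies, on the second only the term `k = i` survives, which is why
`hr` asks for the weight at `i` alone. -/
theorem levelModel_sum (P : HilbertTensor (l2 ℤ) L →L[ℂ] HilbertTensor (l2 ℤ) L)
    (hP : P = opTensor (l2.proj 0) 1) (a b : Fin n → Fin n → (L →L[ℂ] L)) (c : Fin n → ℂ)
    (r : ℂ) (i j : Fin n) (hr : ∀ k, k = i → c k = r)
    (h : ∑ k, c k • (a i k * b j k) = if i = j then r • (1 : L →L[ℂ] L) else 0) :
    ∑ k, c k • (((if i = k then 1 - P else 0) + opTensor (l2.proj 0) (a i k)) *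
      ((if j = k then 1 - P else 0) + opTensor (l2.proj 0) (b j k))) =
      if i = j then r • (1 : HilbertTensor (l2 ℤ) L →L[ℂ] HilbertTensor (l2 ℤ) L) else 0 := by
  have hPP : P * P = P := by rw [hP, opTensor_mul, l2.proj_mul_self, mul_one]
  have e1 : ∀ x : L →L[ℂ] L, (1 - P) * opTensor (l2.proj 0) x = 0 := by
    intro x
    rw [sub_mul, hP, opTensor_mul, l2.proj_mul_self, one_mul, one_mul, sub_self]
  have e2 : ∀ x : L →L[ℂ] L, opTensor (l2.proj 0) x * (1 - P) = 0 := by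
    intro x
    rw [mul_sub, hP, opTensor_mul, l2.proj_mul_self, mul_one, mul_one, sub_self]
  have e3 : (1 - P) * (1 - P) = 1 - P := by
    rw [mul_sub, sub_mul, sub_mul, hPP]; simp
  have e4 : ∀ k, c k • (((if i = k then 1 - P else 0) + opTensor (l2.proj 0) (a i k)) *
      ((if j = k then 1 - P else 0) + opTensor (l2.proj 0) (b j k))) =
      (if k = i then (if i = j then r • (1 - P) else 0) else 0) +
        opTensor (l2.proj 0) (c k • (a i k * b j k)) := by
    intro k
    rw [add_mul, mul_add, mul_add, opTensor_mul, l2.proj_mul_self, opTensor_smul_right, smul_add]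
    have z1 : (if i = k then 1 - P else 0) * opTensor (l2.proj 0) (b j k) = 0 := by
      split_ifs
      · exact e1 _
      · exact zero_mul _
    have z2 : opTensor (l2.proj 0) (a i k) * (if j = k then 1 - P else 0) = 0 := by
      split_ifs
      · exact e2 _
      · exact mul_zero _
    rw [z1, z2, add_zero, zero_add]
    congr 1
    by_cases hk : k = i
    · rw [if_pos hk, if_pos hk.symm, hr k hk]
      subst hk
      by_cases hj : k = j
      · rw [if_pos hj, if_pos hj.symm, e3]
      · rw [if_neg hj, if_neg (Ne.symm hj), mul_zero, smul_zero]
    · rw [if_neg hk, if_neg (Ne.symm hk), zero_mul, smul_zero]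
  have e5 : ∑ k, opTensor (l2.proj (0 : ℤ)) (c k • (a i k * b j k)) =
      opTensor (l2.proj 0) (∑ k, c k • (a i k * b j k)) := by
    refine clm_ext_htmul fun x y => ?_
    simp [opTensor_htmul]
    unfold htmul
    rw [← map_sum, TensorProduct.tmul_sum]
  rw [Finset.sum_congr rfl fun k _ => e4 k, Finset.sum_add_distrib, Finset.sum_ite_eq', e5, h,
    if_pos (Finset.mem_univ i)]
  split_ifs
  · rw [opTensor_smul_right, ← hP, ← smul_add, sub_add_cancel]
  · rw [zero_add]
    refine clm_ext_htmul fun x y => ?_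
    rw [opTensor_htmul]; simp [htmul]

theorem star_ite_zero_add {A : Type*} [AddMonoid A] [StarAddMonoid A] (p : Prop) [Decidable p]
    (x y : A) : star ((if p then x else 0) + y) = (if p then star x else 0) + star y := by
  split_ifs <;> simp

theorem isModel_levelModel {v : Fin n → Fin n → (L →L[ℂ] L)} (hv : IsModel q v) :
    IsModel q (levelModel v) := by
  set Y : HilbertTensor (l2 ℤ) L →L[ℂ] HilbertTensor (l2 ℤ) L :=
    opTensor (l2.perm (Equiv.addRight 1)) 1 with hY
  set P : HilbertTensor (l2 ℤ) L →L[ℂ] HilbertTensor (l2 ℤ) L := opTensor (l2.proj 0) 1 with hP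
  have Y1 : star Y * Y = 1 := by
    rw [hY, opTensor_star, l2.star_perm, star_one, opTensor_mul, l2.perm_mul, mul_one]
    rw [show (Equiv.addRight (1 : ℤ)).symm * Equiv.addRight 1 = 1 from inv_mul_cancel _,
      l2.perm_one, opTensor_one]
  have Y2 : Y * star Y = 1 := by
    rw [hY, opTensor_star, l2.star_perm, star_one, opTensor_mul, l2.perm_mul, mul_one]
    rw [show Equiv.addRight (1 : ℤ) * (Equiv.addRight 1).symm = 1 from mul_inv_cancel _,
      l2.perm_one, opTensor_one]
  have hP1 : star (1 - P) = 1 - P := by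
    rw [star_sub, star_one, hP, opTensor_star, l2.star_proj, star_one]
  have hu : ∀ k l, levelModel v k l =
      Y * ((if k = l then 1 - P else 0) + opTensor (l2.proj 0) (v k l)) := fun _ _ => rfl
  -- The Kronecker delta is stated in both orders because the relations sum over the first index in
  -- two cases and over the second in the other two.
  have hu' : ∀ k l, levelModel v k l =
      Y * ((if l = k then 1 - P else 0) + opTensor (l2.proj 0) (v k l)) := by
    intro k l
    rw [hu]; simp only [eq_comm]
  have hs : ∀ k l, star (levelModel v k l) =
      ((if k = l then 1 - P else 0) + opTensor (l2.proj 0) (star (v k l))) * star Y := by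
    intro k l
    rw [hu, star_mul, star_ite_zero_add, hP1, opTensor_star, l2.star_proj]
  have hs' : ∀ k l, star (levelModel v k l) =
      ((if l = k then 1 - P else 0) + opTensor (l2.proj 0) (star (v k l))) * star Y := by
    intro k l
    rw [hs]; simp only [eq_comm]
  have m1 : ∀ a b : HilbertTensor (l2 ℤ) L →L[ℂ] HilbertTensor (l2 ℤ) L,
      a * star Y * (Y * b) = a * b := by
    intro a b
    rw [mul_assoc, ← mul_assoc (star Y), Y1, one_mul]
  have m2 : ∀ a b : HilbertTensor (l2 ℤ) L →L[ℂ] HilbertTensor (l2 ℤ) L,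
      Y * a * (b * star Y) = Y * (a * b) * star Y := by
    intro a b
    simp only [mul_assoc]
  constructor
  · intro i j
    simp only [hs']
    simp only [hu', m1]
    have := levelModel_sum P hP (fun i k => star (v k i)) (fun j k => v k j) (fun _ => 1) 1 i j
      (fun _ _ => rfl) (by simpa using hv.star_mul i j)
    simpa using this
  · intro i j
    simp only [hs]
    simp only [hu, m2]
    have := levelModel_sum P hP (fun i k => v i k) (fun j k => star (v j k)) (fun _ => 1) 1 i j
      (fun _ _ => rfl) (by simpa using hv.mul_star i j)
    rw [← Finset.sum_mul, ← Finset.mul_sum]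
    simp only [one_smul] at this
    rw [this]
    split_ifs
    · rw [mul_one, Y2]
    · rw [mul_zero, zero_mul]
  · intro i j
    simp only [hs']
    simp only [hu', m2]
    have := levelModel_sum P hP (fun i k => v k i) (fun j k => star (v k j)) (fun k => (q k : ℂ))
      (q i) i j (fun k hk => by rw [hk]) (hv.weight_mul_star i j)
    have m3 : ∀ (c : ℂ) (a : HilbertTensor (l2 ℤ) L →L[ℂ] HilbertTensor (l2 ℤ) L),
        c • (Y * a * star Y) = Y * (c • a) * star Y := fun c a => by
      rw [mul_smul_comm, smul_mul_assoc]
    simp only [m3]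
    rw [← Finset.sum_mul, ← Finset.mul_sum, this]
    split_ifs
    · rw [mul_smul_comm, mul_one, smul_mul_assoc, Y2]
    · rw [mul_zero, zero_mul]
  · intro i j
    simp only [hs]
    simp only [hu, m1]
    exact levelModel_sum P hP (fun i k => star (v i k)) (fun j k => v j k)
      (fun k => (q k : ℂ)⁻¹) (q i : ℂ)⁻¹ i j (fun k hk => by rw [hk]) (hv.weight_star_mul i j)

theorem htmul_zero_left {H K : Type*} [NormedAddCommGroup H] [InnerProductSpace ℂ H]
    [NormedAddCommGroup K] [InnerProductSpace ℂ K] (y : K) : htmul (0 : H) y = 0 := by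
  simp [htmul]

theorem htmul_zero_right {H K : Type*} [NormedAddCommGroup H] [InnerProductSpace ℂ H]
    [NormedAddCommGroup K] [InnerProductSpace ℂ K] (x : H) : htmul x (0 : K) = 0 := by
  simp [htmul]

theorem htmul_sub_left {H K : Type*} [NormedAddCommGroup H] [InnerProductSpace ℂ H]
    [NormedAddCommGroup K] [InnerProductSpace ℂ K] (x x' : H) (y : K) :
    htmul (x - x') y = htmul x y - htmul x' y := by
  unfold htmul; rw [TensorProduct.sub_tmul, map_sub]

theorem levelModel_apply (v : Fin n → Fin n → (L →L[ℂ] L)) (k l : Fin n) (m : ℤ) (ξ : L) :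
    levelModel v k l (htmul (l2.e m) ξ) =
      if m = 0 then htmul (l2.e 1) (v k l ξ) else if k = l then htmul (l2.e (m + 1)) ξ else 0 := by
  have hp : ∀ (x : L →L[ℂ] L), opTensor (l2.proj (0 : ℤ)) x (htmul (l2.e m) ξ) =
      if m = 0 then htmul (l2.e m) (x ξ) else 0 := by
    intro x
    rw [opTensor_htmul, l2.proj_e]
    split_ifs
    · rfl
    · rw [htmul_zero_left]
  have hY : ∀ (m : ℤ) (η : L), opTensor (l2.perm (Equiv.addRight (1 : ℤ))) (1 : L →L[ℂ] L)
      (htmul (l2.e m) η) = htmul (l2.e (m + 1)) η := by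
    intro m η
    rw [opTensor_htmul, l2.perm_e]; rfl
  change opTensor _ _ ((_ + opTensor (l2.proj (0 : ℤ)) (v k l)) _) = _
  rw [add_apply, hp]
  by_cases hm : m = 0
  · rw [if_pos hm, if_pos hm]
    have : (if k = l then 1 - opTensor (l2.proj (0 : ℤ)) (1 : L →L[ℂ] L) else 0)
        (htmul (l2.e m) ξ) = 0 := by
      split_ifs
      · rw [sub_apply, hp, if_pos hm]; exact sub_self _
      · rfl
    rw [this, zero_add, hY, hm, zero_add]
  · rw [if_neg hm, if_neg hm, add_zero]
    split_ifs
    · rw [sub_apply, hp, if_neg hm, sub_zero]; exact hY _ _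
    · exact map_zero _

theorem star_levelModel_apply (v : Fin n → Fin n → (L →L[ℂ] L)) (k l : Fin n) (m : ℤ) (ξ : L) :
    star (levelModel v k l) (htmul (l2.e m) ξ) =
      if m = 1 then htmul (l2.e 0) (star (v k l) ξ)
      else if k = l then htmul (l2.e (m - 1)) ξ else 0 := by
  have hp : ∀ (m : ℤ) (x : L →L[ℂ] L), opTensor (l2.proj (0 : ℤ)) x (htmul (l2.e m) ξ) =
      if m = 0 then htmul (l2.e m) (x ξ) else 0 := by
    intro m x
    rw [opTensor_htmul, l2.proj_e]
    split_ifs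
    · rfl
    · rw [htmul_zero_left]
  have hY : star (opTensor (l2.perm (Equiv.addRight (1 : ℤ))) (1 : L →L[ℂ] L))
      (htmul (l2.e m) ξ) = htmul (l2.e (m - 1)) ξ := by
    rw [opTensor_star, star_one, l2.star_perm, opTensor_htmul, l2.perm_e]; rfl
  unfold levelModel
  rw [star_mul, star_ite_zero_add, star_sub, star_one, opTensor_star, opTensor_star, l2.star_proj,
    star_one]
  change (_ + opTensor (l2.proj (0 : ℤ)) (star (v k l)))
    ((star (opTensor (l2.perm (Equiv.addRight (1 : ℤ))) (1 : L →L[ℂ] L))) (htmul (l2.e m) ξ)) = _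
  rw [hY, add_apply, hp]
  by_cases hm : m = 1
  · subst hm
    rw [sub_self, if_pos rfl, if_pos rfl]
    have : (if k = l then 1 - opTensor (l2.proj (0 : ℤ)) (1 : L →L[ℂ] L) else 0)
        (htmul (l2.e 0) ξ) = 0 := by
      split_ifs
      · rw [sub_apply, hp, if_pos rfl]; exact sub_self _
      · rfl
    rw [this, zero_add]
  · have hm' : m - 1 ≠ 0 := sub_ne_zero.2 hm
    rw [if_neg hm', if_neg hm, add_zero]
    split_ifs
    · rw [sub_apply, hp, if_neg hm', sub_zero]; rfl
    · rfl

end LevelModel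

/-! ### Words in the level model: selecting the letter to be changed. -/

section LevelWords

variable {n : ℕ} {H L : Type*} [NormedAddCommGroup H] [InnerProductSpace ℂ H] [CompleteSpace H]
  [NormedAddCommGroup L] [InnerProductSpace ℂ L] [CompleteSpace L]
  (s : Fin n → (H →L[ℂ] H)) (v : Fin n → Fin n → (L →L[ℂ] L))

theorem coact_levelModel (j : Fin n) (x : H) (m : ℤ) (ξ : L) :
    coact s (levelModel v) j (htmul x (htmul (l2.e m) ξ)) =
      if m = 0 then ∑ i, htmul (s i x) (htmul (l2.e (1 : ℤ)) (v i j ξ))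
      else htmul (s j x) (htmul (l2.e (m + 1)) ξ) := by
  rw [coact_htmul]
  simp only [levelModel_apply]
  split_ifs
  · rfl
  · rw [Finset.sum_eq_single j (fun k _ hk => by rw [if_neg hk, htmul_zero_right]) (by simp),
      if_pos rfl]

theorem star_coact_levelModel (j : Fin n) (x : H) (m : ℤ) (ξ : L) :
    star (coact s (levelModel v) j) (htmul x (htmul (l2.e m) ξ)) =
      if m = 1 then ∑ i, htmul (star (s i) x) (htmul (l2.e (0 : ℤ)) (star (v i j) ξ))
      else htmul (star (s j) x) (htmul (l2.e (m - 1)) ξ) := by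
  rw [star_coact_htmul]
  simp only [star_levelModel_apply]
  split_ifs
  · rfl
  · rw [Finset.sum_eq_single j (fun k _ hk => by rw [if_neg hk, htmul_zero_right]) (by simp),
      if_pos rfl]

/-- The condition on `m` says that the climb never takes the active step from `0` to `1`: it starts
above `0` or ends at most at `0`. -/
theorem wordVec_level_up (α : List (Fin n)) (x : H) (m : ℤ) (ξ : L)
    (h : 0 < m ∨ m + α.length ≤ 0) :
    wordVec (coact s (levelModel v)) α [] (htmul x (htmul (l2.e m) ξ)) =
      htmul (wordVec s α [] x) (htmul (l2.e (m + α.length)) ξ) := by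
  induction α with
  | nil => simp [wordVec_nil_nil]
  | cons i α ih =>
    rw [List.length_cons] at h
    push_cast at h
    rw [wordVec_cons_left, wordVec_cons_left, ih (by omega), coact_levelModel,
      if_neg (by omega), List.length_cons]
    push_cast
    rw [add_assoc]

theorem wordVec_level_down (β : List (Fin n)) (x : H) (m : ℤ) (ξ : L)
    (h : m ≤ 0 ∨ (β.length : ℤ) < m) :
    wordVec (coact s (levelModel v)) [] β (htmul x (htmul (l2.e m) ξ)) =
      htmul (wordVec s [] β x) (htmul (l2.e (m - β.length)) ξ) := by
  induction β generalizing x m with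
  | nil => simp [wordVec_nil_nil]
  | cons j β ih =>
    rw [List.length_cons] at h
    push_cast at h
    rw [wordVec_nil_cons, wordVec_nil_cons, star_coact_levelModel, if_neg (by omega),
      ih _ _ (by omega), List.length_cons]
    push_cast
    rw [sub_sub, add_comm (1 : ℤ)]

theorem wordVec_split_left (t : Fin n → H →L[ℂ] H) (α α' : List (Fin n)) (a : Fin n)
    (β : List (Fin n)) (x : H) : wordVec t (α ++ a :: α') β x =
      wordVec t α [] (t a (wordVec t α' [] (wordVec t [] β x))) := by
  rw [wordVec_append_left, wordVec_cons_left, wordVec_left_right t α']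

theorem wordVec_split_right (t : Fin n → H →L[ℂ] H) (β β' : List (Fin n)) (b : Fin n) (x : H) :
    wordVec t [] (β ++ b :: β') x =
      wordVec t [] β' (star (t b) (wordVec t [] β x)) := by
  rw [wordVec_append_right, wordVec_nil_cons]

/-- Words which stay away from the step at which `v` acts. -/
theorem wordVec_level_of_lt (α β : List (Fin n)) (x : H) (m : ℤ) (ξ : L)
    (h : (β.length : ℤ) < m) :
    wordVec (coact s (levelModel v)) α β (htmul x (htmul (l2.e m) ξ)) =
      htmul (wordVec s α β x) (htmul (l2.e (m - β.length + α.length)) ξ) := by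
  rw [wordVec_left_right, wordVec_level_down s v β x m ξ (Or.inr h),
    wordVec_level_up s v α _ _ ξ (Or.inl (by omega)), ← wordVec_left_right]

/-- From level `|β| + 1` the letters of `β` lead down to `1`, so `b` takes the active step; `β'`
leads on to `-|β'|`. On the way up `α'` returns exactly to `0` because its length equals that of
`β'`, and `a` takes the active step. Only these two letters are replaced. -/
theorem wordVec_level_both (α α' β β' : List (Fin n)) (a b : Fin n) (x : H) (ξ : L)
    (h : α'.length = β'.length) :
    wordVec (coact s (levelModel v)) (α ++ a :: α') (β ++ b :: β')
        (htmul x (htmul (l2.e (β.length + 1 : ℤ)) ξ)) =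
      ∑ d, ∑ c, htmul (wordVec s (α ++ c :: α') (β ++ d :: β') x)
        (htmul (l2.e (1 + α.length : ℤ)) ((v c a * star (v d b)) ξ)) := by
  rw [wordVec_split_left, wordVec_split_right, wordVec_level_down s v β _ _ _ (by omega),
    star_coact_levelModel, if_pos (by omega)]
  simp only [wordVec_sum, map_sum]
  refine Finset.sum_congr rfl fun d _ => ?_
  rw [wordVec_level_down s v β' _ _ _ (by omega), wordVec_level_up s v α' _ _ _ (by omega),
    coact_levelModel, if_pos (by omega), wordVec_sum]
  refine Finset.sum_congr rfl fun c _ => ?_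
  rw [wordVec_level_up s v α _ _ _ (by omega), wordVec_split_left s, wordVec_split_right s]
  rfl

/-- The initial level is at most `0`, so the descent along `β` stays inactive and reaches `-|α'|`;
the ascent then crosses from `0` to `1` at the letter `a`. -/
theorem wordVec_level_left (α α' β : List (Fin n)) (a : Fin n) (x : H) (ξ : L)
    (h : β.length ≤ α'.length) :
    wordVec (coact s (levelModel v)) (α ++ a :: α') β
        (htmul x (htmul (l2.e (β.length - α'.length : ℤ)) ξ)) =
      ∑ c, htmul (wordVec s (α ++ c :: α') β x)
        (htmul (l2.e (1 + α.length : ℤ)) (v c a ξ)) := by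
  rw [wordVec_split_left, wordVec_level_down s v β _ _ _ (by omega),
    wordVec_level_up s v α' _ _ _ (by omega), coact_levelModel, if_pos (by omega), wordVec_sum]
  refine Finset.sum_congr rfl fun c _ => ?_
  rw [wordVec_level_up s v α _ _ _ (by omega), wordVec_split_left s]

/-- Here `α` is too short to climb back from `-|β'|` beyond `0`, so that only `b` takes the active
step. -/
theorem wordVec_level_right (α β β' : List (Fin n)) (b : Fin n) (x : H) (ξ : L)
    (h : α.length ≤ β'.length) :
    wordVec (coact s (levelModel v)) α (β ++ b :: β')
        (htmul x (htmul (l2.e (β.length + 1 : ℤ)) ξ)) =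
      ∑ d, htmul (wordVec s α (β ++ d :: β') x)
        (htmul (l2.e (α.length - β'.length : ℤ)) (star (v d b) ξ)) := by
  rw [wordVec_left_right, wordVec_split_right, wordVec_level_down s v β _ _ _ (by omega),
    star_coact_levelModel, if_pos (by omega)]
  simp only [wordVec_sum]
  refine Finset.sum_congr rfl fun d _ => ?_
  rw [wordVec_level_down s v β' _ _ _ (by omega), wordVec_level_up s v α _ _ _ (by omega),
    wordVec_left_right s α (_ ++ _), wordVec_split_right s, zero_sub, neg_add_eq_sub]

end LevelWords

/-! ### The free group grading of words. -/

section FreeGroupWords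

variable {n : ℕ} {H : Type*} [NormedAddCommGroup H] [InnerProductSpace ℂ H] [CompleteSpace H]

/-- The word `x_α x_β⁻¹` in the free group. -/
def pairWord (α β : List (Fin n)) : List (Fin n × Bool) :=
  α.map (fun i => (i, true)) ++ (β.map fun i => (i, false)).reverse

/-- The diagonal model given by the left regular representation of the free group. -/
def freeModel (n : ℕ) (i j : Fin n) : l2 (FreeGroup (Fin n)) →L[ℂ] l2 (FreeGroup (Fin n)) :=
  if i = j then l2.perm (Equiv.mulLeft (FreeGroup.of i)) else 0

theorem isModel_freeModel (q : Fin n → ℝ) : IsModel q (freeModel n) := by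
  refine isModel_diagonal q (fun i => l2.perm (Equiv.mulLeft (FreeGroup.of i))) (fun i => ?_)
    (fun i => ?_)
  · rw [l2.star_perm, l2.perm_mul, ← l2.perm_one]
    congr 1
    exact inv_mul_cancel (Equiv.mulLeft (FreeGroup.of i))
  · rw [l2.star_perm, l2.perm_mul, ← l2.perm_one]
    congr 1
    exact mul_inv_cancel (Equiv.mulLeft (FreeGroup.of i))

theorem coact_freeModel (s : Fin n → (H →L[ℂ] H)) (j : Fin n) (x : H) (g : FreeGroup (Fin n)) :
    coact s (freeModel n) j (htmul x (l2.e g)) = htmul (s j x) (l2.e (FreeGroup.of j * g)) := by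
  rw [coact_htmul, Finset.sum_eq_single j (fun k _ hk => by
    rw [freeModel, if_neg hk]; exact htmul_zero_right _) (by simp), freeModel, if_pos rfl,
    l2.perm_e]
  rfl

theorem star_coact_freeModel (s : Fin n → (H →L[ℂ] H)) (j : Fin n) (x : H)
    (g : FreeGroup (Fin n)) : star (coact s (freeModel n) j) (htmul x (l2.e g)) =
      htmul (star (s j) x) (l2.e ((FreeGroup.of j)⁻¹ * g)) := by
  rw [star_coact_htmul, Finset.sum_eq_single j (fun k _ hk => by
    rw [freeModel, if_neg hk, star_zero]; exact htmul_zero_right _) (by simp), freeModel,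
    if_pos rfl, l2.star_perm, l2.perm_e]
  rfl

/-- The second factor records the class of `x_α x_β⁻¹`, while the word in the first factor is
unchanged; this is the source of the grading. -/
theorem wordVec_freeModel (s : Fin n → (H →L[ℂ] H)) (α β : List (Fin n)) (x : H) :
    wordVec (coact s (freeModel n)) α β (htmul x (l2.e 1)) =
      htmul (wordVec s α β x) (l2.e (FreeGroup.mk (pairWord α β))) := by
  have down : ∀ (β : List (Fin n)) (x : H) (g : FreeGroup (Fin n)),
      wordVec (coact s (freeModel n)) [] β (htmul x (l2.e g)) =
      htmul (wordVec s [] β x) (l2.e (FreeGroup.mk (pairWord [] β) * g)) := by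
    intro β
    induction β with
    | nil => intro x g; simp [wordVec_nil_nil, pairWord, ← FreeGroup.one_eq_mk]
    | cons j β ih =>
      intro x g
      rw [wordVec_nil_cons, wordVec_nil_cons, star_coact_freeModel, ih, ← mul_assoc]
      congr 3
      simp [pairWord, FreeGroup.of, FreeGroup.inv_mk, FreeGroup.invRev]
  have up : ∀ (α : List (Fin n)) (x : H) (g : FreeGroup (Fin n)),
      wordVec (coact s (freeModel n)) α [] (htmul x (l2.e g)) =
      htmul (wordVec s α [] x) (l2.e (FreeGroup.mk (pairWord α []) * g)) := by
    intro α x g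
    induction α with
    | nil => simp [wordVec_nil_nil, pairWord, ← FreeGroup.one_eq_mk]
    | cons j α ih =>
      rw [wordVec_cons_left, wordVec_cons_left, ih, coact_freeModel, ← mul_assoc]
      rfl
  rw [wordVec_left_right, down, up, ← wordVec_left_right, mul_one]
  congr 2
  simp [pairWord]

/-- The words `α` and `β` do not end with the same letter. -/
def ReducedPair (α β : List (Fin n)) : Prop :=
  ∀ i, i ∈ α.getLast? → i ∉ β.getLast?

/-- Within `x_α` and within `x_β⁻¹` all exponents have the same sign, so a cancellation could happen
only where the two last letters meet. -/
theorem ReducedPair.isReduced {α β : List (Fin n)} (h : ReducedPair α β) :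
    FreeGroup.IsReduced (pairWord α β) := by
  unfold FreeGroup.IsReduced pairWord
  rw [List.isChain_append]
  refine ⟨List.Pairwise.isChain ?_, List.Pairwise.isChain ?_, ?_⟩
  · rw [List.pairwise_map]
    exact List.pairwise_of_forall fun _ _ _ => rfl
  · rw [List.pairwise_reverse, List.pairwise_map]
    exact List.pairwise_of_forall fun _ _ _ => rfl
  · intro x hx y hy hxy
    rw [List.getLast?_map] at hx
    rw [List.head?_reverse, List.getLast?_map] at hy
    simp only [Option.mem_def, Option.map_eq_some_iff] at hx hy
    obtain ⟨i, hi, rfl⟩ := hx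
    obtain ⟨j, hj, rfl⟩ := hy
    simp only at hxy
    subst hxy
    exact absurd hj (h i hi)

/-- Words with the same class in the free group have the same degree. -/
theorem pairWord_length {α β α' β' : List (Fin n)}
    (h : FreeGroup.mk (pairWord α' β') = FreeGroup.mk (pairWord α β)) :
    α'.length + β.length = α.length + β'.length := by
  have key : ∀ α β : List (Fin n),
      (FreeGroup.lift fun _ : Fin n => Multiplicative.ofAdd (1 : ℤ)) (FreeGroup.mk (pairWord α β)) =
        Multiplicative.ofAdd ((α.length : ℤ) - β.length) := by
    intro α β
    rw [FreeGroup.lift_mk, pairWord]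
    simp [List.map_append, List.map_reverse, Function.comp_def, List.map_const', ← ofAdd_nsmul,
      sub_eq_add_neg]
  have h1 := congrArg (FreeGroup.lift fun _ : Fin n => Multiplicative.ofAdd (1 : ℤ)) h
  rw [key, key] at h1
  have h2 := Multiplicative.ofAdd.injective h1
  omega

/-- A word contains its reduced form as a sublist; separating the two signs gives `α ⊆ α'` and `β ⊆
β'` as sublists. Equality of degrees makes both lengths exceed by the same amount. -/
theorem ReducedPair.eq_or_lt {α β α' β' : List (Fin n)} (h : ReducedPair α β)
    (he : FreeGroup.mk (pairWord α' β') = FreeGroup.mk (pairWord α β)) :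
    (α' = α ∧ β' = β) ∨ (α.length < α'.length ∧ β.length < β'.length) := by
  have hlen := pairWord_length he
  have hred : FreeGroup.Red (pairWord α' β') (pairWord α β) := by
    have h1 : FreeGroup.reduce (pairWord α' β') = pairWord α β := by
      rw [FreeGroup.reduce.sound he, h.isReduced.reduce_eq]
    rw [← h1]
    exact FreeGroup.reduce.red
  have hsub : (pairWord α β).Sublist (pairWord α' β') := hred.sublist
  have hα : α.Sublist α' := by
    have := (hsub.filter fun p => p.2).map Prod.fst
    simpa [pairWord, List.filter_append, List.filter_map, Function.comp_def] using this
  have hβ : β.Sublist β' := by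
    have := ((hsub.filter fun p => !p.2).map Prod.fst).reverse
    simpa [pairWord, List.filter_append, List.filter_map, Function.comp_def] using this
  have h1 := hα.length_le
  rcases h1.eq_or_lt with h1 | h1
  · left
    exact ⟨(hα.eq_of_length h1).symm, (hβ.eq_of_length (by omega)).symm⟩
  · right
    exact ⟨h1, by omega⟩

end FreeGroupWords

/-! ### Inner products of words and eigenvectors of covariant operators. -/

section Covariant

variable {n : ℕ} {H : Type*} [NormedAddCommGroup H] [InnerProductSpace ℂ H] [CompleteSpace H]

/-- `R` commutes with the unitary representation `a Ω ⊗ ξ ↦ τ_v(a)(Ω ⊗ ξ)` attached to every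
model `v`. -/
structure IsCovariant (q : Fin n → ℝ) (s : Fin n → (H →L[ℂ] H)) (Ω : H) (R : H →L[ℂ] H) :
    Prop where
  form : ∀ {L : Type} [NormedAddCommGroup L] [InnerProductSpace ℂ L] [CompleteSpace L]
    {v : Fin n → Fin n → (L →L[ℂ] L)}, IsModel q v → ∀ (α' β' α β : List (Fin n)) (ξ ζ : L),
    inner ℂ (wordVec (coact s v) α' β' (htmul Ω ξ))
      (opTensor R 1 (wordVec (coact s v) α β (htmul Ω ζ))) =
      inner ℂ (wordVec s α' β' Ω) (R (wordVec s α β Ω)) * inner ℂ ξ ζ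
  eigen : ∀ {L : Type} [NormedAddCommGroup L] [InnerProductSpace ℂ L] [CompleteSpace L]
    {v : Fin n → Fin n → (L →L[ℂ] L)}, IsModel q v → ∀ (α β : List (Fin n)) (c : ℂ),
    R (wordVec s α β Ω) = c • wordVec s α β Ω → ∀ ξ : L,
      opTensor R 1 (wordVec (coact s v) α β (htmul Ω ξ)) =
        c • wordVec (coact s v) α β (htmul Ω ξ)

/-- A cyclic vector with a covariant representation of the Cuntz relations, in which the action
of the free unitary quantum group of `diag q` is unitarily implemented. -/
structure IsCovariantSystem (q : Fin n → ℝ) (s : Fin n → (H →L[ℂ] H)) (Ω : H) : Prop where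
  pos : ∀ i, 0 < q i
  sum_eq_one : ∑ i, q i = 1
  star_mul : ∀ i j, star (s i) * s j = if i = j then 1 else 0
  sum_mul_star : ∑ i, s i * star (s i) = 1
  inner_self : inner ℂ Ω Ω = (1 : ℂ)
  covariant_one : IsCovariant q s Ω 1
  total : ∀ z, (∀ α β, inner ℂ (wordVec s α β Ω) z = (0 : ℂ)) → z = 0

variable {q : Fin n → ℝ} {s : Fin n → (H →L[ℂ] H)} {Ω : H} {R : H →L[ℂ] H}

/-- In the free group model, started at the unit of the group, the two words end in different basis
vectors. -/
theorem IsCovariant.inner_eq_zero (h : IsCovariant q s Ω R) {α β α' β' : List (Fin n)}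
    (hne : FreeGroup.mk (pairWord α' β') ≠ FreeGroup.mk (pairWord α β)) :
    inner ℂ (wordVec s α' β' Ω) (R (wordVec s α β Ω)) = (0 : ℂ) := by
  have h1 := h.form (isModel_freeModel q) α' β' α β (l2.e 1) (l2.e 1)
  rw [wordVec_freeModel, wordVec_freeModel, opTensor_htmul, inner_htmul, one_apply_eq_self,
    l2.inner_e_e, l2.inner_e_e, if_neg hne, if_pos rfl, mul_zero, mul_one] at h1
  exact h1.symm

theorem reducedPair_concat {i j : Fin n} (h : i ≠ j) (α β : List (Fin n)) :
    ReducedPair (α ++ [i]) (β ++ [j]) := by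
  intro k hk hk'
  simp only [List.getLast?_append, List.getLast?_singleton, Option.some_or, Option.mem_def,
    Option.some.injEq] at hk hk'
  exact h (hk.trans hk'.symm)

theorem IsCovariantSystem.wordVec_eq_sum (h : IsCovariantSystem q s Ω) (α β : List (Fin n))
    (x : H) : wordVec s α β x = ∑ i, wordVec s (α ++ [i]) (β ++ [i]) x := by
  have h1 : ∀ i, wordVec s (α ++ [i]) (β ++ [i]) x =
      wordVec s α [] ((s i * star (s i)) (wordVec s [] β x)) := by
    intro i
    rw [wordVec_split_left, wordVec_split_right]
    simp only [wordVec_nil_nil]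
    rfl
  rw [Finset.sum_congr rfl fun i _ => h1 i, ← wordVec_sum, ← ContinuousLinearMap.sum_apply,
    h.sum_mul_star, wordVec_left_right]
  rfl

theorem exists_inner_ne_zero {L : Type*} [NormedAddCommGroup L] [InnerProductSpace ℂ L]
    {A : L →L[ℂ] L} (hA : A ≠ 0) : ∃ ξ ζ, inner ℂ ζ (A ξ) ≠ (0 : ℂ) := by
  obtain ⟨ξ, hξ⟩ : ∃ ξ, A ξ ≠ 0 := by
    by_contra! h
    exact hA (ContinuousLinearMap.ext h)
  exact ⟨ξ, A ξ, inner_self_ne_zero.2 hξ⟩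

theorem IsMixing.diag_ne_zero {L : Type*} [NormedAddCommGroup L] [InnerProductSpace ℂ L]
    [CompleteSpace L] {i j : Fin n} {v : Fin n → Fin n → (L →L[ℂ] L)} (hv : IsMixing q i j v) :
    v i i * star (v i j) ≠ 0 := by
  intro h0
  apply hv.mul_diag' i
  rw [← star_star (v i j * star (v i i)), star_mul, star_star, h0, star_zero]

/-- The off-diagonal weighted relation keeps only the summands `i` and `j`. It is what brings the
ratio `q_i : q_j` into inner products. -/
theorem IsMixing.weight {L : Type*} [NormedAddCommGroup L] [InnerProductSpace ℂ L]
    [CompleteSpace L] {i j : Fin n} {v : Fin n → Fin n → (L →L[ℂ] L)} (hv : IsMixing q i j v)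
    (hij : i ≠ j) :
    (q j : ℂ) • (v j i * star (v j j)) = -((q i : ℂ) • (v i i * star (v i j))) := by
  have h1 := hv.isModel.weight_mul_star i j
  rw [sum_pair_or_single hij _ (fun k hk hk' => by
    rw [hv.left k hk hk', if_neg hk, zero_mul, smul_zero]), if_neg hij] at h1
  exact (neg_eq_of_add_eq_zero_right h1).symm

/-- Removing a common last letter of a pair of words. -/
theorem IsCovariantSystem.inner_concat (hS : IsCovariantSystem q s Ω) (h : IsCovariant q s Ω R)
    {α β α' β' : List (Fin n)} (hle : β'.length ≤ β.length) (i : Fin n) :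
    inner ℂ (wordVec s (α ++ [i]) (β ++ [i]) Ω) (R (wordVec s α' β' Ω)) =
      (q i : ℂ) * inner ℂ (wordVec s α β Ω) (R (wordVec s α' β' Ω)) := by
  set Y : Fin n → Fin n → ℂ := fun k l =>
    inner ℂ (wordVec s (α ++ [k]) (β ++ [l]) Ω) (R (wordVec s α' β' Ω)) with hY
  -- For `k ≠ l` the pair `(αk, βl)` is reduced, so a pair with the same group element has a right
  -- word of length at least `|β| + 1`, and `β'` is shorter.
  have hoff : ∀ k l, k ≠ l → Y k l = 0 := by
    intro k l hkl
    refine h.inner_eq_zero fun he => ?_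
    rcases (reducedPair_concat hkl α β).eq_or_lt he.symm with ⟨-, h2⟩ | ⟨-, h2⟩
    · have := congrArg List.length h2
      simp at this; omega
    · simp at h2; omega
  have hsum : inner ℂ (wordVec s α β Ω) (R (wordVec s α' β' Ω)) = ∑ j, Y j j := by
    rw [hS.wordVec_eq_sum α β, sum_inner]
  have hrat : ∀ j, (q j : ℂ) * Y i i = q i * Y j j := by
    intro j
    rcases eq_or_ne i j with rfl | hij
    · rfl
    -- Equality of degrees makes both words end at the same level below; otherwise all `Y k k`
    -- vanish by the grading.
    by_cases hlen : α.length + β'.length = β.length + α'.length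
    swap
    · have h0 : ∀ k, Y k k = 0 := by
        intro k
        refine h.inner_eq_zero fun he => hlen ?_
        have := pairWord_length he
        simp at this; omega
      rw [h0, h0, mul_zero, mul_zero]
    obtain ⟨v, hv⟩ := exists_isMixing hS.pos hij
    obtain ⟨ξ, ζ, hξ⟩ := exists_inner_ne_zero hv.diag_ne_zero
    -- The off-diagonal word `(αi, βj)` contributes zero on the right. On the left its image has
    -- coefficients `v_ci v_dj*` at `(αc, βd)`, of which only `(i,i)` and `(j,j)` remain, giving
    -- `Y_ii (v_ii v_ij*) + Y_jj (v_ji v_jj*) = 0` in matrix coefficients. The initial level `|β| +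
    -- 1` keeps the other word inactive.
    have h1 := h.form (isModel_levelModel hv.isModel) (α ++ [i]) (β ++ [j]) α' β'
      (htmul (l2.e (β.length + 1 : ℤ)) ξ) (htmul (l2.e (β.length + 1 : ℤ)) ζ)
    rw [wordVec_level_both s v α [] β [] i j Ω ξ rfl,
      wordVec_level_of_lt s v α' β' Ω _ ζ (by omega), opTensor_htmul, one_apply_eq_self] at h1
    have hl : (β.length + 1 - β'.length + α'.length : ℤ) = 1 + α.length := by omega
    simp only [sum_inner, inner_htmul, hl, l2.inner_e_e, if_true, one_mul] at h1
    change ∑ d, ∑ c, Y c d * inner ℂ ((v c i * star (v d j)) ξ) ζ = Y i j * _ at h1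
    rw [hoff i j hij, zero_mul] at h1
    have h2 : ∀ d, ∑ c, Y c d * inner ℂ ((v c i * star (v d j)) ξ) ζ =
        Y d d * inner ℂ ((v d i * star (v d j)) ξ) ζ := fun d =>
      Finset.sum_eq_single d (fun c _ hc => by rw [hoff c d hc, zero_mul]) (by simp)
    rw [Finset.sum_congr rfl fun d _ => h2 d, sum_pair_or_single hij _ (fun k hk hk' => by
      rw [hv.left k hk hk', if_neg hk, zero_mul, zero_apply, inner_zero_left, mul_zero])] at h1
    have h3 := congrArg (fun T : l2 ℕ →L[ℂ] l2 ℕ => (inner ℂ (T ξ) ζ : ℂ)) (hv.weight hij)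
    simp only [neg_apply, smul_apply, inner_neg_left, inner_smul_left, Complex.conj_ofReal] at h3
    have h4 : inner ℂ ((v i i * star (v i j)) ξ) ζ ≠ (0 : ℂ) := by
      intro h0
      apply hξ
      rw [← inner_conj_symm, h0, map_zero]
    refine mul_right_cancel₀ h4 ?_
    linear_combination (q j : ℂ) * h1 - Y j j * h3
  change Y i i = _
  have hq1 : (∑ j, (q j : ℂ)) = 1 := by exact_mod_cast hS.sum_eq_one
  rw [hsum, Finset.mul_sum, ← Finset.sum_congr rfl fun j _ => hrat j, ← Finset.sum_mul, hq1, one_mul]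

/-- The weight of a word. -/
def wordWeight (q : Fin n → ℝ) (β : List (Fin n)) : ℝ := (β.map q).prod

theorem IsCovariantSystem.wordWeight_pos (hS : IsCovariantSystem q s Ω) (β : List (Fin n)) :
    0 < wordWeight q β := by
  refine List.prod_pos fun x hx => ?_
  obtain ⟨i, -, rfl⟩ := List.mem_map.1 hx
  exact hS.pos i

/-- The hypothesis says `x_α = x_β` for positive words, and positive words are reduced. -/
theorem mk_pairWord_eq_one {α β : List (Fin n)}
    (h : FreeGroup.mk (pairWord α β) = FreeGroup.mk (pairWord [] [])) : α = β := by
  have h1 : FreeGroup.mk (pairWord α β) =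
      FreeGroup.mk (pairWord α []) * (FreeGroup.mk (pairWord β []))⁻¹ := by
    simp [pairWord, FreeGroup.inv_mk, FreeGroup.invRev, Function.comp_def]
  have h2 : FreeGroup.mk (pairWord α []) = FreeGroup.mk (pairWord β []) := by
    rw [h1] at h
    exact mul_inv_eq_one.1 h
  have h3 : ReducedPair β ([] : List (Fin n)) := by intro i _; simp
  rcases h3.eq_or_lt h2 with h | h
  · exact h.1
  · simp at h

/-- The invariant state is thereby determined: `inner_concat` with `R = 1` removes equal last
letters one by one, and the grading excludes `α ≠ β`. -/
theorem IsCovariantSystem.inner_vacuum (hS : IsCovariantSystem q s Ω) (α β : List (Fin n)) :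
    inner ℂ (wordVec s α β Ω) Ω = if α = β then (wordWeight q β : ℂ) else 0 := by
  have e : ∀ α β, (inner ℂ (wordVec s α β Ω) Ω : ℂ) =
      inner ℂ (wordVec s α β Ω) ((1 : H →L[ℂ] H) (wordVec s [] [] Ω)) := by
    intro α β
    rw [wordVec_nil_nil, one_apply_eq_self]
  split_ifs with h
  · subst h
    induction α using List.reverseRecOn with
    | nil => rw [wordVec_nil_nil, hS.inner_self]; simp [wordWeight]
    | append_singleton α i ih =>
      rw [e, hS.inner_concat hS.covariant_one (by simp), ← e, ih]
      simp [wordWeight, mul_comm]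
  · rw [e]
    exact hS.covariant_one.inner_eq_zero fun he => h (mk_pairWord_eq_one he)

theorem IsCovariantSystem.star_prod_mul_prod (hS : IsCovariantSystem q s Ω) {α' α : List (Fin n)}
    (h : α'.length = α.length) :
    star (α'.map s).prod * (α.map s).prod = if α' = α then 1 else 0 := by
  induction α' generalizing α with
  | nil =>
    obtain rfl := List.length_eq_zero_iff.1 h.symm
    simp
  | cons i α' ih =>
    rcases α with _ | ⟨j, α⟩
    · simp at h
    · rw [List.map_cons, List.map_cons, List.prod_cons, List.prod_cons, StarMul.star_mul, mul_assoc,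
        ← mul_assoc (star (s i)), hS.star_mul]
      by_cases hij : i = j
      · rw [if_pos hij, one_mul, ih (by simpa using h)]
        simp [hij]
      · rw [if_neg hij, zero_mul, mul_zero, if_neg]
        simp [hij]

/-- For left words of equal length the Cuntz relations give `s_α'* s_α = δ`; what is left is the
value of the state on `s_β s_β'*`. -/
theorem IsCovariantSystem.inner_wordVec (hS : IsCovariantSystem q s Ω) {α' β' α β : List (Fin n)}
    (h : α'.length = α.length) : inner ℂ (wordVec s α' β' Ω) (wordVec s α β Ω) =
      if α' = α ∧ β' = β then (wordWeight q β : ℂ) else 0 := by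
  have h1 : (inner ℂ (wordVec s α' β' Ω) (wordVec s α β Ω) : ℂ) =
      inner ℂ (star (β'.map s).prod Ω) ((star (α'.map s).prod * (α.map s).prod)
        (star (β.map s).prod Ω)) := by
    change inner ℂ ((α'.map s).prod _) _ = inner ℂ _ (star (α'.map s).prod _)
    rw [ContinuousLinearMap.star_eq_adjoint (α'.map s).prod,
      ContinuousLinearMap.adjoint_inner_right]
    rfl
  have h2 : (inner ℂ (star (β'.map s).prod Ω) (star (β.map s).prod Ω) : ℂ) =
      inner ℂ (wordVec s β β' Ω) Ω := by
    rw [ContinuousLinearMap.star_eq_adjoint (β.map s).prod,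
      ContinuousLinearMap.adjoint_inner_right]
    rfl
  rw [h1, hS.star_prod_mul_prod h]
  by_cases hα : α' = α
  · rw [if_pos hα, one_apply_eq_self, h2, hS.inner_vacuum]
    by_cases hβ : β' = β
    · rw [if_pos hβ.symm, if_pos ⟨hα, hβ⟩, hβ]
    · rw [if_neg (Ne.symm hβ), if_neg (fun h => hβ h.2)]
  · rw [if_neg hα, zero_apply, inner_zero_right, if_neg (fun h => hα h.1)]

theorem IsCovariantSystem.inner_self_ne_zero (hS : IsCovariantSystem q s Ω)
    (α β : List (Fin n)) : inner ℂ (wordVec s α β Ω) (wordVec s α β Ω) ≠ (0 : ℂ) := by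
  rw [hS.inner_wordVec rfl, if_pos ⟨rfl, rfl⟩]
  exact_mod_cast (hS.wordWeight_pos β).ne'

/-- Vectors of reduced pairs of words are eigenvectors. -/
theorem IsCovariantSystem.exists_eigenvalue (hS : IsCovariantSystem q s Ω)
    (h : IsCovariant q s Ω R) {α β : List (Fin n)} (hr : ReducedPair α β) :
    ∃ c : ℂ, R (wordVec s α β Ω) = c • wordVec s α β Ω := by
  set e := wordVec s α β Ω with he
  have he0 : inner ℂ e e ≠ (0 : ℂ) := hS.inner_self_ne_zero α β
  refine ⟨inner ℂ e (R e) / inner ℂ e e, ?_⟩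
  set c : ℂ := inner ℂ e (R e) / inner ℂ e e with hc
  rw [← sub_eq_zero]
  -- With `c` chosen by projecting `R e` onto `e`, it remains to see that `R e - c e` is orthogonal
  -- to all words. Words with a different group element are orthogonal to both terms; the others are
  -- `e` itself or longer words, which are shortened.
  refine hS.total _ fun α' => ?_
  induction α' using List.reverseRecOn with
  | nil =>
    intro β'
    by_cases hm : FreeGroup.mk (pairWord [] β') = FreeGroup.mk (pairWord α β)
    · rcases hr.eq_or_lt hm with ⟨h1, h2⟩ | ⟨h1, -⟩
      · rw [h1, h2, ← he, inner_sub_right, inner_smul_right, hc, div_mul_cancel₀ _ he0, sub_self]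
      · simp at h1
    · have h1 := hS.covariant_one.inner_eq_zero hm
      rw [one_apply_eq_self] at h1
      rw [inner_sub_right, inner_smul_right, h1, h.inner_eq_zero hm, mul_zero, sub_zero]
  | append_singleton α' i ih =>
    intro β'
    by_cases hm : FreeGroup.mk (pairWord (α' ++ [i]) β') = FreeGroup.mk (pairWord α β)
    · rcases hr.eq_or_lt hm with ⟨h1, h2⟩ | ⟨h1, h2⟩
      · rw [h1, h2, ← he, inner_sub_right, inner_smul_right, hc, div_mul_cancel₀ _ he0, sub_self]
      · rcases List.eq_nil_or_concat β' with rfl | ⟨β', j, rfl⟩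
        · simp at h2
        rw [List.concat_eq_append] at *
        -- Otherwise the longer word would be reduced too, and two reduced pairs with the same group
        -- element coincide.
        have hij : i = j := by
          by_contra hij
          rcases (reducedPair_concat hij α' β').eq_or_lt hm.symm with ⟨h3, -⟩ | ⟨h3, -⟩
          · rw [h3] at h1; exact lt_irrefl _ h1
          · exact lt_asymm h1 h3
        subst hij
        have hle : β.length ≤ β'.length := by simp at h2; omega
        have h3 := hS.inner_concat hS.covariant_one (α := α') (α' := α) hle i
        have h4 := hS.inner_concat h (α := α') (α' := α) hle i
        have h5 := ih β'
        rw [inner_sub_right, inner_smul_right] at h5 ⊢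
        rw [one_apply_eq_self] at h3
        rw [h3, h4]
        linear_combination (q i : ℂ) * h5
    · have h1 := hS.covariant_one.inner_eq_zero hm
      rw [one_apply_eq_self] at h1
      rw [inner_sub_right, inner_smul_right, h1, h.inner_eq_zero hm, mul_zero, sub_zero]

end Covariant

/-! ### Transport of eigenvalues by changing letters. -/

section Eigenvalues

variable {n : ℕ} {H : Type*} [NormedAddCommGroup H] [InnerProductSpace ℂ H] [CompleteSpace H]
  {q : Fin n → ℝ} {s : Fin n → (H →L[ℂ] H)} {Ω : H} {R : H →L[ℂ] H}

/-- If `∑ k, w_k ⊗ T_k ξ` is an eigenvector of `R ⊗ 1`, then each `w_k` with `T_k ≠ 0` which is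
separated from the others has the same eigenvalue. -/
theorem eigenvalue_unique_of_sum {ι L K : Type*} [Fintype ι] [NormedAddCommGroup L]
    [InnerProductSpace ℂ L] [NormedAddCommGroup K] [InnerProductSpace ℂ K] (w : ι → H)
    (T : ι → L →L[ℂ] L) (e : K) (he : inner ℂ e e ≠ (0 : ℂ)) (c c' : ℂ) (k : ι)
    (hw : inner ℂ (w k) (w k) ≠ (0 : ℂ))
    (h1 : ∀ l, l ≠ k → inner ℂ (w k) (w l) = (0 : ℂ))
    (h2 : ∀ l, l ≠ k → inner ℂ (w k) (R (w l)) = (0 : ℂ)) (h3 : R (w k) = c' • w k) (hT : T k ≠ 0)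
    (h : ∀ ξ, opTensor R (1 : HilbertTensor K L →L[ℂ] HilbertTensor K L)
      (∑ l, htmul (w l) (htmul e (T l ξ))) = c • ∑ l, htmul (w l) (htmul e (T l ξ))) : c' = c := by
  obtain ⟨ξ, ζ, hξ⟩ := exists_inner_ne_zero hT
  -- Pairing with `w_k ⊗ e ⊗ ζ` isolates the `k`-th term on both sides; `ζ` is chosen so that its
  -- coefficient is nonzero.
  have h4 := congrArg (fun z => (inner ℂ (htmul (w k) (htmul e ζ)) z : ℂ)) (h ξ)
  simp only [map_sum, opTensor_htmul, inner_sum, inner_smul_right, inner_htmul,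
    one_apply_eq_self] at h4
  rw [Finset.sum_eq_single k (fun l _ hl => by rw [h2 l hl, zero_mul]) (by simp),
    Finset.sum_eq_single k (fun l _ hl => by rw [h1 l hl, zero_mul]) (by simp), h3,
    inner_smul_right] at h4
  have h5 : inner ℂ (w k) (w k) * (inner ℂ e e * inner ℂ ζ (T k ξ)) ≠ (0 : ℂ) :=
    mul_ne_zero hw (mul_ne_zero he hξ)
  refine mul_right_cancel₀ h5 ?_
  rw [← mul_assoc, h4]

theorem ReducedPair.mk_ne {α β α' β' : List (Fin n)} (h : ReducedPair α β)
    (hl : α'.length = α.length) (hne : ¬ (α' = α ∧ β' = β)) :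
    FreeGroup.mk (pairWord α β) ≠ FreeGroup.mk (pairWord α' β') := by
  intro he
  rcases h.eq_or_lt he.symm with h1 | ⟨h1, -⟩
  · exact hne h1
  · omega

theorem IsCovariantSystem.inner_eq_zero_of_reduced (hS : IsCovariantSystem q s Ω)
    (h : IsCovariant q s Ω R) {α β α' β' : List (Fin n)} (hr : ReducedPair α β)
    (hl : α'.length = α.length) (hne : ¬ (α' = α ∧ β' = β)) :
    inner ℂ (wordVec s α β Ω) (wordVec s α' β' Ω) = (0 : ℂ) ∧
      inner ℂ (wordVec s α β Ω) (R (wordVec s α' β' Ω)) = (0 : ℂ) :=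
  ⟨hS.covariant_one.inner_eq_zero (hr.mk_ne hl hne), h.inner_eq_zero (hr.mk_ne hl hne)⟩

theorem l2.inner_e_self_ne_zero {I : Type*} [DecidableEq I] (i : I) :
    inner ℂ (l2.e i) (l2.e i) ≠ (0 : ℂ) := by
  rw [l2.inner_e_e, if_pos rfl]; exact one_ne_zero

/-- Changing a letter of `α` and the letter of `β` at the same distance from the end. -/
theorem IsCovariantSystem.eigen_change_both (hS : IsCovariantSystem q s Ω)
    (h : IsCovariant q s Ω R) {L : Type} [NormedAddCommGroup L] [InnerProductSpace ℂ L]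
    [CompleteSpace L] {v : Fin n → Fin n → (L →L[ℂ] L)} (hv : IsModel q v)
    {α α' β β' : List (Fin n)} {a b x y : Fin n} (hlen : α'.length = β'.length)
    (hr : ReducedPair (α ++ x :: α') (β ++ y :: β')) (hT : v x a * star (v y b) ≠ 0) {c : ℂ}
    (hc : R (wordVec s (α ++ a :: α') (β ++ b :: β') Ω) =
      c • wordVec s (α ++ a :: α') (β ++ b :: β') Ω) :
    R (wordVec s (α ++ x :: α') (β ++ y :: β') Ω) =
      c • wordVec s (α ++ x :: α') (β ++ y :: β') Ω := by
  obtain ⟨c', hc'⟩ := hS.exists_eigenvalue h hr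
  have key : c' = c := by
    refine eigenvalue_unique_of_sum (R := R) (ι := Fin n × Fin n)
      (fun p => wordVec s (α ++ p.2 :: α') (β ++ p.1 :: β') Ω)
      (fun p => v p.2 a * star (v p.1 b)) (l2.e (1 + α.length : ℤ)) (l2.inner_e_self_ne_zero _)
      c c' (y, x) (hS.inner_self_ne_zero _ _) ?_ ?_ hc' hT ?_
    · rintro ⟨d, e⟩ hl
      refine (hS.inner_eq_zero_of_reduced h hr (by simp) ?_).1
      rintro ⟨h1, h2⟩
      simp only [List.append_cancel_left_eq, List.cons.injEq, and_true] at h1 h2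
      exact hl (by rw [h1, h2])
    · rintro ⟨d, e⟩ hl
      refine (hS.inner_eq_zero_of_reduced h hr (by simp) ?_).2
      rintro ⟨h1, h2⟩
      simp only [List.append_cancel_left_eq, List.cons.injEq, and_true] at h1 h2
      exact hl (by rw [h1, h2])
    · intro ξ
      -- The image of the given eigenvector is an eigenvector of `R ⊗ 1` with the same eigenvalue.
      -- Its component at the reduced pair with the letters `x`, `y` is nonzero by `hT` and
      -- separated from the others by the grading.
      have h1 := h.eigen (isModel_levelModel hv) _ _ c hc (htmul (l2.e (β.length + 1 : ℤ)) ξ)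
      rw [wordVec_level_both s v α α' β β' a b Ω ξ hlen] at h1
      rw [Fintype.sum_prod_type]
      exact h1
  rw [hc', key]

/-- If `β` has no letter opposite to the one to be changed, the level model touches that letter
alone. Otherwise the opposite letter `b` is touched as well, but it can be kept because `v_yx v_bb*
≠ 0`. -/
theorem IsCovariantSystem.eigen_change_left (hS : IsCovariantSystem q s Ω)
    (h : IsCovariant q s Ω R) {α α' β : List (Fin n)} {x y : Fin n}
    (hr : ReducedPair (α ++ y :: α') β) {c : ℂ}
    (hc : R (wordVec s (α ++ x :: α') β Ω) = c • wordVec s (α ++ x :: α') β Ω) :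
    R (wordVec s (α ++ y :: α') β Ω) = c • wordVec s (α ++ y :: α') β Ω := by
  rcases eq_or_ne x y with rfl | hxy
  · exact hc
  obtain ⟨v, hv⟩ := exists_isMixing hS.pos hxy
  rcases le_or_gt β.length α'.length with hle | hlt
  · obtain ⟨c', hc'⟩ := hS.exists_eigenvalue h hr
    have key : c' = c := by
      have hT : v y x ≠ 0 := by
        intro h0
        exact hv.mul_diag x (by rw [h0, zero_mul])
      refine eigenvalue_unique_of_sum (R := R) (ι := Fin n)
        (fun p => wordVec s (α ++ p :: α') β Ω)
        (fun p => v p x) (l2.e (1 + α.length : ℤ)) (l2.inner_e_self_ne_zero _)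
        c c' y (hS.inner_self_ne_zero _ _) ?_ ?_ hc' hT ?_
      · intro d hl
        refine (hS.inner_eq_zero_of_reduced h hr (by simp) ?_).1
        rintro ⟨h1, -⟩
        simp only [List.append_cancel_left_eq, List.cons.injEq, and_true] at h1
        exact hl h1
      · intro d hl
        refine (hS.inner_eq_zero_of_reduced h hr (by simp) ?_).2
        rintro ⟨h1, -⟩
        simp only [List.append_cancel_left_eq, List.cons.injEq, and_true] at h1
        exact hl h1
      · intro ξ
        have h1 := h.eigen (isModel_levelModel hv.isModel) _ _ c hc
          (htmul (l2.e (β.length - α'.length : ℤ)) ξ)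
        rw [wordVec_level_left s v α α' β x Ω ξ hle] at h1
        exact h1
    rw [hc', key]
  -- The letter `b` is the one of `β` at the same distance from the end as the letter being changed
  -- in `α`.
  · obtain ⟨β₁, b, β₂, rfl, hβ⟩ : ∃ β₁ b β₂, β = β₁ ++ b :: β₂ ∧ α'.length = β₂.length := by
      have hk : β.length - α'.length - 1 < β.length := by omega
      refine ⟨β.take (β.length - α'.length - 1), β[β.length - α'.length - 1],
        β.drop (β.length - α'.length - 1 + 1), ?_, ?_⟩
      · rw [List.cons_getElem_drop_succ, List.take_append_drop]
      · rw [List.length_drop]; omega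
    exact hS.eigen_change_both h hv.isModel hβ hr (hv.mul_diag b) hc

theorem IsCovariantSystem.eigen_change_right (hS : IsCovariantSystem q s Ω)
    (h : IsCovariant q s Ω R) {α β β' : List (Fin n)} {x y : Fin n}
    (hr : ReducedPair α (β ++ y :: β')) {c : ℂ}
    (hc : R (wordVec s α (β ++ x :: β') Ω) = c • wordVec s α (β ++ x :: β') Ω) :
    R (wordVec s α (β ++ y :: β') Ω) = c • wordVec s α (β ++ y :: β') Ω := by
  rcases eq_or_ne x y with rfl | hxy
  · exact hc
  obtain ⟨v, hv⟩ := exists_isMixing hS.pos hxy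
  rcases le_or_gt α.length β'.length with hle | hlt
  · obtain ⟨c', hc'⟩ := hS.exists_eigenvalue h hr
    have key : c' = c := by
      have hT : star (v y x) ≠ 0 := by
        intro h0
        exact hv.mul_diag x (by rw [star_eq_zero.1 h0, zero_mul])
      refine eigenvalue_unique_of_sum (R := R) (ι := Fin n)
        (fun p => wordVec s α (β ++ p :: β') Ω)
        (fun p => star (v p x)) (l2.e (α.length - β'.length : ℤ)) (l2.inner_e_self_ne_zero _)
        c c' y (hS.inner_self_ne_zero _ _) ?_ ?_ hc' hT ?_
      · intro d hl
        refine (hS.inner_eq_zero_of_reduced h hr (by simp) ?_).1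
        rintro ⟨-, h1⟩
        simp only [List.append_cancel_left_eq, List.cons.injEq, and_true] at h1
        exact hl h1
      · intro d hl
        refine (hS.inner_eq_zero_of_reduced h hr (by simp) ?_).2
        rintro ⟨-, h1⟩
        simp only [List.append_cancel_left_eq, List.cons.injEq, and_true] at h1
        exact hl h1
      · intro ξ
        have h1 := h.eigen (isModel_levelModel hv.isModel) _ _ c hc
          (htmul (l2.e (β.length + 1 : ℤ)) ξ)
        rw [wordVec_level_right s v α β β' x Ω ξ hle] at h1
        exact h1
    rw [hc', key]
  · obtain ⟨α₁, a, α₂, rfl, hα⟩ : ∃ α₁ a α₂, α = α₁ ++ a :: α₂ ∧ α₂.length = β'.length := by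
      have hk : α.length - β'.length - 1 < α.length := by omega
      refine ⟨α.take (α.length - β'.length - 1), α[α.length - β'.length - 1],
        α.drop (α.length - β'.length - 1 + 1), ?_, ?_⟩
      · rw [List.cons_getElem_drop_succ, List.take_append_drop]
      · rw [List.length_drop]; omega
    refine hS.eigen_change_both h hv.isModel hα hr (fun h0 => hv.mul_diag a ?_) hc
    rw [← star_star (v y x * star (v a a)), StarMul.star_mul, star_star, h0, star_zero]

/-- With the ending `r` fixed every intermediate pair is reduced by `hr`, so the letters of `t` can
be replaced from left to right; `p` collects those already replaced. -/
theorem IsCovariantSystem.eigen_change_prefix_left (hS : IsCovariantSystem q s Ω)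
    (h : IsCovariant q s Ω R) {r β : List (Fin n)} (hr : ∀ w, ReducedPair (w ++ r) β) {c : ℂ}
    (t t' p : List (Fin n)) (hl : t.length = t'.length)
    (hc : R (wordVec s (p ++ t ++ r) β Ω) = c • wordVec s (p ++ t ++ r) β Ω) :
    R (wordVec s (p ++ t' ++ r) β Ω) = c • wordVec s (p ++ t' ++ r) β Ω := by
  induction t generalizing t' p with
  | nil => obtain rfl := List.length_eq_zero_iff.1 hl.symm; exact hc
  | cons x t ih =>
    rcases t' with _ | ⟨y, t'⟩
    · simp at hl
    have h1 : ∀ (x : Fin n) t, p ++ x :: t ++ r = p ++ [x] ++ t ++ r := by simp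
    rw [h1]
    refine ih t' (p ++ [y]) (by simpa using hl) ?_
    have h2 : ∀ x : Fin n, p ++ [x] ++ t ++ r = p ++ x :: (t ++ r) := by simp
    rw [h2]
    refine hS.eigen_change_left h ?_ (x := x) (by simpa using hc)
    have := hr (p ++ y :: t)
    simpa using this

theorem IsCovariantSystem.eigen_change_prefix_right (hS : IsCovariantSystem q s Ω)
    (h : IsCovariant q s Ω R) {r α : List (Fin n)} (hr : ∀ w, ReducedPair α (w ++ r)) {c : ℂ}
    (t t' p : List (Fin n)) (hl : t.length = t'.length)
    (hc : R (wordVec s α (p ++ t ++ r) Ω) = c • wordVec s α (p ++ t ++ r) Ω) :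
    R (wordVec s α (p ++ t' ++ r) Ω) = c • wordVec s α (p ++ t' ++ r) Ω := by
  induction t generalizing t' p with
  | nil => obtain rfl := List.length_eq_zero_iff.1 hl.symm; exact hc
  | cons x t ih =>
    rcases t' with _ | ⟨y, t'⟩
    · simp at hl
    have h1 : ∀ (x : Fin n) t, p ++ x :: t ++ r = p ++ [x] ++ t ++ r := by simp
    rw [h1]
    refine ih t' (p ++ [y]) (by simpa using hl) ?_
    have h2 : ∀ x : Fin n, p ++ [x] ++ t ++ r = p ++ x :: (t ++ r) := by simp
    rw [h2]
    refine hS.eigen_change_right h ?_ (x := x) (by simpa using hc)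
    have := hr (p ++ y :: t)
    simpa using this

theorem reducedPair_nil_right (α : List (Fin n)) : ReducedPair α [] := by intro i _; simp

theorem reducedPair_nil_left (β : List (Fin n)) : ReducedPair [] β := by intro i hi; simp at hi

theorem ReducedPair.ne {α β : List (Fin n)} {i j : Fin n}
    (h : ReducedPair (α ++ [i]) (β ++ [j])) : i ≠ j := by
  rintro rfl
  exact h i (by simp) (by simp)

/-- All reduced pairs of words of the same lengths have the same eigenvalue. -/
theorem IsCovariantSystem.eigen_reduced (hS : IsCovariantSystem q s Ω) (h : IsCovariant q s Ω R)
    {α β α' β' : List (Fin n)} (hr : ReducedPair α β) (hr' : ReducedPair α' β')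
    (hα : α.length = α'.length) (hβ : β.length = β'.length) {c : ℂ}
    (hc : R (wordVec s α β Ω) = c • wordVec s α β Ω) :
    R (wordVec s α' β' Ω) = c • wordVec s α' β' Ω := by
  rcases List.eq_nil_or_concat β with rfl | ⟨β, b, rfl⟩
  · obtain rfl := List.length_eq_zero_iff.1 hβ.symm
    have := hS.eigen_change_prefix_left h (r := []) (fun w => reducedPair_nil_right _) α α' [] hα
      (by simpa using hc)
    simpa using this
  rcases List.eq_nil_or_concat α with rfl | ⟨α, a, rfl⟩
  · obtain rfl := List.length_eq_zero_iff.1 hα.symm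
    have := hS.eigen_change_prefix_right h (r := []) (fun w => reducedPair_nil_left _)
      (β.concat b) β' [] hβ (by simpa using hc)
    simpa using this
  rcases List.eq_nil_or_concat β' with rfl | ⟨β', d, rfl⟩
  · simp at hβ
  rcases List.eq_nil_or_concat α' with rfl | ⟨α', x, rfl⟩
  · simp at hα
  simp only [List.concat_eq_append, List.length_append, List.length_singleton,
    add_left_inj] at hr hr' hα hβ hc ⊢
  have hab := hr.ne
  have hxd := hr'.ne
  have h1 : R (wordVec s (α ++ [x]) (β ++ [d]) Ω) = c • wordVec s (α ++ [x]) (β ++ [d]) Ω := by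
    -- The last letters are changed with care, as the pair must stay reduced. If the new left letter
    -- equals the old right one, changing it alone would destroy reducedness, and for `n = 2` no
    -- third letter offers a detour; the two letters are therefore swapped at once.
    by_cases hxb : x = b
    · subst hxb
      obtain ⟨v, hv⟩ := exists_isMixing hS.pos hab
      have h2 := hS.eigen_change_both h hv.isModel (α := α) (β := β) (α' := []) (β' := []) rfl
        (reducedPair_concat hab.symm α β) hv.mul_swap hc
      exact hS.eigen_change_right h (β' := []) (reducedPair_concat hxd α β) h2
    · have h2 := hS.eigen_change_left h (α' := []) (reducedPair_concat hxb α β) hc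
      exact hS.eigen_change_right h (β' := []) (reducedPair_concat hxd α β) h2
  -- From here on the distinct last letters `x`, `d` stay fixed and the prefixes are free.
  have h2 := hS.eigen_change_prefix_left h (r := [x]) (β := β ++ [d])
    (fun w => reducedPair_concat hxd w β) α α' [] hα (by simpa using h1)
  have h3 := hS.eigen_change_prefix_right h (r := [d]) (α := α' ++ [x])
    (fun w => reducedPair_concat hxd α' w) β β' [] hβ (by simpa using h2)
  simpa using h3

/-- Removing a common last letter, up to the eigenspace of the reduced pairs. -/
theorem IsCovariantSystem.eigen_diagonal (hS : IsCovariantSystem q s Ω) (h : IsCovariant q s Ω R)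
    {α β : List (Fin n)} {c : ℂ}
    (hc : ∀ i j, i ≠ j → R (wordVec s (α ++ [i]) (β ++ [j]) Ω) =
      c • wordVec s (α ++ [i]) (β ++ [j]) Ω) (i : Fin n) :
    R (wordVec s (α ++ [i]) (β ++ [i]) Ω - (q i : ℂ) • wordVec s α β Ω) =
      c • (wordVec s (α ++ [i]) (β ++ [i]) Ω - (q i : ℂ) • wordVec s α β Ω) := by
  set w : Fin n → H := fun i => R (wordVec s (α ++ [i]) (β ++ [i]) Ω) -
    c • wordVec s (α ++ [i]) (β ++ [i]) Ω with hw
  -- The argument of `inner_concat` with vectors instead of numbers: `R ⊗ 1 - c` annihilates the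
  -- image of the word `(αi, βj)`, in which the terms with different last letters drop out by `hc`,
  -- leaving a relation between `w i` and `w j` alone.
  have hrat : ∀ j, (q j : ℂ) • w i = (q i : ℂ) • w j := by
    intro j
    rcases eq_or_ne i j with rfl | hij
    · rfl
    obtain ⟨v, hv⟩ := exists_isMixing hS.pos hij
    obtain ⟨ξ, hξ⟩ : ∃ ξ, (v i i * star (v i j)) ξ ≠ 0 := by
      by_contra! h0
      exact hv.diag_ne_zero (ContinuousLinearMap.ext h0)
    have h1 := h.eigen (isModel_levelModel hv.isModel) _ _ c (hc i j hij)
      (htmul (l2.e (β.length + 1 : ℤ)) ξ)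
    rw [wordVec_level_both s v α [] β [] i j Ω ξ rfl, ← sub_eq_zero] at h1
    simp only [map_sum, opTensor_htmul, one_apply_eq_self, Finset.smul_sum, ← htmul_smul_left,
      ← Finset.sum_sub_distrib, ← htmul_sub_left] at h1
    have h2 : ∀ d, ∑ x, htmul (R (wordVec s (α ++ [x]) (β ++ [d]) Ω) -
        c • wordVec s (α ++ [x]) (β ++ [d]) Ω)
          (htmul (l2.e (1 + α.length : ℤ)) ((v x i * star (v d j)) ξ)) =
        htmul (w d) (htmul (l2.e (1 + α.length : ℤ)) ((v d i * star (v d j)) ξ)) := fun d =>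
      Finset.sum_eq_single d (fun x _ hx => by
        rw [hc x d hx, sub_self, htmul_zero_left]) (by simp)
    rw [Finset.sum_congr rfl fun d _ => h2 d, sum_pair_or_single hij _ (fun k hk hk' => by
      rw [hv.left k hk hk', if_neg hk, zero_mul, zero_apply, htmul_zero_right,
        htmul_zero_right])] at h1
    have h3 := congrArg (fun T : l2 ℕ →L[ℂ] l2 ℕ => T ξ) (hv.weight hij)
    simp only [neg_apply, smul_apply] at h3
    have h4 : htmul ((q j : ℂ) • w i - (q i : ℂ) • w j)
        (htmul (l2.e (1 + α.length : ℤ)) ((v i i * star (v i j)) ξ)) = 0 := by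
      have h5 : ∀ A B : l2 ℕ, (q j : ℂ) • B = -((q i : ℂ) • A) → (q j : ℂ) •
          htmul (w j) (htmul (l2.e (1 + α.length : ℤ)) B) =
          (-(q i : ℂ)) • htmul (w j) (htmul (l2.e (1 + α.length : ℤ)) A) := by
        intro A B hAB
        rw [← htmul_smul_right, ← htmul_smul_right, hAB, ← neg_smul, htmul_smul_right,
          htmul_smul_right]
      have h6 := congrArg ((q j : ℂ) • ·) h1
      simp only [smul_add, smul_zero, h5 _ _ h3] at h6
      rw [htmul_sub_left, htmul_smul_left, htmul_smul_left, ← h6]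
      module
    have h5 : (q j : ℂ) • w i - (q i : ℂ) • w j = 0 := by
      have h6 := congrArg (fun z => (inner ℂ z z : ℂ)) h4
      simp only [inner_htmul, inner_zero_left] at h6
      rcases mul_eq_zero.1 h6 with h7 | h7
      · exact inner_self_eq_zero.1 h7
      · rcases mul_eq_zero.1 h7 with h8 | h8
        · exact absurd h8 (l2.inner_e_self_ne_zero _)
        · exact absurd (inner_self_eq_zero.1 h8) hξ
    exact sub_eq_zero.1 h5
  have hq1 : (∑ j, (q j : ℂ)) = 1 := by exact_mod_cast hS.sum_eq_one
  have hsum : R (wordVec s α β Ω) - c • wordVec s α β Ω = ∑ j, w j := by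
    rw [hS.wordVec_eq_sum α β, map_sum, Finset.smul_sum, ← Finset.sum_sub_distrib]
  -- The `w j` are proportional to the `q j` and the `q j` sum to one, so `w i` is the fraction `q
  -- i` of the total.
  have h1 : w i = (q i : ℂ) • (R (wordVec s α β Ω) - c • wordVec s α β Ω) := by
    rw [hsum, Finset.smul_sum, ← Finset.sum_congr rfl fun j _ => hrat j, ← Finset.sum_smul, hq1,
      one_smul]
  rw [← sub_eq_zero, map_sub, map_smul, smul_sub, smul_comm c, sub_sub_sub_comm, ← smul_sub, ← h1,
    sub_self]

end Eigenvalues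

/-! ### The pieces `K_{rs}`: orthogonality, density, dimension, scalarity. -/

section WordSpans

variable {n : ℕ} {H : Type*} [NormedAddCommGroup H] [InnerProductSpace ℂ H] [CompleteSpace H]
  {q : Fin n → ℝ} {s : Fin n → (H →L[ℂ] H)} {Ω : H} {R : H →L[ℂ] H}

/-- The span of the vectors `s_α s_β* Ω` with `α` of length `r` and `β` of length `t`. -/
def wordSpan (s : Fin n → (H →L[ℂ] H)) (Ω : H) (r t : ℕ) : Submodule ℂ H :=
  Submodule.span ℂ {x | ∃ α β : List (Fin n), α.length = r ∧ β.length = t ∧ x = wordVec s α β Ω}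

/-- The part of `wordSpan s Ω r t` orthogonal to the previous level. -/
def wordSubspace (s : Fin n → (H →L[ℂ] H)) (Ω : H) : ℕ → ℕ → Submodule ℂ H
  | r + 1, t + 1 => wordSpan s Ω (r + 1) (t + 1) ⊓ (wordSpan s Ω r t)ᗮ
  | r, t => wordSpan s Ω r t

theorem wordVec_mem_wordSpan (s : Fin n → (H →L[ℂ] H)) (Ω : H) (α β : List (Fin n)) :
    wordVec s α β Ω ∈ wordSpan s Ω α.length β.length :=
  Submodule.subset_span ⟨α, β, rfl, rfl, rfl⟩

theorem wordSpan_eq_span_range (s : Fin n → (H →L[ℂ] H)) (Ω : H) (r t : ℕ) :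
    wordSpan s Ω r t = Submodule.span ℂ (Set.range fun p : (Fin r → Fin n) × (Fin t → Fin n) =>
      wordVec s (List.ofFn p.1) (List.ofFn p.2) Ω) := by
  unfold wordSpan
  congr 1
  ext x
  constructor
  · rintro ⟨α, β, rfl, rfl, rfl⟩
    exact ⟨(α.get, β.get), by simp only [List.ofFn_get]⟩
  · rintro ⟨p, rfl⟩
    exact ⟨_, _, by simp, by simp, rfl⟩

instance finiteDimensional_wordSpan (s : Fin n → (H →L[ℂ] H)) (Ω : H) (r t : ℕ) :
    FiniteDimensional ℂ (wordSpan s Ω r t) := by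
  rw [wordSpan_eq_span_range]
  exact FiniteDimensional.span_of_finite ℂ (Set.finite_range _)

theorem wordSubspace_le_wordSpan (s : Fin n → (H →L[ℂ] H)) (Ω : H) (r t : ℕ) :
    wordSubspace s Ω r t ≤ wordSpan s Ω r t := by
  rcases r with _ | r
  · exact le_rfl
  rcases t with _ | t
  · exact le_rfl
  exact inf_le_left

theorem wordSubspace_eq_wordSpan (s : Fin n → (H →L[ℂ] H)) (Ω : H) {r t : ℕ} (h : r = 0 ∨ t = 0) :
    wordSubspace s Ω r t = wordSpan s Ω r t := by
  rcases r with _ | r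
  · rfl
  rcases t with _ | t
  · rfl
  simp at h

theorem IsCovariantSystem.finrank_wordSpan (hS : IsCovariantSystem q s Ω) (r t : ℕ) :
    Module.finrank ℂ (wordSpan s Ω r t) = n ^ (r + t) := by
  rw [wordSpan_eq_span_range, finrank_span_eq_card]
  · simp [pow_add]
  refine linearIndependent_of_ne_zero_of_inner_eq_zero (𝕜 := ℂ) ?_ ?_
  · rintro ⟨a, b⟩ h0
    apply hS.inner_self_ne_zero (List.ofFn a) (List.ofFn b)
    simp only at h0
    rw [h0, inner_zero_left]
  · rintro ⟨a, b⟩ ⟨a', b'⟩ hne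
    simp only
    rw [hS.inner_wordVec (by simp), if_neg]
    rintro ⟨h1, h2⟩
    exact hne (by rw [List.ofFn_injective h1, List.ofFn_injective h2])

theorem IsCovariantSystem.wordSpan_le_succ (hS : IsCovariantSystem q s Ω) (r t : ℕ) :
    wordSpan s Ω r t ≤ wordSpan s Ω (r + 1) (t + 1) := by
  refine Submodule.span_le.2 ?_
  rintro _ ⟨α, β, rfl, rfl, rfl⟩
  rw [hS.wordVec_eq_sum]
  refine Submodule.sum_mem _ fun i _ => ?_
  simpa using wordVec_mem_wordSpan s Ω (α ++ [i]) (β ++ [i])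

theorem IsCovariantSystem.wordSpan_le_add (hS : IsCovariantSystem q s Ω) (r t k : ℕ) :
    wordSpan s Ω r t ≤ wordSpan s Ω (r + k) (t + k) := by
  induction k with
  | zero => exact le_rfl
  | succ k ih => exact ih.trans (hS.wordSpan_le_succ _ _)

theorem IsCovariantSystem.wordSpan_isOrtho (hS : IsCovariantSystem q s Ω) {r t r' t' : ℕ}
    (h : r + t' ≠ r' + t) : wordSpan s Ω r t ⟂ wordSpan s Ω r' t' := by
  refine Submodule.isOrtho_span.2 ?_
  rintro _ ⟨α, β, rfl, rfl, rfl⟩ _ ⟨α', β', rfl, rfl, rfl⟩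
  refine hS.covariant_one.inner_eq_zero fun he => h ?_
  have := pairWord_length he
  omega

/-- In equal degree the smaller space is contained in `H_{r'-1,t'-1}`, to which `K_{r't'}` is
orthogonal by definition. -/
theorem IsCovariantSystem.wordSubspace_isOrtho_of_lt (hS : IsCovariantSystem q s Ω)
    {r t r' t' : ℕ} (h : r + t' = r' + t) (hlt : r < r') :
    wordSubspace s Ω r t ⟂ wordSubspace s Ω r' t' := by
  obtain ⟨k, rfl⟩ := Nat.exists_eq_add_of_lt hlt
  obtain rfl : t' = t + k + 1 := by omega
  exact ((wordSubspace_le_wordSpan s Ω r t).trans (hS.wordSpan_le_add r t k)).trans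
    (((Submodule.isOrtho_orthogonal_right _).mono_right inf_le_right))

theorem IsCovariantSystem.wordSubspace_isOrtho (hS : IsCovariantSystem q s Ω)
    {r t r' t' : ℕ} (h : (r, t) ≠ (r', t')) :
    wordSubspace s Ω r t ⟂ wordSubspace s Ω r' t' := by
  by_cases he : r + t' = r' + t
  · rcases lt_trichotomy r r' with hlt | rfl | hlt
    · exact hS.wordSubspace_isOrtho_of_lt he hlt
    · exact absurd (by rw [Nat.add_left_cancel he]) h
    · exact (hS.wordSubspace_isOrtho_of_lt he.symm hlt).symm
  · exact (hS.wordSpan_isOrtho he).mono (wordSubspace_le_wordSpan _ _ _ _)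
      (wordSubspace_le_wordSpan _ _ _ _)

/-- Iterate `H_{r+1,t+1} = H_{rt} ⊕ K_{r+1,t+1}` until one index is zero. -/
theorem IsCovariantSystem.wordSpan_le_iSup (hS : IsCovariantSystem q s Ω) (r t : ℕ) :
    wordSpan s Ω r t ≤ ⨆ (r : ℕ) (t : ℕ), wordSubspace s Ω r t := by
  have hle : ∀ r t, wordSubspace s Ω r t ≤ ⨆ (r : ℕ) (t : ℕ), wordSubspace s Ω r t := fun r t =>
    le_iSup₂ (f := fun r t => wordSubspace s Ω r t) r t
  induction r generalizing t with
  | zero => exact hle 0 t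
  | succ r ih =>
    rcases t with _ | t
    · exact hle (r + 1) 0
    rw [← Submodule.sup_orthogonal_inf_of_hasOrthogonalProjection (hS.wordSpan_le_succ r t)]
    refine sup_le (ih t) ?_
    rw [inf_comm]
    exact hle (r + 1) (t + 1)

theorem IsCovariantSystem.dense_iSup (hS : IsCovariantSystem q s Ω) :
    (⨆ (r : ℕ) (t : ℕ), wordSubspace s Ω r t).topologicalClosure = ⊤ := by
  rw [Submodule.topologicalClosure_eq_top_iff, Submodule.eq_bot_iff]
  intro z hz
  refine hS.total z fun α β => ?_
  exact Submodule.mem_orthogonal _ _ |>.1 hz _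
    (hS.wordSpan_le_iSup _ _ (wordVec_mem_wordSpan s Ω α β))

theorem IsCovariantSystem.finrank_wordSubspace (hS : IsCovariantSystem q s Ω) (r t : ℕ) :
    Module.finrank ℂ (wordSubspace s Ω r t) =
      if r = 0 ∨ t = 0 then n ^ (r + t) else n ^ (r + t) - n ^ (r + t - 2) := by
  split_ifs with h
  · rw [wordSubspace_eq_wordSpan s Ω h, hS.finrank_wordSpan]
  · obtain ⟨r, rfl⟩ := Nat.exists_eq_succ_of_ne_zero (fun h0 => h (Or.inl h0))
    obtain ⟨t, rfl⟩ := Nat.exists_eq_succ_of_ne_zero (fun h0 => h (Or.inr h0))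
    have h1 := Submodule.finrank_add_inf_finrank_orthogonal (hS.wordSpan_le_succ r t)
    rw [hS.finrank_wordSpan, hS.finrank_wordSpan, inf_comm] at h1
    have h2 : r.succ + t.succ - 2 = r + t := by omega
    rw [h2]
    exact Nat.eq_sub_of_add_eq' h1

/-- A covariant operator is scalar on the spans of words in the letters or in their adjoints only. -/
theorem IsCovariantSystem.exists_scalar_wordSpan (hS : IsCovariantSystem q s Ω)
    (h : IsCovariant q s Ω R) {r t : ℕ} (hrt : r = 0 ∨ t = 0) (i : Fin n) :
    ∃ c : ℂ, ∀ x ∈ wordSpan s Ω r t, R x = c • x := by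
  have hred : ∀ α β : List (Fin n), α.length = r → β.length = t → ReducedPair α β := by
    rintro α β rfl rfl
    rcases hrt with h0 | h0
    · obtain rfl := List.length_eq_zero_iff.1 h0
      exact reducedPair_nil_left β
    · obtain rfl := List.length_eq_zero_iff.1 h0
      exact reducedPair_nil_right α
  have hr0 := hred (List.replicate r i) (List.replicate t i) (by simp) (by simp)
  obtain ⟨c, hc⟩ := hS.exists_eigenvalue h hr0
  refine ⟨c, fun x hx => ?_⟩
  have hle : wordSpan s Ω r t ≤ LinearMap.ker ((R - c • 1 : H →L[ℂ] H) : H →ₗ[ℂ] H) := by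
    refine Submodule.span_le.2 ?_
    rintro _ ⟨α, β, hα, hβ, rfl⟩
    have := hS.eigen_reduced h hr0 (hred α β hα hβ) (by simp [hα]) (by simp [hβ]) hc
    simp [this]
  have := hle hx
  simpa [sub_eq_zero] using this

/-- This identifies the projection of a word of level `(r+1, t+1)` to level `(r, t)`: equal last
letters `i` are removed with the factor `q_i`, different ones give zero. -/
theorem IsCovariantSystem.inner_concat_concat (hS : IsCovariantSystem q s Ω)
    {α' β' α β : List (Fin n)} (hα : α'.length = α.length) (i j : Fin n) :
    inner ℂ (wordVec s α' β' Ω) (wordVec s (α ++ [i]) (β ++ [j]) Ω) =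
      if i = j then (q i : ℂ) * inner ℂ (wordVec s α' β' Ω) (wordVec s α β Ω) else 0 := by
  rw [hS.wordVec_eq_sum α' β', sum_inner]
  have h1 : ∀ k, (inner ℂ (wordVec s (α' ++ [k]) (β' ++ [k]) Ω)
      (wordVec s (α ++ [i]) (β ++ [j]) Ω) : ℂ) =
      if k = i then (if i = j then (q i : ℂ) *
        (if α' = α ∧ β' = β then (wordWeight q β : ℂ) else 0) else 0) else 0 := by
    intro k
    rw [hS.inner_wordVec (by simp [hα])]
    by_cases hk : k = i
    · subst hk
      by_cases hij : k = j
      · subst hij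
        simp [wordWeight, mul_comm]
      · simp [hij]
    · simp [hk]
  rw [Finset.sum_congr rfl fun k _ => h1 k, Finset.sum_ite_eq' Finset.univ i,
    if_pos (Finset.mem_univ i), ← hS.wordVec_eq_sum, hS.inner_wordVec hα]

/-- A covariant operator is scalar on each of the orthogonal pieces. -/
theorem IsCovariantSystem.exists_scalar (hS : IsCovariantSystem q s Ω) (h : IsCovariant q s Ω R)
    (hn : 2 ≤ n) (r t : ℕ) : ∃ c : ℂ, ∀ x ∈ wordSubspace s Ω r t, R x = c • x := by
  let i₀ : Fin n := ⟨0, by omega⟩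
  let i₁ : Fin n := ⟨1, by omega⟩
  have h01 : i₀ ≠ i₁ := by simp [i₀, i₁]
  rcases r with _ | r
  · exact hS.exists_scalar_wordSpan h (Or.inl rfl) i₀
  rcases t with _ | t
  · exact hS.exists_scalar_wordSpan h (Or.inr rfl) i₀
  have hr0 := reducedPair_concat h01 (List.replicate r i₀) (List.replicate t i₀)
  obtain ⟨c, hc⟩ := hS.exists_eigenvalue h hr0
  have hoff : ∀ α β : List (Fin n), α.length = r → β.length = t → ∀ i j, i ≠ j →
      R (wordVec s (α ++ [i]) (β ++ [j]) Ω) = c • wordVec s (α ++ [i]) (β ++ [j]) Ω :=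
    fun α β hα hβ i j hij => hS.eigen_reduced h hr0 (reducedPair_concat hij α β) (by simp [hα])
      (by simp [hβ]) hc
  -- The orthogonal decomposition of `H_{r+1,t+1}` along `H_{rt}`, with the complementary part an
  -- eigenvector for the eigenvalue of the reduced pairs. It is checked on words and extended
  -- linearly.
  have key : ∀ y ∈ wordSpan s Ω (r + 1) (t + 1), ∃ p ∈ wordSpan s Ω r t,
      R (y - p) = c • (y - p) ∧ y - p ∈ (wordSpan s Ω r t)ᗮ := by
    intro y hy
    induction hy using Submodule.span_induction with
    | mem y hy =>
      obtain ⟨α, β, hα, hβ, rfl⟩ := hy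
      rcases List.eq_nil_or_concat α with rfl | ⟨α, i, rfl⟩
      · simp at hα
      rcases List.eq_nil_or_concat β with rfl | ⟨β, j, rfl⟩
      · simp at hβ
      simp only [List.concat_eq_append, List.length_append, List.length_singleton,
        add_left_inj] at hα hβ ⊢
      refine ⟨if i = j then (q i : ℂ) • wordVec s α β Ω else 0, ?_, ?_, ?_⟩
      · split_ifs
        · exact Submodule.smul_mem _ _ (hα ▸ hβ ▸ wordVec_mem_wordSpan s Ω α β)
        · exact zero_mem _
      · split_ifs with hij
        · subst hij
          exact hS.eigen_diagonal h (hoff α β hα hβ) i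
        · rw [sub_zero]; exact hoff α β hα hβ i j hij
      · have hle : wordSpan s Ω r t ≤ (Submodule.span ℂ {wordVec s (α ++ [i]) (β ++ [j]) Ω -
            if i = j then (q i : ℂ) • wordVec s α β Ω else 0})ᗮ := by
          refine Submodule.span_le.2 ?_
          rintro _ ⟨α', β', hα', hβ', rfl⟩
          rw [SetLike.mem_coe, Submodule.mem_orthogonal_singleton_iff_inner_left, inner_sub_right,
            hS.inner_concat_concat (hα'.trans hα.symm)]
          split_ifs
          · rw [inner_smul_right, sub_self]
          · rw [inner_zero_right, sub_zero]
        rw [Submodule.mem_orthogonal]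
        intro u hu
        exact Submodule.mem_orthogonal_singleton_iff_inner_left.1 (hle hu)
    | zero => exact ⟨0, zero_mem _, by simp, by simp⟩
    | add x y _ _ hx hy =>
      obtain ⟨p, h1, h2, h3⟩ := hx
      obtain ⟨p', h1', h2', h3'⟩ := hy
      refine ⟨p + p', add_mem h1 h1', ?_, ?_⟩
      · rw [add_sub_add_comm, map_add, h2, h2', smul_add]
      · rw [add_sub_add_comm]; exact add_mem h3 h3'
    | smul a x _ hx =>
      obtain ⟨p, h1, h2, h3⟩ := hx
      refine ⟨a • p, Submodule.smul_mem _ _ h1, ?_, ?_⟩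
      · rw [← smul_sub, map_smul, h2, smul_comm]
      · rw [← smul_sub]; exact Submodule.smul_mem _ _ h3
  refine ⟨c, fun x hx => ?_⟩
  obtain ⟨p, h1, h2, h3⟩ := key x hx.1
  -- For `x` already orthogonal to `H_{rt}` the correction `p` lies in `H_{rt}` and in its
  -- orthogonal complement, so it vanishes.
  have h4 : p ∈ (wordSpan s Ω r t)ᗮ := by
    have := sub_mem hx.2 h3
    simpa using this
  obtain rfl : p = 0 := by
    have := Submodule.mem_orthogonal _ _ |>.1 h4 p h1
    exact inner_self_eq_zero.1 this
  simpa using h2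

end WordSpans

/-! ### Diagonalizing `Q` and conjugating matrices over an algebra by scalar matrices. -/

section Diagonalization

variable {n : ℕ} {Q : Matrix (Fin n) (Fin n) ℂ}

open scoped ComplexOrder in
/-- A positive definite matrix of trace one is unitarily equivalent to a diagonal matrix with
positive entries which sum to one. -/
theorem exists_diagonalization (hQ : Q.PosDef) (htr : Q.trace = 1) :
    ∃ (q : Fin n → ℝ) (A : Matrix (Fin n) (Fin n) ℂ), (∀ i, 0 < q i) ∧ ∑ i, q i = 1 ∧
      A.conjTranspose * A = 1 ∧ A * A.conjTranspose = 1 ∧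
      Q = A.map star * Matrix.diagonal (fun i => (q i : ℂ)) * A.transpose := by
  set U := hQ.isHermitian.eigenvectorUnitary with hU
  have h1 : (U : Matrix (Fin n) (Fin n) ℂ).conjTranspose * U = 1 := Unitary.coe_star_mul_self U
  have h2 : (U : Matrix (Fin n) (Fin n) ℂ) * (U : Matrix (Fin n) (Fin n) ℂ).conjTranspose = 1 :=
    Unitary.coe_mul_star_self U
  have h3 : ((U : Matrix (Fin n) (Fin n) ℂ).map star).map star = U := by
    ext i j; simp
  have h4 : ((U : Matrix (Fin n) (Fin n) ℂ).map star).conjTranspose =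
      (U : Matrix (Fin n) (Fin n) ℂ).transpose := by
    ext i j; simp
  have h5 : (U : Matrix (Fin n) (Fin n) ℂ).conjTranspose.transpose =
      (U : Matrix (Fin n) (Fin n) ℂ).map star := by
    ext i j; simp
  -- The entrywise conjugate of the eigenvector matrix is taken since the relations contain `uᵗ` and
  -- `ū`: for `u = A v A*` these are `Ā vᵗ Aᵗ` and `Ā v̄ Aᵗ`, which match `Q = Ā Λ Aᵗ`.
  refine ⟨hQ.isHermitian.eigenvalues, (U : Matrix (Fin n) (Fin n) ℂ).map star,
    hQ.eigenvalues_pos, ?_, ?_, ?_, ?_⟩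
  · have := hQ.isHermitian.trace_eq_sum_eigenvalues
    rw [htr] at this
    exact Complex.ofReal_injective (by rw [Complex.ofReal_sum]; exact this.symm)
  · rw [h4, ← h5, ← Matrix.transpose_mul, h1, Matrix.transpose_one]
  · rw [h4, ← h5, ← Matrix.transpose_mul, h2, Matrix.transpose_one]
  · rw [h3]
    exact hQ.isHermitian.spectral_theorem

theorem transpose_map_algebraMap_mul {E : Type*} [Ring E] [Algebra ℂ E]
    (M : Matrix (Fin n) (Fin n) ℂ) (v : Matrix (Fin n) (Fin n) E) :
    (M.map (algebraMap ℂ E) * v).transpose = v.transpose * M.transpose.map (algebraMap ℂ E) := by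
  ext i j
  simp only [Matrix.transpose_apply, Matrix.mul_apply, Matrix.map_apply]
  exact Finset.sum_congr rfl fun k _ => Algebra.commutes _ _

theorem transpose_mul_map_algebraMap {E : Type*} [Ring E] [Algebra ℂ E]
    (v : Matrix (Fin n) (Fin n) E) (M : Matrix (Fin n) (Fin n) ℂ) :
    (v * M.map (algebraMap ℂ E)).transpose = M.transpose.map (algebraMap ℂ E) * v.transpose := by
  ext i j
  simp only [Matrix.transpose_apply, Matrix.mul_apply, Matrix.map_apply]
  exact Finset.sum_congr rfl fun k _ => (Algebra.commutes _ _).symm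

variable {E : Type*} [Ring E] [StarRing E] [Algebra ℂ E] [StarModule ℂ E]

theorem map_algebraMap_conjTranspose (M : Matrix (Fin n) (Fin n) ℂ) :
    (M.map (algebraMap ℂ E)).conjTranspose = M.conjTranspose.map (algebraMap ℂ E) := by
  ext i j
  exact (algebraMap_star_comm _).symm

theorem map_star_map_algebraMap_mul (M : Matrix (Fin n) (Fin n) ℂ) (v : Matrix (Fin n) (Fin n) E) :
    (M.map (algebraMap ℂ E) * v).map star = (M.map star).map (algebraMap ℂ E) * v.map star := by
  ext i j
  simp only [Matrix.map_apply, Matrix.mul_apply, star_sum, star_mul, ← algebraMap_star_comm]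
  exact Finset.sum_congr rfl fun k _ => (Algebra.commutes _ _).symm

theorem map_star_mul_map_algebraMap (v : Matrix (Fin n) (Fin n) E) (M : Matrix (Fin n) (Fin n) ℂ) :
    (v * M.map (algebraMap ℂ E)).map star = v.map star * (M.map star).map (algebraMap ℂ E) := by
  ext i j
  simp only [Matrix.map_apply, Matrix.mul_apply, star_sum, star_mul, ← algebraMap_star_comm]
  exact Finset.sum_congr rfl fun k _ => Algebra.commutes _ _

end Diagonalization

/-! ### From models for the diagonal matrix to representations of `A_u(Q)`. -/

section ModelRelations

variable {n : ℕ} {Q : Matrix (Fin n) (Fin n) ℂ}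

/-- A solution of the relations for a diagonal matrix gives one for a unitarily equivalent
matrix. -/
theorem IsModel.freeUnitaryRel {q : Fin n → ℝ} (hq : ∀ i, 0 < q i)
    {A : Matrix (Fin n) (Fin n) ℂ}
    (h1 : A.conjTranspose * A = 1) (h2 : A * A.conjTranspose = 1)
    (hQ : Q = A.map star * Matrix.diagonal (fun i => (q i : ℂ)) * A.transpose)
    {L : Type} [NormedAddCommGroup L] [InnerProductSpace ℂ L] [CompleteSpace L]
    {v : Fin n → Fin n → (L →L[ℂ] L)} (hv : IsModel q v) :
    FreeUnitaryRel Q (A.map (algebraMap ℂ (L →L[ℂ] L)) * Matrix.of v *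
      A.conjTranspose.map (algebraMap ℂ (L →L[ℂ] L))) := by
  set c : Matrix (Fin n) (Fin n) ℂ → Matrix (Fin n) (Fin n) (L →L[ℂ] L) :=
    fun M => M.map (algebraMap ℂ (L →L[ℂ] L)) with hc
  have hmul : ∀ M N, c M * c N = c (M * N) := fun M N => Matrix.map_mul.symm
  have hone : c 1 = 1 := Matrix.map_one _ (map_zero _) (map_one _)
  have e1 : A.conjTranspose.transpose = A.map star := by ext i j; simp
  have e2 : A.conjTranspose.map star = A.transpose := by ext i j; simp
  have h3 : A.transpose * A.map star = 1 := by
    rw [← e1, ← Matrix.transpose_mul, h1, Matrix.transpose_one]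
  have h4 : A.map star * A.transpose = 1 := by
    rw [← e1, ← Matrix.transpose_mul, h2, Matrix.transpose_one]
  set Λ : Matrix (Fin n) (Fin n) ℂ := Matrix.diagonal (fun i => (q i : ℂ)) with hΛ
  set Λ' : Matrix (Fin n) (Fin n) ℂ := Matrix.diagonal (fun i => (q i : ℂ)⁻¹) with hΛ'
  have hq0 : ∀ i, (q i : ℂ) ≠ 0 := fun i => by exact_mod_cast (hq i).ne'
  have h5 : Λ * Λ' = 1 := by
    rw [hΛ, hΛ', Matrix.diagonal_mul_diagonal, ← Matrix.diagonal_one]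
    congr 1; ext i; exact mul_inv_cancel₀ (hq0 i)
  have hQ' : Q⁻¹ = A.map star * Λ' * A.transpose := by
    refine Matrix.inv_eq_right_inv ?_
    rw [hQ]
    calc _ = A.map star * (Λ * (A.transpose * A.map star) * Λ') * A.transpose := by
          simp only [Matrix.mul_assoc]
      _ = 1 := by rw [h3, Matrix.mul_one, h5, Matrix.mul_one, h4]
  set w : Matrix (Fin n) (Fin n) (L →L[ℂ] L) := Matrix.of v with hw
  have hu1 : (c A * w * c A.conjTranspose).conjTranspose = c A * w.conjTranspose *
      c A.conjTranspose := by
    rw [Matrix.conjTranspose_mul, Matrix.conjTranspose_mul, map_algebraMap_conjTranspose,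
      map_algebraMap_conjTranspose, Matrix.conjTranspose_conjTranspose, Matrix.mul_assoc]
  have hu2 : (c A * w * c A.conjTranspose).transpose =
      c (A.map star) * w.transpose * c A.transpose := by
    rw [transpose_mul_map_algebraMap, transpose_map_algebraMap_mul, e1, Matrix.mul_assoc]
  have hu3 : (c A * w * c A.conjTranspose).map star =
      c (A.map star) * w.map star * c A.transpose := by
    rw [map_star_mul_map_algebraMap, map_star_map_algebraMap_mul, e2]
  have r1 : w.conjTranspose * w = 1 := by
    ext1 i j
    rw [Matrix.mul_apply, Matrix.one_apply, ← hv.star_mul i j]; rfl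
  have r2 : w * w.conjTranspose = 1 := by
    ext1 i j
    rw [Matrix.mul_apply, Matrix.one_apply, ← hv.mul_star i j]; rfl
  have hcd : ∀ d : Fin n → ℂ, c (Matrix.diagonal d) =
      Matrix.diagonal fun i => algebraMap ℂ (L →L[ℂ] L) (d i) := fun d =>
    Matrix.diagonal_map (map_zero _)
  have r3 : w.transpose * c Λ * w.map star = c Λ := by
    rw [hΛ, hcd]
    ext1 i j
    rw [Matrix.mul_apply, Matrix.diagonal_apply]
    simp only [Matrix.mul_diagonal, Matrix.transpose_apply, Matrix.map_apply]
    have := hv.weight_mul_star i j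
    rw [← Algebra.algebraMap_eq_smul_one] at this
    rw [← this]
    refine Finset.sum_congr rfl fun k _ => ?_
    rw [← Algebra.commutes, mul_assoc, Algebra.smul_def]; rfl
  have r4 : w.map star * c Λ' * w.transpose = c Λ' := by
    rw [hΛ', hcd]
    ext1 i j
    rw [Matrix.mul_apply, Matrix.diagonal_apply]
    simp only [Matrix.mul_diagonal, Matrix.transpose_apply, Matrix.map_apply]
    have := hv.weight_star_mul i j
    rw [← Algebra.algebraMap_eq_smul_one] at this
    rw [← this]
    refine Finset.sum_congr rfl fun k _ => ?_
    rw [← Algebra.commutes, mul_assoc, Algebra.smul_def]; rfl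
  have m1 : c A.conjTranspose * c A = 1 := by rw [hmul, h1, hone]
  have m2 : c A * c A.conjTranspose = 1 := by rw [hmul, h2, hone]
  have m3 : c A.transpose * c (A.map star) = 1 := by rw [hmul, h3, hone]
  have m4 : c (A.map star) * c A.transpose = 1 := by rw [hmul, h4, hone]
  have m5 : c Λ * c Λ' = 1 := by rw [hmul, h5, hone]
  have hcQ : c Q = c (A.map star) * c Λ * c A.transpose := by rw [hQ, hmul, hmul]
  have hcQ' : c Q⁻¹ = c (A.map star) * c Λ' * c A.transpose := by rw [hQ', hmul, hmul]
  change FreeUnitaryRel Q (c A * w * c A.conjTranspose)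
  refine ⟨?_, ?_, ?_, ?_⟩
  · rw [hu1]
    calc _ = c A * (w.conjTranspose * (c A.conjTranspose * c A) * w) * c A.conjTranspose := by
          simp only [Matrix.mul_assoc]
      _ = 1 := by rw [m1, Matrix.mul_one, r1, Matrix.mul_one, m2]
  · rw [hu1]
    calc _ = c A * (w * (c A.conjTranspose * c A) * w.conjTranspose) * c A.conjTranspose := by
          simp only [Matrix.mul_assoc]
      _ = 1 := by rw [m1, Matrix.mul_one, r2, Matrix.mul_one, m2]
  · rw [hu2, hu3]
    change _ * c Q * _ * c Q⁻¹ = 1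
    rw [hcQ, hcQ']
    -- All inner factors `Aᵗ Ā` equal `1`, which leaves `Ā (wᵗ Λ w̄ Λ') Aᵗ` and the diagonal
    -- relation.
    calc _ = c (A.map star) * (w.transpose * (c A.transpose * c (A.map star)) * c Λ *
          (c A.transpose * c (A.map star)) * w.map star * (c A.transpose * c (A.map star)) * c Λ') *
          c A.transpose := by
          simp only [Matrix.mul_assoc]
      _ = 1 := by simp only [m3, Matrix.mul_one, r3, m5, m4]
  · rw [hu2, hu3]
    change c Q * _ * c Q⁻¹ * _ = 1
    rw [hcQ, hcQ']
    calc _ = c (A.map star) * (c Λ * (c A.transpose * c (A.map star)) * (w.map star *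
          (c A.transpose * c (A.map star)) * c Λ' * (c A.transpose * c (A.map star)) *
          w.transpose)) * c A.transpose := by
          simp only [Matrix.mul_assoc]
      _ = 1 := by simp only [m3, Matrix.mul_one, r4, m5, m4]

end ModelRelations

/-! ### Vector states: from GNS representations to arbitrary ones. -/

section VectorStates

attribute [local instance] CStarAlgebra.spectralOrder CStarAlgebra.spectralOrderedRing

variable {A C : Type*} [CStarAlgebra A] [CStarAlgebra C]

open scoped ComplexOrder in
/-- The vector state of a nonzero vector. -/
theorem exists_vectorState {L : Type*} [NormedAddCommGroup L] [InnerProductSpace ℂ L]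
    [CompleteSpace L] (f : C →⋆ₐ[ℂ] (L →L[ℂ] L)) {ξ : L} (hξ : ξ ≠ 0) :
    ∃ ψ : CStarState C, ∀ c, inner ℂ ξ (f c ξ) = inner ℂ ξ ξ * ψ.eval c := by
  have h0 : (inner ℂ ξ ξ : ℂ) ≠ 0 := inner_self_ne_zero.2 hξ
  let φ : C →ₗ[ℂ] ℂ :=
    { toFun := fun c => (inner ℂ ξ ξ)⁻¹ * inner ℂ ξ (f c ξ)
      map_add' := fun a b => by rw [map_add, add_apply, inner_add_right, mul_add]
      map_smul' := fun r a => by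
        rw [map_smul, smul_apply, inner_smul_right, RingHom.id_apply, smul_eq_mul]; ring }
  have hφ : ∀ c, φ c = (inner ℂ ξ ξ)⁻¹ * inner ℂ ξ (f c ξ) := fun c => rfl
  have hpos : ∀ x, 0 ≤ x → 0 ≤ φ x := by
    intro x hx
    obtain ⟨b, rfl⟩ := CStarAlgebra.nonneg_iff_eq_star_mul_self.1 hx
    have h1 : (inner ℂ ξ (f (star b * b) ξ) : ℂ) = inner ℂ (f b ξ) (f b ξ) := by
      rw [map_mul, map_star, ContinuousLinearMap.star_eq_adjoint, ContinuousLinearMap.mul_apply,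
        ContinuousLinearMap.adjoint_inner_right]
    have h2 : ∀ x : L, (inner ℂ x x : ℂ) = ((‖x‖ ^ 2 : ℝ) : ℂ) := fun x =>
      (inner_self_eq_norm_sq_to_K x).trans (Complex.ofReal_pow _ 2).symm
    rw [hφ, h1, h2, h2, ← Complex.ofReal_inv, ← Complex.ofReal_mul]
    exact Complex.zero_le_real.2 (by positivity)
  refine ⟨⟨PositiveLinearMap.mk₀ φ hpos, ?_⟩, fun c => ?_⟩
  · change φ 1 = 1
    rw [hφ, map_one, one_apply_eq_self, inv_mul_cancel₀ h0]
  · change _ = inner ℂ ξ ξ * φ c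
    rw [hφ, mul_inv_cancel_left₀ h0]

theorem CStarState.π_Ω (φ : CStarState A) (a : A) : φ.π a φ.Ω = φ.η a := by
  unfold CStarState.Ω
  rw [φ.π_η, mul_one]

theorem CStarState.inner_Ω_self (φ : CStarState A) : inner ℂ φ.Ω φ.Ω = (1 : ℂ) := by
  unfold CStarState.Ω
  rw [φ.inner_η, star_one, one_mul]
  exact φ.map_one

/-- Passing from a vector to its vector state. -/
theorem inner_repTensor_vectorState {H L : Type*} [NormedAddCommGroup H] [InnerProductSpace ℂ H]
    [CompleteSpace H] [NormedAddCommGroup L] [InnerProductSpace ℂ L] [CompleteSpace L]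
    (π : A →⋆ₐ[ℂ] (H →L[ℂ] H)) (f : C →⋆ₐ[ℂ] (L →L[ℂ] L)) {ξ : L} {ψ : CStarState C}
    (hψ : ∀ c, inner ℂ ξ (f c ξ) = inner ℂ ξ ξ * ψ.eval c) (Ω : H) (X : H →L[ℂ] H)
    (w' w : A ⊗[ℂ] C) :
    inner ℂ (repTensor π f w' (htmul Ω ξ)) (opTensor X 1 (repTensor π f w (htmul Ω ξ))) =
      inner ℂ ξ ξ * inner ℂ (repTensor π ψ.π w' (htmul Ω ψ.Ω))
        (opTensor X 1 (repTensor π ψ.π w (htmul Ω ψ.Ω))) := by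
  induction w' using TensorProduct.induction_on with
  | zero => simp
  | add x y hx hy =>
    simp only [map_add, add_apply, inner_add_left, hx, hy, mul_add]
  | tmul a' c' =>
    induction w using TensorProduct.induction_on with
    | zero => simp
    | add x y hx hy => simp only [map_add, add_apply, inner_add_right, hx, hy, mul_add]
    | tmul a c =>
      simp only [repTensor_tmul, opTensor_htmul, inner_htmul, one_apply_eq_self]
      have h1 : (inner ℂ (f c' ξ) (f c ξ) : ℂ) = inner ℂ ξ (f (star c' * c) ξ) := by
        rw [map_mul, map_star, ContinuousLinearMap.star_eq_adjoint, ContinuousLinearMap.mul_apply,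
          ContinuousLinearMap.adjoint_inner_right]
      have h2 : (inner ℂ (ψ.π c' ψ.Ω) (ψ.π c ψ.Ω) : ℂ) = ψ.eval (star c' * c) := by
        rw [ψ.π_Ω, ψ.π_Ω, ψ.inner_η]
      rw [h1, h2, hψ]
      ring

end VectorStates

/-! ### From invariance of the state and equivariance of `R` to covariance for all models. -/

section Invariance

variable {A C : Type*} [CStarAlgebra A] [CStarAlgebra C] {τ : A →⋆ₐ[ℂ] MinTensor A C}
  {ρ : CStarState A} {R : ρ.GNS →L[ℂ] ρ.GNS}

theorem MinTensor.rep_incl (φ : CStarState A) (ψ : CStarState C) (w : A ⊗[ℂ] C) :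
    MinTensor.rep φ ψ (MinTensor.incl w) = repTensor φ.π ψ.π w :=
  (minFamily A C).extend_incl (φ, ψ) w

/-- `R ⊗ 1` has the same matrix coefficients and eigenvectors on the vectors `τ(a)(Ω ⊗ Ω_ψ)` as
`R` on the vectors `aΩ`. -/
structure IsInvariantOperator (τ : A →⋆ₐ[ℂ] MinTensor A C) (ρ : CStarState A)
    (R : ρ.GNS →L[ℂ] ρ.GNS) : Prop where
  form : ∀ (ψ : CStarState C) (a b : A), inner ℂ (MinTensor.rep ρ ψ (τ a) (htmul ρ.Ω ψ.Ω))
    (opTensor R 1 (MinTensor.rep ρ ψ (τ b) (htmul ρ.Ω ψ.Ω))) = inner ℂ (ρ.η a) (R (ρ.η b))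
  eigen : ∀ (ψ : CStarState C) (a : A) (c : ℂ), R (ρ.η a) = c • ρ.η a →
    opTensor R 1 (MinTensor.rep ρ ψ (τ a) (htmul ρ.Ω ψ.Ω)) =
      c • MinTensor.rep ρ ψ (τ a) (htmul ρ.Ω ψ.Ω)

theorem IsInvariantState.isInvariantOperator_one (hρ : IsInvariantState τ ρ) :
    IsInvariantOperator τ ρ 1 := by
  have hform : ∀ (ψ : CStarState C) (a b : A), inner ℂ (MinTensor.rep ρ ψ (τ a) (htmul ρ.Ω ψ.Ω))
      (MinTensor.rep ρ ψ (τ b) (htmul ρ.Ω ψ.Ω)) = (inner ℂ (ρ.η a) (ρ.η b) : ℂ) := by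
    intro ψ a b
    rw [ρ.inner_η, ← hρ (star a * b) ψ]
    unfold productState
    rw [map_mul, map_mul, map_star, map_star, ContinuousLinearMap.star_eq_adjoint,
      ContinuousLinearMap.mul_apply, ContinuousLinearMap.adjoint_inner_right]
  refine ⟨fun ψ a b => ?_, fun ψ a c hc => ?_⟩
  · rw [opTensor_one, one_apply_eq_self, one_apply_eq_self, hform]
  · rw [opTensor_one, one_apply_eq_self]
    rw [one_apply_eq_self] at hc
    -- For the identity operator an eigenvalue `c ≠ 1` occurs only on the zero vector, and the
    -- coaction preserves the vanishing of the norm.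
    have h1 : (1 - c) • ρ.η a = 0 := by rw [sub_smul, one_smul, ← hc, sub_self]
    rcases smul_eq_zero.1 h1 with h2 | h2
    · rw [← sub_eq_zero.1 h2, one_smul]
    · have h3 : MinTensor.rep ρ ψ (τ a) (htmul ρ.Ω ψ.Ω) = 0 := by
        rw [← inner_self_eq_zero (𝕜 := ℂ), hform, h2, inner_zero_left]
      rw [h3, smul_zero]

theorem IsInducedUnitary.isInvariantOperator
    {u : ∀ ψ : CStarState C, HilbertTensor ρ.GNS ψ.GNS →L[ℂ] HilbertTensor ρ.GNS ψ.GNS}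
    (hu : IsInducedUnitary τ ρ u)
    (hR : ∀ ψ : CStarState C, Commute (opTensor R (1 : ψ.GNS →L[ℂ] ψ.GNS)) (u ψ)) :
    IsInvariantOperator τ ρ R := by
  have hcomm : ∀ (ψ : CStarState C) x, opTensor R 1 (u ψ x) = u ψ (opTensor R 1 x) := fun ψ x =>
    congrArg (fun T => T x) (hR ψ).eq
  refine ⟨fun ψ a b => ?_, fun ψ a c hc => ?_⟩
  -- `R ⊗ 1` is moved past `u_ψ`, and `u_ψ* u_ψ = 1` removes the unitary from both sides.
  · rw [← (hu ψ).2, ← (hu ψ).2, hcomm, ← ContinuousLinearMap.adjoint_inner_right,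
      ← ContinuousLinearMap.star_eq_adjoint, ← ContinuousLinearMap.mul_apply,
      (Unitary.mem_iff.1 (hu ψ).1).1, one_apply_eq_self, opTensor_htmul, inner_htmul,
      one_apply_eq_self, ψ.inner_Ω_self, mul_one]
  · rw [← (hu ψ).2, hcomm, opTensor_htmul, hc, one_apply_eq_self, htmul_smul_left, map_smul]

/-- Polarization, using `ξ + ζ` and `ξ + iζ`. A vector state controls one vector at a time, whereas
`IsCovariant.form` involves two. -/
theorem inner_eq_of_inner_self {L K : Type*} [NormedAddCommGroup L] [InnerProductSpace ℂ L]
    [NormedAddCommGroup K] [InnerProductSpace ℂ K] (G' G : L →ₗ[ℂ] K) (c : ℂ)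
    (h : ∀ ξ, inner ℂ (G' ξ) (G ξ) = c * inner ℂ ξ ξ) (ξ ζ : L) :
    inner ℂ (G' ξ) (G ζ) = c * inner ℂ ξ ζ := by
  have h1 := h (ξ + ζ)
  have h2 := h (ξ + Complex.I • ζ)
  simp only [map_add, map_smul, inner_add_left, inner_add_right, inner_smul_left,
    inner_smul_right, h ξ, h ζ, Complex.conj_I] at h1 h2
  have hI := Complex.I_mul_I
  linear_combination (1 / 2 : ℂ) * h1 - (1 / 2 : ℂ) * Complex.I * h2 +
    (1 / 2 : ℂ) * (inner ℂ (G' ξ) (G ζ) - c * inner ℂ ξ ζ - inner ℂ (G' ζ) (G ξ)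
      + c * inner ℂ ζ ξ) * hI

/-- `T` is the image of `τ(a)`, an element of the algebraic tensor product, under `π_ρ ⊗ f`. -/
def IsImageOfCoaction (τ : A →⋆ₐ[ℂ] MinTensor A C) (ρ : CStarState A) {L : Type*}
    [NormedAddCommGroup L] [InnerProductSpace ℂ L] [CompleteSpace L]
    (f : C →⋆ₐ[ℂ] (L →L[ℂ] L)) (a : A)
    (T : HilbertTensor ρ.GNS L →L[ℂ] HilbertTensor ρ.GNS L) : Prop :=
  ∃ w : A ⊗[ℂ] C, MinTensor.incl w = τ a ∧ repTensor ρ.π f w = T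

section Image

variable {L : Type*} [NormedAddCommGroup L] [InnerProductSpace ℂ L] [CompleteSpace L]
  {f : C →⋆ₐ[ℂ] (L →L[ℂ] L)} {a b : A} {T U : HilbertTensor ρ.GNS L →L[ℂ] HilbertTensor ρ.GNS L}

theorem IsImageOfCoaction.one : IsImageOfCoaction τ ρ f 1 1 :=
  ⟨1, by rw [map_one, map_one], map_one _⟩

theorem IsImageOfCoaction.mul (h : IsImageOfCoaction τ ρ f a T) (h' : IsImageOfCoaction τ ρ f b U) :
    IsImageOfCoaction τ ρ f (a * b) (T * U) := by
  obtain ⟨w, h1, h2⟩ := h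
  obtain ⟨w', h1', h2'⟩ := h'
  exact ⟨w * w', by rw [map_mul, map_mul, h1, h1'], by rw [map_mul, h2, h2']⟩

theorem IsImageOfCoaction.star (h : IsImageOfCoaction τ ρ f a T) :
    IsImageOfCoaction τ ρ f (star a) (star T) := by
  obtain ⟨w, h1, h2⟩ := h
  exact ⟨Star.star w, by rw [map_star, map_star, h1], by rw [map_star, h2]⟩

theorem IsImageOfCoaction.smul (h : IsImageOfCoaction τ ρ f a T) (c : ℂ) :
    IsImageOfCoaction τ ρ f (c • a) (c • T) := by
  obtain ⟨w, h1, h2⟩ := h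
  exact ⟨c • w, by rw [map_smul, map_smul, h1], by rw [map_smul, h2]⟩

theorem IsImageOfCoaction.sum {ι : Type*} (F : Finset ι) {a : ι → A}
    {T : ι → HilbertTensor ρ.GNS L →L[ℂ] HilbertTensor ρ.GNS L}
    (h : ∀ i, IsImageOfCoaction τ ρ f (a i) (T i)) :
    IsImageOfCoaction τ ρ f (∑ i ∈ F, a i) (∑ i ∈ F, T i) := by
  choose w h1 h2 using h
  exact ⟨∑ i ∈ F, w i, by simp only [map_sum, h1], by simp only [map_sum, h2]⟩

theorem IsImageOfCoaction.list_prod {ι : Type*} {a : ι → A}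
    {T : ι → HilbertTensor ρ.GNS L →L[ℂ] HilbertTensor ρ.GNS L}
    (h : ∀ i, IsImageOfCoaction τ ρ f (a i) (T i)) (l : List ι) :
    IsImageOfCoaction τ ρ f (l.map a).prod (l.map T).prod := by
  induction l with
  | nil => exact IsImageOfCoaction.one
  | cons i l ih => simpa using (h i).mul ih

end Image

variable {n : ℕ}

/-- The element `z_α z_β*`. -/
def wordElt (z : Fin n → A) (α β : List (Fin n)) : A := (α.map z).prod * star (β.map z).prod

theorem η_wordElt (ρ : CStarState A) (z : Fin n → A) (α β : List (Fin n)) :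
    ρ.η (wordElt z α β) = wordVec (fun i => ρ.π (z i)) α β ρ.Ω := by
  rw [← ρ.π_Ω]
  unfold wordElt wordVec
  rw [map_mul, map_star, map_list_prod, map_list_prod, List.map_map, List.map_map]
  rfl

theorem opTensor_sub_smul_one {H K : Type*} [NormedAddCommGroup H] [InnerProductSpace ℂ H]
    [NormedAddCommGroup K] [InnerProductSpace ℂ K] (R : H →L[ℂ] H) (c : ℂ)
    (x : HilbertTensor H K) :
    opTensor (R - c • 1) (1 : K →L[ℂ] K) x = opTensor R 1 x - c • x := by
  have h : opTensor (R - c • 1) (1 : K →L[ℂ] K) = opTensor R 1 - c • 1 := by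
    rw [eq_sub_iff_add_eq, ← opTensor_one, ← opTensor_smul_left, ← opTensor_add_left,
      sub_add_cancel]
  rw [h]; simp

/-- Invariance concerns the GNS representations of states, models are arbitrary. The words lie in
the algebraic tensor product, where the inner products for a vector `ξ` of the model are `‖ξ‖²`
times those for its vector state; no extension of `π_ρ ⊗ f` to the minimal tensor product is needed.
-/
theorem IsInvariantOperator.isCovariant (h : IsInvariantOperator τ ρ R) {q : Fin n → ℝ}
    {z : Fin n → A}
    (hf : ∀ {L : Type} [NormedAddCommGroup L] [InnerProductSpace ℂ L] [CompleteSpace L]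
      {v : Fin n → Fin n → (L →L[ℂ] L)}, IsModel q v → ∃ f : C →⋆ₐ[ℂ] (L →L[ℂ] L),
      ∀ j, IsImageOfCoaction τ ρ f (z j) (coact (fun i => ρ.π (z i)) v j)) :
    IsCovariant q (fun i => ρ.π (z i)) ρ.Ω R := by
  have key : ∀ {L : Type} [NormedAddCommGroup L] [InnerProductSpace ℂ L] [CompleteSpace L]
      {v : Fin n → Fin n → (L →L[ℂ] L)}, IsModel q v → ∃ f : C →⋆ₐ[ℂ] (L →L[ℂ] L), ∀ α β,
      ∃ w : A ⊗[ℂ] C, MinTensor.incl w = τ (wordElt z α β) ∧ ∀ x,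
        repTensor ρ.π f w x = wordVec (coact (fun i => ρ.π (z i)) v) α β x := by
    intro L _ _ _ v hv
    obtain ⟨f, hf⟩ := hf hv
    refine ⟨f, fun α β => ?_⟩
    obtain ⟨w, h1, h2⟩ := (IsImageOfCoaction.list_prod hf α).mul
      (IsImageOfCoaction.list_prod hf β).star
    exact ⟨w, h1, fun x => by rw [h2]; rfl⟩
  constructor
  · intro L _ _ _ v hv α' β' α β ξ ζ
    obtain ⟨f, hf⟩ := key hv
    obtain ⟨w', h1', h2'⟩ := hf α' β'
    obtain ⟨w, h1, h2⟩ := hf α β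
    let G : (L →ₗ[ℂ] HilbertTensor ρ.GNS L) :=
      { toFun := fun ξ => htmul ρ.Ω ξ
        map_add' := fun x y => htmul_add_right _ _ _
        map_smul' := fun c x => htmul_smul_right _ _ _ }
    rw [← h2, ← h2', ← η_wordElt, ← η_wordElt]
    refine inner_eq_of_inner_self ((repTensor ρ.π f w').toLinearMap ∘ₗ G)
      ((opTensor R 1).toLinearMap ∘ₗ (repTensor ρ.π f w).toLinearMap ∘ₗ G) _ (fun ξ => ?_) ξ ζ
    change inner ℂ (repTensor ρ.π f w' (htmul ρ.Ω ξ))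
      (opTensor R 1 (repTensor ρ.π f w (htmul ρ.Ω ξ))) = _
    rcases eq_or_ne ξ 0 with rfl | hξ
    · simp [htmul_zero_right]
    obtain ⟨ψ, hψ⟩ := exists_vectorState f hξ
    rw [inner_repTensor_vectorState ρ.π f hψ, ← MinTensor.rep_incl, ← MinTensor.rep_incl, h1, h1',
      h.form, mul_comm]
  · intro L _ _ _ v hv α β c hc ξ
    obtain ⟨f, hf⟩ := key hv
    obtain ⟨w, h1, h2⟩ := hf α β
    rw [← h2]
    rcases eq_or_ne ξ 0 with rfl | hξ
    · simp [htmul_zero_right]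
    obtain ⟨ψ, hψ⟩ := exists_vectorState f hξ
    rw [← η_wordElt] at hc
    have h3 := h.eigen ψ _ c hc
    rw [← h1, MinTensor.rep_incl] at h3
    -- An identity of vectors becomes one of inner products: the squared norm of `((R - c) ⊗ 1) y`
    -- is a matrix coefficient of `(R - c)*(R - c) ⊗ 1` and can be computed in the vector state.
    rw [← sub_eq_zero, ← opTensor_sub_smul_one, ← inner_self_eq_zero (𝕜 := ℂ)]
    nth_rewrite 1 [← star_star (opTensor (R - c • 1) (1 : L →L[ℂ] L))]
    rw [ContinuousLinearMap.star_eq_adjoint (star _), ContinuousLinearMap.adjoint_inner_left,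
      ← ContinuousLinearMap.mul_apply, opTensor_star, opTensor_mul, star_one, one_mul,
      inner_repTensor_vectorState ρ.π f hψ]
    have h4 : opTensor (star (R - c • 1) * (R - c • 1)) (1 : ψ.GNS →L[ℂ] ψ.GNS) =
        opTensor (star (R - c • 1)) 1 * opTensor (R - c • 1) 1 := by
      rw [opTensor_mul, one_mul]
    rw [h4, ContinuousLinearMap.mul_apply, opTensor_sub_smul_one, h3, sub_self, map_zero, inner_zero_right, mul_zero]

end Invariance

section OpTensorSums

variable {H K : Type*} [NormedAddCommGroup H] [InnerProductSpace ℂ H]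
  [NormedAddCommGroup K] [InnerProductSpace ℂ K]

theorem opTensor_sum_left {ι : Type*} (F : Finset ι) (S : ι → H →L[ℂ] H) (T : K →L[ℂ] K) :
    opTensor (∑ i ∈ F, S i) T = ∑ i ∈ F, opTensor (S i) T :=
  map_sum (AddMonoidHom.mk' (fun S : H →L[ℂ] H => opTensor S T)
    fun S S' => opTensor_add_left S S' T) S F

theorem opTensor_sum_right {ι : Type*} (F : Finset ι) (S : H →L[ℂ] H) (T : ι → K →L[ℂ] K) :
    opTensor S (∑ i ∈ F, T i) = ∑ i ∈ F, opTensor S (T i) :=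
  map_sum (AddMonoidHom.mk' (fun T : K →L[ℂ] K => opTensor S T)
    fun T T' => opTensor_add_right S T T') T F

end OpTensorSums

/-! ### Letters acting on spans of words, and invariance of the spans under linear changes of
letters. -/

section WordSpanMaps

variable {n : ℕ} {H : Type*} [NormedAddCommGroup H] [InnerProductSpace ℂ H] [CompleteSpace H]
  {s t : Fin n → (H →L[ℂ] H)} {Ω : H}

theorem map_mem_wordSpan {r k : ℕ} (i : Fin n) {x : H} (hx : x ∈ wordSpan t Ω r k) :
    t i x ∈ wordSpan t Ω (r + 1) k := by
  have h : wordSpan t Ω r k ≤ (wordSpan t Ω (r + 1) k).comap (t i).toLinearMap := by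
    refine Submodule.span_le.2 ?_
    rintro _ ⟨α, β, rfl, rfl, rfl⟩
    have := wordVec_mem_wordSpan t Ω (i :: α) β
    rwa [wordVec_cons_left] at this
  exact h hx

theorem star_wordVec_nil (i : Fin n) (β : List (Fin n)) (x : H) :
    star (t i) (wordVec t [] β x) = wordVec t [] (β ++ [i]) x := by
  rw [wordVec_append_right, wordVec_nil_cons, wordVec_nil_nil]

/-- With an empty left word an adjoint letter simply becomes the new last letter of `β`, without
using any relation. -/
theorem star_map_mem_wordSpan {k : ℕ} (i : Fin n) {x : H} (hx : x ∈ wordSpan t Ω 0 k) :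
    star (t i) x ∈ wordSpan t Ω 0 (k + 1) := by
  have h : wordSpan t Ω 0 k ≤ (wordSpan t Ω 0 (k + 1)).comap (star (t i)).toLinearMap := by
    refine Submodule.span_le.2 ?_
    rintro _ ⟨α, β, hα, rfl, rfl⟩
    obtain rfl := List.length_eq_zero_iff.1 hα
    have := wordVec_mem_wordSpan t Ω [] (β ++ [i])
    rw [List.length_append] at this
    change star (t i) (wordVec t [] β Ω) ∈ wordSpan t Ω 0 (β.length + 1)
    rwa [star_wordVec_nil]
  exact h hx

/-- Words in linear combinations of the letters. -/
theorem wordSpan_le_of_linear {A : Matrix (Fin n) (Fin n) ℂ} (h : ∀ j, s j = ∑ i, A i j • t i)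
    (r k : ℕ) : wordSpan s Ω r k ≤ wordSpan t Ω r k := by
  refine Submodule.span_le.2 ?_
  rintro _ ⟨α, β, rfl, rfl, rfl⟩
  rw [SetLike.mem_coe]
  induction α with
  | nil =>
    induction β using List.reverseRecOn with
    | nil => exact Submodule.subset_span ⟨[], [], rfl, rfl, by rw [wordVec_nil_nil, wordVec_nil_nil]⟩
    | append_singleton β j ih =>
      rw [← star_wordVec_nil, h, star_sum, ContinuousLinearMap.sum_apply, List.length_append]
      refine Submodule.sum_mem _ fun i _ => ?_
      rw [star_smul, smul_apply]
      exact Submodule.smul_mem _ _ (star_map_mem_wordSpan i ih)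
  | cons j α ih =>
    rw [wordVec_cons_left, h, ContinuousLinearMap.sum_apply]
    exact Submodule.sum_mem _ fun i _ => Submodule.smul_mem _ _ (map_mem_wordSpan i ih)

theorem wordSubspace_congr {r k : ℕ} (h : ∀ r k, wordSpan s Ω r k = wordSpan t Ω r k) :
    wordSubspace s Ω r k = wordSubspace t Ω r k := by
  rcases r with _ | r
  · exact h _ _
  rcases k with _ | k
  · exact h _ _
  change wordSpan s Ω (r + 1) (k + 1) ⊓ (wordSpan s Ω r k)ᗮ =
    wordSpan t Ω (r + 1) (k + 1) ⊓ (wordSpan t Ω r k)ᗮ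
  rw [h, h]

end WordSpanMaps

/-! ### Rotated generators of the Cuntz algebra. -/

section CuntzWords

variable {n : ℕ}

theorem Cuntz.star_S_mul_S (i j : Fin n) :
    star (Cuntz.S i) * Cuntz.S j = if i = j then (1 : Cuntz n) else 0 := by
  split_ifs with h
  · rw [h, Cuntz.rel.1]
  · exact isometry_orthogonal _ Cuntz.rel.1 Cuntz.rel.2 i j h

/-- Linear combinations of the generators. -/
def rotatedS (A : Matrix (Fin n) (Fin n) ℂ) (j : Fin n) : Cuntz n := ∑ i, A i j • Cuntz.S i

variable {A : Matrix (Fin n) (Fin n) ℂ}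

theorem star_rotatedS_mul (h1 : A.conjTranspose * A = 1) (i j : Fin n) :
    star (rotatedS A i) * rotatedS A j = if i = j then 1 else 0 := by
  have h2 := congrFun (congrFun h1 i) j
  rw [Matrix.mul_apply, Matrix.one_apply] at h2
  unfold rotatedS
  rw [star_sum, Finset.sum_mul_sum]
  simp only [star_smul, smul_mul_smul_comm, Cuntz.star_S_mul_S, smul_ite, smul_zero,
    Finset.sum_ite_eq, Finset.mem_univ, if_true]
  rw [← Finset.sum_smul]
  simp only [Matrix.conjTranspose_apply] at h2
  rw [h2, ite_smul, one_smul, zero_smul]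

theorem rotatedS_inverse (h2 : A * A.conjTranspose = 1) (i : Fin n) :
    ∑ j, A.conjTranspose j i • rotatedS A j = Cuntz.S i := by
  unfold rotatedS
  simp only [Finset.smul_sum, smul_smul]
  rw [Finset.sum_comm]
  simp only [← Finset.sum_smul]
  have h3 : ∀ k, ∑ j, A.conjTranspose j i * A k j = if k = i then 1 else 0 := by
    intro k
    have := congrFun (congrFun h2 k) i
    rw [Matrix.mul_apply, Matrix.one_apply] at this
    rw [← this]
    exact Finset.sum_congr rfl fun j _ => mul_comm _ _
  simp only [h3, ite_smul, one_smul, zero_smul, Finset.sum_ite_eq', Finset.mem_univ, if_true]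

theorem sum_rotatedS_mul_star (h2 : A * A.conjTranspose = 1) :
    ∑ j, rotatedS A j * star (rotatedS A j) = 1 := by
  have h3 : ∀ j, rotatedS A j * star (rotatedS A j) =
      ∑ i, Cuntz.S i * (A i j • star (rotatedS A j)) := by
    intro j
    nth_rewrite 1 [rotatedS]
    rw [Finset.sum_mul]
    exact Finset.sum_congr rfl fun i _ => by rw [smul_mul_assoc, mul_smul_comm]
  rw [Finset.sum_congr rfl fun j _ => h3 j, Finset.sum_comm, ← Cuntz.rel.2]
  refine Finset.sum_congr rfl fun i _ => ?_
  rw [← Finset.mul_sum, ← rotatedS_inverse h2 i, star_sum]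
  congr 1
  refine Finset.sum_congr rfl fun j _ => ?_
  rw [star_smul]
  simp

/-- The canonical map of the free `*`-algebra onto a dense subalgebra. -/
def Cuntz.incl : FreeStarAlg (Fin n) →⋆ₐ[ℂ] Cuntz n := UnivCStar.incl

/-- The span of the words in the rotated generators is a left ideal for the free `*`-algebra. -/
theorem wordElt_mul_mem (h1 : A.conjTranspose * A = 1) (h2 : A * A.conjTranspose = 1)
    (x : FreeStarAlg (Fin n)) (y : Cuntz n)
    (hy : y ∈ Submodule.span ℂ (Set.range fun p : List (Fin n) × List (Fin n) =>
      wordElt (rotatedS A) p.1 p.2)) :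
    Cuntz.incl x * y ∈
      Submodule.span ℂ (Set.range fun p : List (Fin n) × List (Fin n) =>
        wordElt (rotatedS A) p.1 p.2) := by
  set M := Submodule.span ℂ (Set.range fun p : List (Fin n) × List (Fin n) =>
      wordElt (rotatedS A) p.1 p.2) with hM
  have hmem : ∀ α β, wordElt (rotatedS A) α β ∈ M := fun α β => Submodule.subset_span ⟨(α, β), rfl⟩
  have hleft : ∀ j, ∀ y ∈ M, rotatedS A j * y ∈ M := by
    intro j y hy
    have h : M ≤ M.comap (LinearMap.mulLeft ℂ (rotatedS A j)) := by
      refine Submodule.span_le.2 ?_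
      rintro _ ⟨⟨α, β⟩, rfl⟩
      have := hmem (j :: α) β
      simpa [wordElt, mul_assoc] using this
    exact h hy
  have hleft' : ∀ j, ∀ y ∈ M, star (rotatedS A j) * y ∈ M := by
    intro j y hy
    have h : M ≤ M.comap (LinearMap.mulLeft ℂ (star (rotatedS A j))) := by
      refine Submodule.span_le.2 ?_
      rintro _ ⟨⟨α, β⟩, rfl⟩
      change star (rotatedS A j) * wordElt (rotatedS A) α β ∈ M
      -- An adjoint letter either extends `β`, if `α` is empty, or meets the first letter of `α` and
      -- is absorbed by the Cuntz relations.
      rcases α with _ | ⟨i, α⟩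
      · have := hmem [] (β ++ [j])
        simpa [wordElt] using this
      · have h3 : star (rotatedS A j) * wordElt (rotatedS A) (i :: α) β =
            (if j = i then 1 else 0) * wordElt (rotatedS A) α β := by
          rw [← star_rotatedS_mul h1]
          simp only [wordElt, List.map_cons, List.prod_cons, mul_assoc]
        rw [h3]
        split_ifs
        · rw [one_mul]; exact hmem _ _
        · rw [zero_mul]; exact zero_mem _
    exact h hy
  induction x using FreeStarAlg.induction generalizing y with
  | hc c =>
    rw [AlgHomClass.commutes, ← Algebra.smul_def]
    exact M.smul_mem c hy
  | hl l =>
    rcases l with i | i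
    · change Cuntz.S i * y ∈ M
      rw [← rotatedS_inverse h2 i, Finset.sum_mul]
      refine Submodule.sum_mem _ fun j _ => ?_
      rw [smul_mul_assoc]
      exact M.smul_mem _ (hleft j y hy)
    · have h3 : Cuntz.incl (FreeStarAlg.letter (Sum.inr i)) = star (Cuntz.S i) := by
        have h4 : (FreeStarAlg.letter (Sum.inr i) : FreeStarAlg (Fin n)) =
            star (FreeStarAlg.letter (Sum.inl i)) := (FreeStarAlg.star_letter (Sum.inl i)).symm
        rw [h4, map_star]; rfl
      rw [h3, ← rotatedS_inverse h2 i, star_sum, Finset.sum_mul]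
      refine Submodule.sum_mem _ fun j _ => ?_
      rw [star_smul, smul_mul_assoc]
      exact M.smul_mem _ (hleft' j y hy)
  | hm a b ha hb =>
    rw [map_mul, mul_assoc]
    exact ha _ (hb _ hy)
  | ha a b ha hb =>
    rw [map_add, add_mul]
    exact add_mem (ha _ hy) (hb _ hy)

/-- The span of the words contains `1` and is stable under the free `*`-algebra, so it contains the
image of the latter, which is dense in the Cuntz algebra; `η` is continuous with dense range. -/
theorem total_wordVec_rotatedS (h1 : A.conjTranspose * A = 1) (h2 : A * A.conjTranspose = 1)
    (ρ : CStarState (Cuntz n)) (z : ρ.GNS)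
    (hz : ∀ α β, inner ℂ (wordVec (fun i => ρ.π (rotatedS A i)) α β ρ.Ω) z = (0 : ℂ)) : z = 0 := by
  have hM : ∀ y ∈ Submodule.span ℂ (Set.range fun p : List (Fin n) × List (Fin n) =>
      wordElt (rotatedS A) p.1 p.2), inner ℂ (ρ.η y) z = (0 : ℂ) := by
    intro y hy
    induction hy using Submodule.span_induction with
    | mem y hy =>
      obtain ⟨p, rfl⟩ := hy
      rw [η_wordElt, hz]
    | zero => rw [map_zero, inner_zero_left]
    | add x y _ _ hx hy => rw [map_add, inner_add_left, hx, hy, add_zero]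
    | smul c x _ hx => rw [map_smul, inner_smul_left, hx, mul_zero]
  have hcont : Continuous ρ.η := by
    have h3 : (ρ.η : Cuntz n → ρ.GNS) = fun a => ρ.π a ρ.Ω := funext fun a => (ρ.π_Ω a).symm
    rw [h3]
    have h4 : Continuous ρ.π :=
      AddMonoidHomClass.continuous_of_bound ρ.π 1 fun a =>
        (NonUnitalStarAlgHom.norm_apply_le ρ.π a).trans_eq (one_mul _).symm
    exact (ContinuousLinearMap.apply ℂ ρ.GNS ρ.Ω).continuous.comp h4
  have hall : ∀ a : Cuntz n, inner ℂ (ρ.η a) z = (0 : ℂ) := by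
    refine (univFamily (Fin n) (CuntzRel n)).induction
      (isClosed_eq (hcont.inner continuous_const) continuous_const) fun x => ?_
    refine hM _ ?_
    have h5 : (1 : Cuntz n) ∈ Submodule.span ℂ (Set.range fun p : List (Fin n) × List (Fin n) =>
        wordElt (rotatedS A) p.1 p.2) :=
      Submodule.subset_span ⟨([], []), by simp [wordElt]⟩
    have := wordElt_mul_mem h1 h2 x 1 h5
    rwa [mul_one] at this
  have hz' : ∀ x : ρ.GNS, inner ℂ x z = (0 : ℂ) := fun x =>
    ρ.denseRange_η.induction_on x (isClosed_eq (continuous_id.inner continuous_const)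
      continuous_const) hall
  exact inner_self_eq_zero.1 (hz' z)

/-- The words in the generators span the same levels as those in their rotations. -/
theorem levelSpan_eq_wordSpan (h2 : A * A.conjTranspose = 1)
    (ρ : CStarState (Cuntz n)) (r k : ℕ) :
    Cuntz.levelSpan ρ r k = wordSpan (fun i => ρ.π (Cuntz.S i)) ρ.Ω r k ∧
      wordSpan (fun i => ρ.π (Cuntz.S i)) ρ.Ω r k =
        wordSpan (fun i => ρ.π (rotatedS A i)) ρ.Ω r k := by
  constructor
  · rw [wordSpan_eq_span_range]
    unfold Cuntz.levelSpan
    congr 2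
    funext p
    rw [← η_wordElt]
    unfold wordElt Cuntz.word
    rw [List.map_ofFn, List.map_ofFn]
    rfl
  · refine le_antisymm (wordSpan_le_of_linear (A := A.conjTranspose) (fun j => ?_) r k)
      (wordSpan_le_of_linear (A := A) (fun j => ?_) r k)
    · rw [← rotatedS_inverse h2 j]
      simp only [map_sum, map_smul]
    · unfold rotatedS
      simp only [map_sum, map_smul]

end CuntzWords

/-! ### The GNS space of the invariant state as a covariant system. -/

section CovariantSystem

variable {n : ℕ} {Q A : Matrix (Fin n) (Fin n) ℂ} {q : Fin n → ℝ}

/-- Sending `u` to `A v A*` makes the rotated generators transform under `v` itself. This is the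
reason for working with them instead of the `S_i`. -/
theorem exists_isImageOfCoaction (hq : ∀ i, 0 < q i)
    (h1 : A.conjTranspose * A = 1) (h2 : A * A.conjTranspose = 1)
    (hQ : Q = A.map star * Matrix.diagonal (fun i => (q i : ℂ)) * A.transpose)
    (ρ : CStarState (Cuntz n))
    {L : Type} [NormedAddCommGroup L] [InnerProductSpace ℂ L] [CompleteSpace L]
    {v : Fin n → Fin n → (L →L[ℂ] L)} (hv : IsModel q v) :
    ∃ f : FreeUnitary Q →⋆ₐ[ℂ] (L →L[ℂ] L), ∀ j, IsImageOfCoaction (cuntzAction Q) ρ f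
      (rotatedS A j) (coact (fun i => ρ.π (rotatedS A i)) v j) := by
  set u := A.map (algebraMap ℂ (L →L[ℂ] L)) * Matrix.of v *
      A.conjTranspose.map (algebraMap ℂ (L →L[ℂ] L)) with hu
  have hrel : FreeUnitaryRel Q u := hv.freeUnitaryRel hq h1 h2 hQ
  set f := FreeUnitary.lift Q u hrel with hf
  have hS : ∀ j, IsImageOfCoaction (cuntzAction Q) ρ f (Cuntz.S j)
      (∑ i, opTensor (ρ.π (Cuntz.S i)) (u i j)) := by
    intro j
    refine ⟨∑ i, Cuntz.S i ⊗ₜ FreeUnitary.u Q i j, ?_, ?_⟩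
    · rw [map_sum, cuntzAction_S]; rfl
    · rw [map_sum]
      refine Finset.sum_congr rfl fun i _ => ?_
      rw [repTensor_tmul, hf, FreeUnitary.lift_u]
  have hua : ∀ i m, ∑ j, A j m • u i j = ∑ k, A i k • v k m := by
    intro i m
    have e : u * A.map (algebraMap ℂ (L →L[ℂ] L)) =
        A.map (algebraMap ℂ (L →L[ℂ] L)) * Matrix.of v := by
      rw [hu, Matrix.mul_assoc, ← Matrix.map_mul, h1, Matrix.map_one _ (map_zero _) (map_one _),
        Matrix.mul_one]
    have e' := congrFun (congrFun e i) m
    rw [Matrix.mul_apply, Matrix.mul_apply] at e'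
    simp only [Matrix.map_apply, Matrix.of_apply, ← Algebra.commutes, ← Algebra.smul_def] at e'
    exact e'
  refine ⟨f, fun m => ?_⟩
  have h3 := IsImageOfCoaction.sum Finset.univ fun j => (hS j).smul (A j m)
  refine (congrArg (IsImageOfCoaction (cuntzAction Q) ρ f (rotatedS A m)) ?_).mpr h3
  change ∑ k, opTensor (ρ.π (rotatedS A k)) (v k m) = _
  simp only [Finset.smul_sum, ← opTensor_smul_right]
  rw [Finset.sum_comm]
  simp only [← opTensor_sum_right, hua]
  simp only [opTensor_sum_right, opTensor_smul_right, ← opTensor_smul_left]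
  rw [Finset.sum_comm]
  refine Finset.sum_congr rfl fun k _ => ?_
  rw [← opTensor_sum_left]
  unfold rotatedS
  simp only [map_sum, map_smul]

open scoped ComplexOrder in
/-- The GNS space of the invariant state, as a covariant system. -/
theorem exists_isCovariantSystem (hQ : Q.PosDef) (htr : Q.trace = 1) (ρ : CStarState (Cuntz n))
    (hρ : IsInvariantState (cuntzAction Q) ρ) :
    ∃ (q : Fin n → ℝ) (s : Fin n → (ρ.GNS →L[ℂ] ρ.GNS)), IsCovariantSystem q s ρ.Ω ∧
      (∀ r k, wordSpan (fun i => ρ.π (Cuntz.S i)) ρ.Ω r k = wordSpan s ρ.Ω r k) ∧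
      ∀ R : ρ.GNS →L[ℂ] ρ.GNS, IsInvariantOperator (cuntzAction Q) ρ R →
        IsCovariant q s ρ.Ω R := by
  obtain ⟨q, A, hq, hq1, h1, h2, hA⟩ := exists_diagonalization hQ htr
  have hcov : ∀ R : ρ.GNS →L[ℂ] ρ.GNS, IsInvariantOperator (cuntzAction Q) ρ R →
      IsCovariant q (fun i => ρ.π (rotatedS A i)) ρ.Ω R := fun R hR =>
    hR.isCovariant fun hv => exists_isImageOfCoaction hq h1 h2 hA ρ hv
  refine ⟨q, fun i => ρ.π (rotatedS A i), ?_, fun r k => (levelSpan_eq_wordSpan h2 ρ r k).2, hcov⟩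
  refine ⟨hq, hq1, fun i j => ?_, ?_, ρ.inner_Ω_self, hcov 1 hρ.isInvariantOperator_one,
    total_wordVec_rotatedS h1 h2 ρ⟩
  · rw [← map_star, ← map_mul, star_rotatedS_mul h1]
    split_ifs
    · rw [map_one]
    · rw [map_zero]
  · simp_rw [← map_star, ← map_mul]
    rw [← map_sum, sum_rotatedS_mul_star h2, map_one]

theorem spectralSubspace_eq_wordSubspace (ρ : CStarState (Cuntz n)) (r k : ℕ) :
    Cuntz.spectralSubspace ρ r k = wordSubspace (fun i => ρ.π (Cuntz.S i)) ρ.Ω r k := by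
  have h : ∀ r k, Cuntz.levelSpan ρ r k = wordSpan (fun i => ρ.π (Cuntz.S i)) ρ.Ω r k := fun r k =>
    -- The first half does not involve the rotation, so any unitary may be supplied.
    (levelSpan_eq_wordSpan (A := 1) (by simp) ρ r k).1
  rcases r with _ | r
  · exact h _ _
  rcases k with _ | k
  · exact h _ _
  change Cuntz.levelSpan ρ (r + 1) (k + 1) ⊓ (Cuntz.levelSpan ρ r k)ᗮ =
    wordSpan _ ρ.Ω (r + 1) (k + 1) ⊓ (wordSpan _ ρ.Ω r k)ᗮ
  rw [h, h]

end CovariantSystem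

/-! ### Irreducibility of the fundamental representation. -/

section Irreducibility

variable {n : ℕ} {Q : Matrix (Fin n) (Fin n) ℂ}

/-- A matrix commuting with every model is a multiple of the identity. -/
theorem eq_smul_one_of_commute_models (hn : 0 < n) {q : Fin n → ℝ} (hq : ∀ i, 0 < q i)
    (T : Matrix (Fin n) (Fin n) ℂ)
    (h : ∀ {L : Type} [NormedAddCommGroup L] [InnerProductSpace ℂ L] [CompleteSpace L]
      {v : Fin n → Fin n → (L →L[ℂ] L)}, IsModel q v →
      ∀ i j, ∑ k, T i k • v k j = ∑ k, T k j • v i k) : ∃ c : ℂ, T = c • 1 := by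
  -- The free group model is diagonal with linearly independent entries, which forces `T` to be
  -- diagonal; a mixing model with `v_ij ≠ 0` then makes its diagonal entries equal.
  have hoff : ∀ i j, i ≠ j → T i j = 0 := by
    intro i j hij
    have h1 := h (isModel_freeModel q) i j
    rw [Finset.sum_eq_single j (fun k _ hk => by rw [freeModel, if_neg hk, smul_zero]) (by simp),
      Finset.sum_eq_single i (fun k _ hk => by rw [freeModel, if_neg (Ne.symm hk), smul_zero])
        (by simp), freeModel, freeModel, if_pos rfl, if_pos rfl] at h1
    have h2 := congrArg (fun X : l2 (FreeGroup (Fin n)) →L[ℂ] l2 (FreeGroup (Fin n)) =>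
      (inner ℂ (l2.e (FreeGroup.of j)) (X (l2.e 1)) : ℂ)) h1
    simp only [smul_apply, l2.perm_e, inner_smul_right, Equiv.coe_mulLeft, mul_one] at h2
    rw [l2.inner_e_e, l2.inner_e_e, if_pos rfl, if_neg, mul_one, mul_zero] at h2
    · exact h2
    · intro h3
      exact hij (FreeGroup.of_injective h3).symm
  have hdiag : ∀ i j, T i i = T j j := by
    intro i j
    rcases eq_or_ne i j with rfl | hij
    · rfl
    obtain ⟨v, hv⟩ := exists_isMixing hq hij
    have h1 := h hv.isModel i j
    rw [Finset.sum_eq_single i (fun k _ hk => by rw [hoff i k (Ne.symm hk), zero_smul]) (by simp),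
      Finset.sum_eq_single j (fun k _ hk => by rw [hoff k j hk, zero_smul]) (by simp),
      ← sub_eq_zero, ← sub_smul] at h1
    rcases smul_eq_zero.1 h1 with h2 | h2
    · exact sub_eq_zero.1 h2
    · exact absurd (by rw [h2, zero_mul]) (hv.mul_diag' i)
  refine ⟨T ⟨0, hn⟩ ⟨0, hn⟩, ?_⟩
  ext i j
  rw [Matrix.smul_apply, Matrix.one_apply]
  split_ifs with hij
  · subst hij
    rw [smul_eq_mul, mul_one]; exact hdiag _ _
  · rw [smul_zero]; exact hoff i j hij

open scoped ComplexOrder in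
/-- The fundamental representation is irreducible. -/
theorem isIrreducibleUnitaryRep_u (hn : 0 < n) (hQ : Q.PosDef) (htr : Q.trace = 1) :
    IsIrreducibleUnitaryRep (FreeUnitary.comul Q) (FreeUnitary.u Q) where
  pos := hn
  star_mul := (FreeUnitary.rel Q).1
  mul_star := (FreeUnitary.rel Q).2.1
  comul := FreeUnitary.comul_u Q
  irreducible := by
    intro T hT
    obtain ⟨q, A, hq, hq1, h1, h2, hA⟩ := exists_diagonalization hQ htr
    obtain ⟨c, hc⟩ := eq_smul_one_of_commute_models hn hq (A.conjTranspose * T * A) (by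
      intro L _ _ _ v hv i j
      set m : Matrix (Fin n) (Fin n) ℂ → Matrix (Fin n) (Fin n) (L →L[ℂ] L) :=
        fun M => M.map (algebraMap ℂ (L →L[ℂ] L)) with hm
      have hmul : ∀ M N, m M * m N = m (M * N) := fun M N => Matrix.map_mul.symm
      have hone : m 1 = 1 := Matrix.map_one _ (map_zero _) (map_one _)
      have hrel : FreeUnitaryRel Q (m A * Matrix.of v * m A.conjTranspose) :=
        hv.freeUnitaryRel hq h1 h2 hA
      have h3 := congrArg (fun M => M.map (FreeUnitary.lift Q _ hrel)) hT
      have hTm : (T.map (algebraMap ℂ (FreeUnitary Q))).map (FreeUnitary.lift Q _ hrel) = m T := by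
        ext1 i j
        exact AlgHomClass.commutes (FreeUnitary.lift Q _ hrel) (T i j)
      have hum : (FreeUnitary.u Q).map (FreeUnitary.lift Q _ hrel) =
          m A * Matrix.of v * m A.conjTranspose := by
        ext1 i j
        exact FreeUnitary.lift_u Q _ hrel i j
      simp only [Matrix.map_mul, hTm, hum] at h3
      have m1 : m A.conjTranspose * m A = 1 := by rw [hmul, h1, hone]
      have h4 : m (A.conjTranspose * T * A) * Matrix.of v =
          Matrix.of v * m (A.conjTranspose * T * A) := by
        rw [← hmul, ← hmul]
        calc _ = m A.conjTranspose * (m T * (m A * Matrix.of v * m A.conjTranspose)) * m A := by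
              simp only [Matrix.mul_assoc, m1, Matrix.mul_one]
          _ = (m A.conjTranspose * m A) * Matrix.of v * (m A.conjTranspose * m T * m A) := by
              rw [h3]; simp only [Matrix.mul_assoc]
          _ = _ := by rw [m1, Matrix.one_mul]
      have h5 := congrFun (congrFun h4 i) j
      rw [Matrix.mul_apply, Matrix.mul_apply] at h5
      simp only [hm, Matrix.map_apply, Matrix.of_apply, ← Algebra.commutes,
        ← Algebra.smul_def] at h5
      exact h5)
    refine ⟨c, ?_⟩
    calc T = (A * A.conjTranspose) * T * (A * A.conjTranspose) := by
          rw [h2, Matrix.one_mul, Matrix.mul_one]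
      _ = A * (A.conjTranspose * T * A) * A.conjTranspose := by simp only [Matrix.mul_assoc]
      _ = c • 1 := by rw [hc, Matrix.mul_smul, Matrix.mul_one, Matrix.smul_mul, h2]

-- The entries of `u` are coefficients of an irreducible representation, so the commutator condition
-- of a spectral triple applies to the generators themselves.
open scoped ComplexOrder in
theorem S_mem_algebraicElements (hn : 0 < n) (hQ : Q.PosDef) (htr : Q.trace = 1) (j : Fin n) :
    Cuntz.S j ∈ algebraicElements (FreeUnitary.comul Q) (cuntzAction Q) := by
  change cuntzAction Q (Cuntz.S j) ∈ Submodule.span ℂ _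
  rw [cuntzAction_S]
  exact Submodule.sum_mem _ fun i _ => Submodule.subset_span ⟨_, _,
    StarAlgebra.subset_adjoin ℂ _ ⟨n, _, isIrreducibleUnitaryRep_u hn hQ htr, i, j, rfl⟩, rfl⟩

end Irreducibility

/-! ### Eigenvectors of `D`, of its resolvent and of the functional calculus. -/

section Eigenspaces

variable {H : Type*} [NormedAddCommGroup H] [InnerProductSpace ℂ H] [CompleteSpace H]
  {D : H →ₗ.[ℂ] H} {R : H →L[ℂ] H}

theorem inner_symm_of_isSelfAdjoint (hD : IsSelfAdjoint D) (x y : D.domain) :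
    inner ℂ (D x) (y : H) = (inner ℂ (x : H) (D y) : ℂ) := by
  have h := LinearPMap.adjoint_isFormalAdjoint hD.dense_domain
  rw [LinearPMap.isSelfAdjoint_def.1 hD] at h
  exact h x y

/-- A vector on which `D` acts as the real scalar `d`. -/
def IsEigenvectorOf (D : H →ₗ.[ℂ] H) (d : ℝ) (x : H) : Prop :=
  ∃ hx : x ∈ D.domain, D ⟨x, hx⟩ = (d : ℂ) • x

/-- A subspace on which a resolvent is scalar is an eigenspace. -/
theorem exists_real_eigenvalue (hD : IsSelfAdjoint D) {z : ℂ} (hR : IsResolventAt D z R)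
    (K : Submodule ℂ H) {c : ℂ} (hK : ∀ x ∈ K, R x = c • x) :
    ∃ d : ℝ, ∀ x ∈ K, IsEigenvectorOf D d x := by
  by_cases h0 : ∀ x ∈ K, x = 0
  · exact ⟨0, fun x hx => by
      obtain rfl := h0 x hx
      exact ⟨D.domain.zero_mem, (map_zero D.toFun).trans (smul_zero _).symm⟩⟩
  push Not at h0
  obtain ⟨x, hx, hx0⟩ := h0
  -- A resolvent is injective, so it cannot act as zero on a nonzero vector.
  have hc0 : c ≠ 0 := by
    rintro rfl
    apply hx0
    have h1 := hR.right_inv x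
    have h2 : R x = 0 := by rw [hK x hx, zero_smul]
    have h3 : (⟨R x, hR.mem x⟩ : D.domain) = 0 := Subtype.ext h2
    rw [h3, h2, smul_zero, sub_zero] at h1
    exact h1.symm.trans (map_zero D.toFun)
  -- Solving `c = (d - z)⁻¹` for `d`; the vector `y = c⁻¹ R y` is in the domain because it is in the
  -- range of `R`.
  have key : ∀ y ∈ K, ∃ hy : y ∈ D.domain, D ⟨y, hy⟩ = (c⁻¹ + z) • y := by
    intro y hy
    have h1 : y = c⁻¹ • R y := by rw [hK y hy, smul_smul, inv_mul_cancel₀ hc0, one_smul]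
    have hmem : y ∈ D.domain := by
      rw [h1]; exact D.domain.smul_mem _ (hR.mem y)
    refine ⟨hmem, ?_⟩
    have h2 : (⟨y, hmem⟩ : D.domain) = c⁻¹ • ⟨R y, hR.mem y⟩ := Subtype.ext h1
    have h3 : D (c⁻¹ • ⟨R y, hR.mem y⟩) = c⁻¹ • D ⟨R y, hR.mem y⟩ := map_smul D.toFun _ _
    rw [h2, h3, sub_eq_iff_eq_add.1 (hR.right_inv y), hK y hy, smul_add, smul_smul, smul_smul,
      add_smul, mul_right_comm, inv_mul_cancel₀ hc0, one_mul]
  have hreal : (starRingEnd ℂ) (c⁻¹ + z) = c⁻¹ + z := by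
    obtain ⟨hx', h1⟩ := key x hx
    have h2 := inner_symm_of_isSelfAdjoint hD ⟨x, hx'⟩ ⟨x, hx'⟩
    rw [h1, inner_smul_left, inner_smul_right] at h2
    exact mul_right_cancel₀ (inner_self_ne_zero.2 hx0) h2
  obtain ⟨d, hd⟩ := Complex.conj_eq_iff_real.1 hreal
  exact ⟨d, fun y hy => by
    obtain ⟨h1, h2⟩ := key y hy
    exact ⟨h1, by rw [h2, hd]⟩⟩

theorem sub_I_ne_zero (d : ℝ) : (d : ℂ) - Complex.I ≠ 0 := by
  intro h
  have := congrArg Complex.im h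
  simp at this

theorem IsEigenvectorOf.resolvent (hR : IsResolventAt D Complex.I R) {d : ℝ} {x : H}
    (hx : IsEigenvectorOf D d x) : R x = ((d : ℂ) - Complex.I)⁻¹ • x := by
  obtain ⟨hx, h1⟩ := hx
  have h2 := hR.left_inv ⟨x, hx⟩
  rw [h1, ← sub_smul, map_smul] at h2
  change _ = x at h2
  nth_rewrite 2 [← h2]
  rw [smul_smul, inv_mul_cancel₀ (sub_I_ne_zero d), one_smul]

/-- Symmetry of `D` is paired against a vector `R y` of the domain, so that the resolvent at `-i`
never has to be constructed. -/
theorem IsEigenvectorOf.star_resolvent (hD : IsSelfAdjoint D)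
    (hR : IsResolventAt D Complex.I R) {d : ℝ} {x : H}
    (hx : IsEigenvectorOf D d x) : star R x = ((d : ℂ) + Complex.I)⁻¹ • x := by
  obtain ⟨hx, h1⟩ := hx
  refine ext_inner_right ℂ fun y => ?_
  have h2 := inner_symm_of_isSelfAdjoint hD ⟨x, hx⟩ ⟨R y, hR.mem y⟩
  rw [h1, sub_eq_iff_eq_add.1 (hR.right_inv y), inner_smul_left, inner_add_right,
    inner_smul_right, Complex.conj_ofReal] at h2
  rw [ContinuousLinearMap.star_eq_adjoint, ContinuousLinearMap.adjoint_inner_left, inner_smul_left,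
    map_inv₀, map_add, Complex.conj_ofReal, Complex.conj_I, ← sub_eq_add_neg,
    eq_inv_mul_iff_mul_eq₀ (sub_I_ne_zero d)]
  linear_combination h2

theorem IsEigenvectorOf.star_resolvent_mul (hD : IsSelfAdjoint D)
    (hR : IsResolventAt D Complex.I R) {d : ℝ} {x : H} (hx : IsEigenvectorOf D d x) :
    (star R * R) x = (((1 + d ^ 2)⁻¹ : ℝ) : ℂ) • x := by
  rw [ContinuousLinearMap.mul_apply, hx.resolvent hR, map_smul, hx.star_resolvent hD hR, smul_smul]
  congr 1
  rw [← mul_inv, Complex.ofReal_inv]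
  congr 1
  push_cast
  linear_combination -Complex.I_mul_I

theorem cfc_eigenvector {a : H →L[ℂ] H} (ha : IsSelfAdjoint a) {f : ℝ → ℝ} {l : ℝ} {x : H}
    (hf : ContinuousOn f (spectrum ℝ a)) (hx : a x = (l : ℂ) • x) :
    cfc f a x = (f l : ℂ) • x := by
  rcases eq_or_ne x 0 with rfl | hx0
  · rw [map_zero, smul_zero]
  have hl : l ∈ spectrum ℝ a := by
    rw [spectrum.mem_iff]
    intro hu
    obtain ⟨b, hb⟩ := hu.exists_left_inv
    apply hx0
    have h1 : (algebraMap ℝ (H →L[ℂ] H) l - a) x = 0 := by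
      rw [sub_apply, hx, Algebra.algebraMap_eq_smul_one, smul_apply, one_apply_eq_self, sub_eq_zero]
      exact (Complex.coe_smul l x).symm
    calc x = (b * (algebraMap ℝ (H →L[ℂ] H) l - a)) x := by rw [hb, one_apply_eq_self]
      _ = 0 := by rw [ContinuousLinearMap.mul_apply, h1, map_zero]
  rw [cfc_apply f a ha hf]
  -- Stone–Weierstrass: the identity holds for constants and the coordinate, is preserved by sums
  -- and products, and is closed in `g`.
  have key : ∀ g : C(spectrum ℝ a, ℝ), cfcHom ha g x = (g ⟨l, hl⟩ : ℂ) • x := by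
    intro g
    have hid : cfcHom ha (.restrict (spectrum ℝ a) <| .id ℝ) x = (l : ℂ) • x := by
      rw [cfcHom_id ha, hx]
    induction g using ContinuousMap.induction_on_of_compact with
    | const r =>
      have : (ContinuousMap.const (spectrum ℝ a) r) = algebraMap ℝ C(spectrum ℝ a, ℝ) r := rfl
      rw [this, AlgHomClass.commutes, Algebra.algebraMap_eq_smul_one, smul_apply, one_apply_eq_self]
      exact (Complex.coe_smul r x).symm
    | id => exact hid
    | star_id =>
      rw [star_trivial]; exact hid
    | add f g hf hg =>
      rw [map_add, add_apply, hf, hg, ContinuousMap.add_apply, Complex.ofReal_add, add_smul]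
    | mul f g hf hg =>
      rw [map_mul, ContinuousLinearMap.mul_apply, hg, map_smul, hf, smul_smul,
        ContinuousMap.mul_apply, Complex.ofReal_mul, mul_comm]
    | frequently g hg =>
      have hcl : IsClosed {g : C(spectrum ℝ a, ℝ) | cfcHom ha g x = (g ⟨l, hl⟩ : ℂ) • x} := by
        refine isClosed_eq ?_ ?_
        · exact (ContinuousLinearMap.apply ℂ H x).continuous.comp (cfcHom_continuous ha)
        · exact (Complex.continuous_ofReal.comp (continuous_eval_const _)).smul
            continuous_const
      exact hcl.mem_of_frequently_of_tendsto hg Filter.tendsto_id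
  exact key _

open scoped ComplexOrder in
theorem rpow_eigenvector {P : H →L[ℂ] H} (hP : 0 ≤ P) {p l : ℝ} (hp : 0 < p) {x : H}
    (hx : P x = (l : ℂ) • x) : (P ^ p) x = ((l ^ p : ℝ) : ℂ) • x := by
  rw [CFC.rpow_eq_cfc_real hP]
  exact cfc_eigenvector (.of_nonneg hP)
    (Real.continuous_rpow_const hp.le).continuousOn hx

end Eigenspaces

/-! ### Linear growth of the eigenvalues. -/

section CommutatorBounds

variable {n : ℕ} {H : Type*} [NormedAddCommGroup H] [InnerProductSpace ℂ H] [CompleteSpace H]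
  {t : Fin n → (H →L[ℂ] H)} {Ω : H} {D : H →ₗ.[ℂ] H} {M : ℝ}

theorem inner_apply_apply_of_star_mul (ht : ∀ i j, star (t i) * t j = if i = j then 1 else 0)
    (i j : Fin n) (x y : H) : inner ℂ (t i x) (t j y) = if i = j then (inner ℂ x y : ℂ) else 0 := by
  rw [← ContinuousLinearMap.adjoint_inner_right, ← ContinuousLinearMap.star_eq_adjoint,
    ← ContinuousLinearMap.mul_apply, ht]
  split_ifs
  · rw [one_apply_eq_self]
  · rw [zero_apply, inner_zero_right]

theorem norm_apply_of_star_mul (ht : ∀ i j, star (t i) * t j = if i = j then 1 else 0)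
    (i : Fin n) (x : H) : ‖t i x‖ = ‖x‖ := by
  have h := inner_apply_apply_of_star_mul ht i i x x
  rw [if_pos rfl, inner_self_eq_norm_sq_to_K, inner_self_eq_norm_sq_to_K] at h
  have h2 : ‖t i x‖ ^ 2 = ‖x‖ ^ 2 := by exact_mod_cast h
  exact (sq_eq_sq₀ (norm_nonneg _) (norm_nonneg _)).1 h2

theorem sum_norm_sq_star_apply (ht : ∑ i, t i * star (t i) = 1) (x : H) :
    ∑ i, ‖star (t i) x‖ ^ 2 = ‖x‖ ^ 2 := by
  have h : ∑ i, (inner ℂ (star (t i) x) (star (t i) x) : ℂ) = inner ℂ x x := by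
    have h1 : ∀ i, (inner ℂ (star (t i) x) (star (t i) x) : ℂ) =
        inner ℂ ((t i * star (t i)) x) x := by
      intro i
      rw [ContinuousLinearMap.mul_apply]
      nth_rewrite 2 [ContinuousLinearMap.star_eq_adjoint]
      rw [ContinuousLinearMap.adjoint_inner_right]
    rw [Finset.sum_congr rfl fun i _ => h1 i, ← sum_inner, ← ContinuousLinearMap.sum_apply, ht,
      one_apply_eq_self]
  simp only [inner_self_eq_norm_sq_to_K] at h
  exact_mod_cast h

/-- Each piece contains a nonzero vector that the `i`-th letter maps to the next piece. -/
theorem exists_map_mem_wordSubspace (hn : 2 ≤ n)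
    (ht : ∀ i j, star (t i) * t j = if i = j then 1 else 0)
    (hfin : ∀ r k, Module.finrank ℂ (wordSpan t Ω r k) = n ^ (r + k))
    (hne : ∀ r k, ∃ x ∈ wordSubspace t Ω r k, x ≠ 0) (i : Fin n) (r k : ℕ) :
    ∃ x ∈ wordSubspace t Ω r k, x ≠ 0 ∧ t i x ∈ wordSubspace t Ω (r + 1) k := by
  rcases k with _ | k
  · obtain ⟨x, hx, hx0⟩ := hne r 0
    refine ⟨x, hx, hx0, ?_⟩
    rw [wordSubspace_eq_wordSpan t Ω (Or.inr rfl)] at hx ⊢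
    exact map_mem_wordSpan i hx
  rcases r with _ | r
  -- For `r = 0` one needs `t_i x ⟂ H_{0,k}`, that is `x ⟂ t_i* H_{0,k}`. That image has dimension
  -- at most `n^k`, less than the dimension `n^(k+1)` of `H_{0,k+1}`, so such an `x ≠ 0` exists.
  · set U := (wordSpan t Ω 0 k).map (star (t i)).toLinearMap with hU
    have hle : U ≤ wordSpan t Ω 0 (k + 1) := by
      rintro _ ⟨y, hy, rfl⟩
      exact star_map_mem_wordSpan i hy
    have h1 : Module.finrank ℂ U ≤ n ^ k := by
      refine (Submodule.finrank_map_le _ _).trans_eq ?_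
      rw [hfin, zero_add]
    have h2 := Submodule.finrank_add_inf_finrank_orthogonal hle
    rw [hfin, zero_add, pow_succ] at h2
    have h3 : 0 < n ^ k := pow_pos (by omega) k
    have h4 : 0 < Module.finrank ℂ ↥(Uᗮ ⊓ wordSpan t Ω 0 (k + 1)) := by nlinarith
    have h5 : Uᗮ ⊓ wordSpan t Ω 0 (k + 1) ≠ ⊥ := by
      intro h0
      rw [h0, finrank_bot] at h4
      exact lt_irrefl _ h4
    obtain ⟨x, hx, hx0⟩ := Submodule.exists_mem_ne_zero_of_ne_bot h5
    refine ⟨x, hx.2, hx0, map_mem_wordSpan i hx.2, ?_⟩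
    rw [SetLike.mem_coe, Submodule.mem_orthogonal]
    intro y hy
    have h6 := Submodule.mem_orthogonal _ _ |>.1 hx.1 (star (t i) y) ⟨y, hy, rfl⟩
    rwa [ContinuousLinearMap.star_eq_adjoint, ContinuousLinearMap.adjoint_inner_left] at h6
  -- For positive `r` every `x` works: the words of `H_{r+1,k}` begin with a letter, and the `t_a`
  -- are isometries with orthogonal ranges, so orthogonality to `H_{r,k}` is inherited.
  · obtain ⟨x, hx, hx0⟩ := hne (r + 1) (k + 1)
    refine ⟨x, hx, hx0, map_mem_wordSpan i hx.1, ?_⟩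
    have hle : wordSpan t Ω (r + 1) k ≤ (Submodule.span ℂ {t i x})ᗮ := by
      refine Submodule.span_le.2 ?_
      rintro _ ⟨α, β, hα, hβ, rfl⟩
      rcases α with _ | ⟨a, α⟩
      · simp at hα
      rw [SetLike.mem_coe, Submodule.mem_orthogonal_singleton_iff_inner_left, wordVec_cons_left,
        inner_apply_apply_of_star_mul ht]
      split_ifs
      · refine Submodule.mem_orthogonal _ _ |>.1 hx.2 _ ?_
        simp only [List.length_cons, add_left_inj] at hα
        exact hα ▸ hβ ▸ wordVec_mem_wordSpan t Ω α β
      · rfl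
    rw [SetLike.mem_coe, Submodule.mem_orthogonal]
    intro u hu
    exact Submodule.mem_orthogonal_singleton_iff_inner_left.1 (hle hu)

theorem abs_sub_le_of_commutator (ht : ∀ i j, star (t i) * t j = if i = j then 1 else 0)
    {i : Fin n} (hM : HasCommutatorBound D (t i) M) {d d' : ℝ} {x : H} (hx0 : x ≠ 0)
    (hx : IsEigenvectorOf D d x) (hx' : IsEigenvectorOf D d' (t i x)) : |d' - d| ≤ M := by
  obtain ⟨hx, h1⟩ := hx
  obtain ⟨hx', h2⟩ := hx'
  obtain ⟨hT, hM⟩ := hM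
  have h3 := hM ⟨x, hx⟩
  rw [h1, h2, map_smul, ← sub_smul, norm_smul, norm_apply_of_star_mul ht, ← Complex.ofReal_sub,
    Complex.norm_real] at h3
  exact le_of_mul_le_mul_right h3 (norm_pos_iff.2 hx0)

/-- With `y = t_i* x` one has `⟪[D, t_i] y, x⟫ = (d - d') ‖y‖²`, while the left side is at most `M
‖y‖ ‖x‖`. Only the commutator with `t_i` itself enters, not that with its adjoint. -/
theorem abs_sub_mul_norm_le_of_commutator (hD : IsSelfAdjoint D)
    {i : Fin n} (hM : HasCommutatorBound D (t i) M) {d d' : ℝ} {x : H}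
    (hx : IsEigenvectorOf D d x) (hx' : IsEigenvectorOf D d' (star (t i) x)) :
    |d' - d| * ‖star (t i) x‖ ≤ M * ‖x‖ := by
  rcases eq_or_ne (star (t i) x) 0 with h0 | h0
  · rw [h0, norm_zero, mul_zero]
    obtain ⟨hT, hM⟩ := hM
    obtain ⟨hx, -⟩ := hx
    exact (norm_nonneg _).trans (hM ⟨x, hx⟩)
  set y := star (t i) x with hy
  obtain ⟨hx, h1⟩ := hx
  obtain ⟨hy', h2⟩ := hx'
  obtain ⟨hT, hM⟩ := hM
  have h3 : (inner ℂ (D ⟨t i y, hT y hy'⟩ - t i (D ⟨y, hy'⟩)) x : ℂ) =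
      ((d - d' : ℝ) : ℂ) * inner ℂ y y := by
    have h4 : (inner ℂ (t i y) x : ℂ) = inner ℂ y y := by
      rw [hy, ContinuousLinearMap.star_eq_adjoint, ContinuousLinearMap.adjoint_inner_right]
    have h5 := inner_symm_of_isSelfAdjoint hD ⟨t i y, hT y hy'⟩ ⟨x, hx⟩
    rw [h1, inner_smul_right] at h5
    change _ = (d : ℂ) * inner ℂ (t i y) x at h5
    rw [inner_sub_left, h5, h2, map_smul, inner_smul_left, Complex.conj_ofReal, h4]
    push_cast; ring
  have h6 : |d' - d| * (‖y‖ * ‖y‖) ≤ M * ‖y‖ * ‖x‖ := by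
    calc |d' - d| * (‖y‖ * ‖y‖) = ‖((d - d' : ℝ) : ℂ) * inner ℂ y y‖ := by
          rw [norm_mul, Complex.norm_real, inner_self_eq_norm_sq_to_K, Real.norm_eq_abs,
            abs_sub_comm, norm_pow, RCLike.norm_ofReal, abs_norm, sq]
      _ ≤ ‖D ⟨t i y, hT y hy'⟩ - t i (D ⟨y, hy'⟩)‖ * ‖x‖ := by
          rw [← h3]; exact norm_inner_le_norm _ _
      _ ≤ M * ‖y‖ * ‖x‖ := mul_le_mul_of_nonneg_right (hM ⟨y, hy'⟩) (norm_nonneg _)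
  refine le_of_mul_le_mul_right ?_ (norm_pos_iff.2 h0)
  calc _ = |d' - d| * (‖y‖ * ‖y‖) := by ring
    _ ≤ M * ‖y‖ * ‖x‖ := h6
    _ = _ := by ring

/-- Squaring the bounds for the single letters and adding them uses `∑ ‖t_i* x‖² = ‖x‖²`; the `n`
equal upper bounds produce the factor `√n`. -/
theorem abs_sub_le_sqrt_of_commutator (hD : IsSelfAdjoint D) (ht : ∑ i, t i * star (t i) = 1)
    (hM0 : 0 ≤ M) (hM : ∀ i, HasCommutatorBound D (t i) M) {d d' : ℝ} {x : H} (hx0 : x ≠ 0)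
    (hx : IsEigenvectorOf D d x) (hx' : ∀ i, IsEigenvectorOf D d' (star (t i) x)) :
    |d' - d| ≤ M * √(n : ℝ) := by
  have h1 : |d' - d| ^ 2 * ‖x‖ ^ 2 ≤ (n : ℝ) * (M * ‖x‖) ^ 2 := by
    calc |d' - d| ^ 2 * ‖x‖ ^ 2 = ∑ i, (|d' - d| * ‖star (t i) x‖) ^ 2 := by
          rw [← sum_norm_sq_star_apply ht, Finset.mul_sum]
          exact Finset.sum_congr rfl fun i _ => (mul_pow _ _ _).symm
      _ ≤ ∑ _i : Fin n, (M * ‖x‖) ^ 2 := Finset.sum_le_sum fun i _ =>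
          pow_le_pow_left₀ (by positivity)
            (abs_sub_mul_norm_le_of_commutator hD (hM i) hx (hx' i)) 2
      _ = (n : ℝ) * (M * ‖x‖) ^ 2 := by simp
  have h2 : |d' - d| ^ 2 ≤ (M * √(n : ℝ)) ^ 2 := by
    rw [mul_pow, Real.sq_sqrt (Nat.cast_nonneg n)]
    refine le_of_mul_le_mul_right ?_ (pow_pos (norm_pos_iff.2 hx0) 2)
    calc _ ≤ _ := h1
      _ = _ := by ring
  exact (sq_le_sq₀ (abs_nonneg _) (by positivity)).1 h2

/-- The growth of the eigenvalues of an operator with bounded commutators. -/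
theorem abs_eigenvalue_le (hn : 2 ≤ n) (hD : IsSelfAdjoint D)
    (ht : ∀ i j, star (t i) * t j = if i = j then 1 else 0)
    (ht' : ∑ i, t i * star (t i) = 1)
    (hfin : ∀ r k, Module.finrank ℂ (wordSpan t Ω r k) = n ^ (r + k))
    (hne : ∀ r k, ∃ x ∈ wordSubspace t Ω r k, x ≠ 0)
    (hM : ∀ i, HasCommutatorBound D (t i) M) {d : ℕ → ℕ → ℝ}
    (hd : ∀ r k, ∀ x ∈ wordSubspace t Ω r k, IsEigenvectorOf D (d r k) x) (r k : ℕ) :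
    |d r k| ≤ |d 0 0| + M * (r + √(n : ℝ) * k) := by
  let i₀ : Fin n := ⟨0, by omega⟩
  -- The path from `(0,0)` to `(r,k)` goes first along `r = 0`, where `t_i*` maps `K_{0,k}` into
  -- `K_{0,k+1}`, and then in the direction of `r`.
  have hleft : ∀ r k, |d (r + 1) k - d r k| ≤ M := by
    intro r k
    obtain ⟨x, hx, hx0, hx'⟩ := exists_map_mem_wordSubspace hn ht hfin hne i₀ r k
    exact abs_sub_le_of_commutator ht (hM i₀) hx0 (hd r k x hx) (hd (r + 1) k _ hx')
  have hM0 : 0 ≤ M := (abs_nonneg _).trans (hleft 0 0)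
  have hright : ∀ k, |d 0 (k + 1) - d 0 k| ≤ M * √(n : ℝ) := by
    intro k
    obtain ⟨x, hx, hx0⟩ := hne 0 k
    refine abs_sub_le_sqrt_of_commutator hD ht' hM0 hM hx0 (hd 0 k x hx) fun i =>
      hd 0 (k + 1) _ ?_
    rw [wordSubspace_eq_wordSpan t Ω (Or.inl rfl)] at hx ⊢
    exact star_map_mem_wordSpan i hx
  induction r with
  | zero =>
    induction k with
    | zero => simp
    | succ k ih =>
      have h1 := abs_sub_abs_le_abs_sub (d 0 (k + 1)) (d 0 k)
      have h2 := hright k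
      push_cast at ih ⊢
      linarith
  | succ r ih =>
    have h1 := abs_sub_abs_le_abs_sub (d (r + 1) k) (d r k)
    have h2 := hleft r k
    push_cast at ih ⊢
    linarith

theorem HasCommutatorBound.mono {T : H →L[ℂ] H} {M' : ℝ} (h : HasCommutatorBound D T M)
    (hle : M ≤ M') : HasCommutatorBound D T M' := by
  obtain ⟨hT, h⟩ := h
  exact ⟨hT, fun x => (h x).trans (mul_le_mul_of_nonneg_right hle (norm_nonneg _))⟩

end CommutatorBounds

/-! ### Linear growth excludes summability. -/

section Summability

variable {n : ℕ} {H : Type*} [NormedAddCommGroup H] [InnerProductSpace ℂ H] [CompleteSpace H]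
  {D : H →ₗ.[ℂ] H}

open scoped ComplexOrder in
/-- The eigenvalues along an orthonormal family of eigenvectors of a summable operator. -/
theorem IsPSummable.summable {ι : Type*} (hD : IsSelfAdjoint D) {p : ℝ} (hp : 0 < p)
    (h : IsPSummable D p) {v : ι → H} (hv : Orthonormal ℂ v) {d : ι → ℝ}
    (hd : ∀ i, IsEigenvectorOf D (d i) (v i)) :
    Summable fun i => ((1 + d i ^ 2)⁻¹ : ℝ) ^ (p / 2) := by
  obtain ⟨R, hR, htr⟩ := h
  have hP : (0 : H →L[ℂ] H) ≤ star R * R := star_mul_self_nonneg R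
  -- The trace condition is applied to a Hilbert basis containing the given family; its diagonal
  -- entries at the family are the asserted terms.
  obtain ⟨w, b, hw, hb⟩ := hv.toSubtypeRange.exists_hilbertBasis_extension
  have h1 := htr w b
  have hinj : Function.Injective fun i => (⟨v i, hw ⟨i, rfl⟩⟩ : w) := by
    intro i j hij
    exact hv.linearIndependent.injective (congrArg Subtype.val hij)
  have h2 := h1.comp_injective hinj
  refine h2.congr fun i => ?_
  have h3 : b ⟨v i, hw ⟨i, rfl⟩⟩ = v i := congrFun hb _
  change (inner ℂ (b ⟨v i, _⟩) (CFC.abs ((star R * R) ^ (p / 2)) (b ⟨v i, _⟩))).re = _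
  rw [h3, CFC.abs_of_nonneg _ CFC.rpow_nonneg,
    rpow_eigenvector hP (by positivity) ((hd i).star_resolvent_mul hD hR), inner_smul_right,
    inner_self_eq_norm_sq_to_K, hv.1 i]
  simp

/-- A positive sequence bounded below by a negative power is not summable over the words. -/
theorem not_summable_words (hn : 2 ≤ n) {d : ℕ → ℝ} {a M p : ℝ} (ha : 0 ≤ a) (hM : 0 ≤ M)
    (hd : ∀ r : ℕ, |d r| ≤ a + M * r) :
    ¬ Summable fun α : List (Fin n) => ((1 + d α.length ^ 2)⁻¹ : ℝ) ^ (p / 2) := by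
  intro hs
  set C := ∑' α : List (Fin n), ((1 + d α.length ^ 2)⁻¹ : ℝ) ^ (p / 2) with hC
  -- The `n^r` words of length `r` all contribute the same term, and together at most the whole sum.
  have hbound : ∀ r : ℕ, (n : ℝ) ^ r * ((1 + d r ^ 2)⁻¹ : ℝ) ^ (p / 2) ≤ C := by
    intro r
    have h1 := hs.sum_le_tsum (Finset.univ.map ⟨fun f : Fin r → Fin n => List.ofFn f,
      List.ofFn_injective⟩) (fun α _ => by positivity)
    rw [Finset.sum_map] at h1
    simpa using h1
  -- Rounding the exponent up to an integer turns the lower bound on the terms into the reciprocal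
  -- of a polynomial in `r`.
  obtain ⟨k, hk⟩ := exists_nat_ge (p / 2)
  set B := 1 + (a + M) ^ 2 with hB
  have hB1 : 0 < B := by positivity
  have hlow : ∀ r : ℕ, (2 : ℝ) ^ r ≤ C * B ^ k * ((r + 1 : ℕ) : ℝ) ^ (2 * k) := by
    intro r
    have h1 : (1 : ℝ) ≤ 1 + d r ^ 2 := by nlinarith [sq_nonneg (d r)]
    have h2 : (1 + d r ^ 2 : ℝ) ≤ B * ((r + 1 : ℕ) : ℝ) ^ 2 := by
      have h3 : |d r| ≤ (a + M) * ((r + 1 : ℕ) : ℝ) := by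
        refine (hd r).trans ?_
        push_cast
        nlinarith [Nat.cast_nonneg (α := ℝ) r, mul_nonneg ha (Nat.cast_nonneg (α := ℝ) r)]
      have h4 : d r ^ 2 ≤ ((a + M) * ((r + 1 : ℕ) : ℝ)) ^ 2 := by
        rw [← sq_abs]; exact pow_le_pow_left₀ (abs_nonneg _) h3 2
      have h5 : (1 : ℝ) ≤ ((r + 1 : ℕ) : ℝ) ^ 2 := by
        refine one_le_pow₀ ?_
        push_cast
        linarith [Nat.cast_nonneg (α := ℝ) r]
      rw [hB]
      nlinarith
    have h6 : (1 + d r ^ 2 : ℝ) ^ (p / 2) ≤ B ^ k * ((r + 1 : ℕ) : ℝ) ^ (2 * k) := by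
      calc (1 + d r ^ 2 : ℝ) ^ (p / 2) ≤ (1 + d r ^ 2 : ℝ) ^ (k : ℝ) :=
            Real.rpow_le_rpow_of_exponent_le h1 hk
        _ = (1 + d r ^ 2 : ℝ) ^ k := Real.rpow_natCast _ _
        _ ≤ (B * ((r + 1 : ℕ) : ℝ) ^ 2) ^ k := pow_le_pow_left₀ (by positivity) h2 k
        _ = _ := by rw [mul_pow, ← pow_mul]
    have h7 : 0 < (1 + d r ^ 2 : ℝ) ^ (p / 2) := by positivity
    have h8 := hbound r
    rw [Real.inv_rpow (by positivity), ← div_eq_mul_inv, div_le_iff₀ h7] at h8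
    have hC0 : 0 ≤ C := tsum_nonneg fun α => by positivity
    calc (2 : ℝ) ^ r ≤ (n : ℝ) ^ r :=
          pow_le_pow_left₀ (by norm_num) (by exact_mod_cast hn) r
      _ ≤ C * (1 + d r ^ 2 : ℝ) ^ (p / 2) := h8
      _ ≤ C * (B ^ k * ((r + 1 : ℕ) : ℝ) ^ (2 * k)) := mul_le_mul_of_nonneg_left h6 hC0
      _ = _ := by ring
  -- The limit is taken at `r + 1`; the factor `2` in the next line compensates for `2^(r+1)` in
  -- place of `2^r`.
  have hlim := (tendsto_pow_const_div_const_pow_of_one_lt (2 * k) (one_lt_two (α := ℝ))).comp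
    (Filter.tendsto_add_atTop_nat 1)
  have hlim2 := hlim.const_mul (2 * (C * B ^ k))
  rw [mul_zero] at hlim2
  obtain ⟨r, hr⟩ := (hlim2.eventually (gt_mem_nhds (zero_lt_one (α := ℝ)))).exists
  have h9 := hlow r
  simp only [Function.comp_apply] at hr
  rw [pow_succ (2 : ℝ) r] at hr
  have h10 : (0 : ℝ) < 2 ^ r := by positivity
  have h11 : 2 * (C * B ^ k) * (((r + 1 : ℕ) : ℝ) ^ (2 * k) / (2 ^ r * 2)) =
      (C * B ^ k * ((r + 1 : ℕ) : ℝ) ^ (2 * k)) / 2 ^ r := by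
    field_simp
  rw [h11, div_lt_one h10] at hr
  linarith

end Summability

/-! ### Application to equivariant spectral triples. -/

section Main

variable {n : ℕ} {Q : Matrix (Fin n) (Fin n) ℂ} {ρ : CStarState (Cuntz n)}

theorem IsCovariantSystem.orthonormal_words {H : Type*} [NormedAddCommGroup H]
    [InnerProductSpace ℂ H] [CompleteSpace H] {q : Fin n → ℝ} {s : Fin n → (H →L[ℂ] H)} {Ω : H}
    (hS : IsCovariantSystem q s Ω) :
    Orthonormal ℂ fun α : List (Fin n) => wordVec s α [] Ω := by
  classical
  rw [orthonormal_iff_ite]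
  intro α β
  by_cases hl : α.length = β.length
  · rw [hS.inner_wordVec hl]
    simp [wordWeight]
  · rw [if_neg (fun h => hl (by rw [h]))]
    have h1 : wordSpan s Ω α.length 0 ⟂ wordSpan s Ω β.length 0 :=
      hS.wordSpan_isOrtho (by simpa using hl)
    exact h1.inner_eq (wordVec_mem_wordSpan s Ω α []) (wordVec_mem_wordSpan s Ω β [])

theorem IsCovariantSystem.exists_ne_zero {H : Type*} [NormedAddCommGroup H]
    [InnerProductSpace ℂ H] [CompleteSpace H] {q : Fin n → ℝ} {s : Fin n → (H →L[ℂ] H)} {Ω : H}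
    (hS : IsCovariantSystem q s Ω) (hn : 2 ≤ n) (r k : ℕ) :
    ∃ x ∈ wordSubspace s Ω r k, x ≠ 0 := by
  have h0 : wordSubspace s Ω r k ≠ ⊥ := by
    intro h0
    have h1 := hS.finrank_wordSubspace r k
    rw [h0, finrank_bot] at h1
    split_ifs at h1 with h
    · exact absurd h1 (pow_pos (by omega) _).ne
    · have h2 : n ^ (r + k - 2) < n ^ (r + k) :=
        Nat.pow_lt_pow_right (by omega) (by omega)
      omega
  obtain ⟨x, hx, hx0⟩ := Submodule.exists_mem_ne_zero_of_ne_bot h0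
  exact ⟨x, hx, hx0⟩

open scoped ComplexOrder in
theorem exists_commutatorBound (hn : 2 ≤ n) (hQ : Q.PosDef) (htr : Q.trace = 1)
    {D : ρ.GNS →ₗ.[ℂ] ρ.GNS}
    (hD : IsEquivariantSpectralTriple (FreeUnitary.comul Q) (cuntzAction Q) ρ D) :
    ∃ M : ℝ, ∀ i : Fin n, HasCommutatorBound D (ρ.π (Cuntz.S i)) M := by
  choose M hM using fun i : Fin n => hD.spectralTriple.bounded_commutator _
    (S_mem_algebraicElements (by omega) hQ htr i)
  exact ⟨∑ i, |M i|, fun i => (hM i).mono ((le_abs_self _).trans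
    (Finset.single_le_sum (f := fun i => |M i|) (fun i _ => abs_nonneg _) (Finset.mem_univ i)))⟩

open scoped ComplexOrder in
theorem exists_eigenvalues (hn : 2 ≤ n) (hQ : Q.PosDef) (htr : Q.trace = 1)
    (hρ : IsInvariantState (cuntzAction Q) ρ) {D : ρ.GNS →ₗ.[ℂ] ρ.GNS}
    (hD : IsEquivariantSpectralTriple (FreeUnitary.comul Q) (cuntzAction Q) ρ D) :
    ∃ d : ℕ → ℕ → ℝ,
      (∀ r k, ∀ x ∈ Cuntz.spectralSubspace ρ r k, IsEigenvectorOf D (d r k) x) ∧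
      ∀ M : ℝ, (∀ i : Fin n, HasCommutatorBound D (ρ.π (Cuntz.S i)) M) →
        ∀ r k : ℕ, |d r k| ≤ |d 0 0| + M * (r + √(n : ℝ) * k) := by
  obtain ⟨q, s, hS, hspan, hcov⟩ := exists_isCovariantSystem hQ htr ρ hρ
  obtain ⟨u, hu, R, hR, hcomm⟩ := hD.equivariant
  have hRcov := hcov R (hu.isInvariantOperator hcomm)
  -- The pieces do not depend on the rotation: scalarity is proved for the rotated generators, the
  -- growth bound for the original ones, whose commutators are controlled by `M`.
  have hsub : ∀ r k, wordSubspace (fun i => ρ.π (Cuntz.S i)) ρ.Ω r k = wordSubspace s ρ.Ω r k :=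
    fun r k => wordSubspace_congr hspan
  have hex : ∀ r k, ∃ d : ℝ, ∀ x ∈ Cuntz.spectralSubspace ρ r k, IsEigenvectorOf D d x := by
    intro r k
    obtain ⟨c, hc⟩ := hS.exists_scalar hRcov hn r k
    rw [spectralSubspace_eq_wordSubspace, hsub]
    exact exists_real_eigenvalue hD.spectralTriple.selfAdjoint hR _ hc
  choose d hd using hex
  refine ⟨d, hd, fun M hM => ?_⟩
  refine abs_eigenvalue_le hn hD.spectralTriple.selfAdjoint
    (fun i j => ?_) ?_ (fun r k => ?_) (fun r k => ?_) hM
    (fun r k => by rw [← spectralSubspace_eq_wordSubspace]; exact hd r k)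
  · rw [← map_star, ← map_mul, Cuntz.star_S_mul_S]
    split_ifs
    · rw [map_one]
    · rw [map_zero]
  · simp_rw [← map_star, ← map_mul]
    rw [← map_sum, Cuntz.rel.2, map_one]
  · rw [hspan, hS.finrank_wordSpan]
  · rw [hsub]; exact hS.exists_ne_zero hn r k

open scoped ComplexOrder in
theorem not_isPSummable (hn : 2 ≤ n) (hQ : Q.PosDef) (htr : Q.trace = 1)
    (hρ : IsInvariantState (cuntzAction Q) ρ) {D : ρ.GNS →ₗ.[ℂ] ρ.GNS}
    (hD : IsEquivariantSpectralTriple (FreeUnitary.comul Q) (cuntzAction Q) ρ D) {p : ℝ}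
    (hp : 0 < p) : ¬ IsPSummable D p := by
  intro h
  obtain ⟨M, hM⟩ := exists_commutatorBound hn hQ htr hD
  obtain ⟨d, hd, hbound⟩ := exists_eigenvalues hn hQ htr hρ hD
  obtain ⟨q, s, hS, hspan, -⟩ := exists_isCovariantSystem hQ htr ρ hρ
  have hv : ∀ α : List (Fin n), IsEigenvectorOf D (d α.length 0) (wordVec s α [] ρ.Ω) := by
    intro α
    refine hd _ _ _ ?_
    rw [spectralSubspace_eq_wordSubspace, wordSubspace_congr hspan,
      wordSubspace_eq_wordSpan s ρ.Ω (Or.inr rfl)]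
    exact wordVec_mem_wordSpan s ρ.Ω α []
  refine not_summable_words hn (d := fun r => d r 0) (a := |d 0 0|) (M := |M|) (abs_nonneg _)
    (abs_nonneg _) (fun r => ?_)
    (h.summable hD.spectralTriple.selfAdjoint hp hS.orthonormal_words hv)
  have h1 := hbound |M| (fun i => (hM i).mono (le_abs_self M)) r 0
  simpa using h1

end Main

end NCG

end

open NCG
open scoped ComplexOrder
theorem mainTheorem6 (n : ℕ) (hn : 2 ≤ n) (Q : Matrix (Fin n) (Fin n) ℂ) (hQ : Q.PosDef)
    (htr : Q.trace = 1) :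
    (∀ ρ : CStarState (Cuntz n), IsInvariantState (cuntzAction Q) ρ →
      (∀ r s r' s' : ℕ, (r, s) ≠ (r', s') →
        Cuntz.spectralSubspace ρ r s ⟂ Cuntz.spectralSubspace ρ r' s') ∧
      (⨆ (r : ℕ) (s : ℕ), Cuntz.spectralSubspace ρ r s).topologicalClosure = ⊤ ∧
      (∀ r s : ℕ, Module.finrank ℂ (Cuntz.spectralSubspace ρ r s) =
        if r = 0 ∨ s = 0 then n ^ (r + s) else n ^ (r + s) - n ^ (r + s - 2)) ∧
      ∀ D : ρ.GNS →ₗ.[ℂ] ρ.GNS,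
        IsEquivariantSpectralTriple (FreeUnitary.comul Q) (cuntzAction Q) ρ D →
        (∃ M : ℝ, ∀ i : Fin n, HasCommutatorBound D (ρ.π (Cuntz.S i)) M) ∧
        (∃ d : ℕ → ℕ → ℝ,
          (∀ (r s : ℕ), ∀ x ∈ Cuntz.spectralSubspace ρ r s,
            ∃ hx : x ∈ D.domain, D ⟨x, hx⟩ = (d r s : ℂ) • x) ∧
          ∀ M : ℝ, (∀ i : Fin n, HasCommutatorBound D (ρ.π (Cuntz.S i)) M) →
            ∀ r s : ℕ, |d r s| ≤ |d 0 0| + M * (r + √(n : ℝ) * s)) ∧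
        ∀ p : ℝ, 0 < p → ¬ IsPSummable D p) ∧
    spectralDimension (FreeUnitary.comul Q) (cuntzAction Q) = ⊤ := by
  refine ⟨fun ρ hρ => ?_, ?_⟩
  · obtain ⟨q, s, hS, hspan, -⟩ := exists_isCovariantSystem hQ htr ρ hρ
    have hsub : ∀ r k, Cuntz.spectralSubspace ρ r k = wordSubspace s ρ.Ω r k := fun r k => by
      rw [spectralSubspace_eq_wordSubspace, wordSubspace_congr hspan]
    refine ⟨fun r k r' k' h => ?_, ?_, fun r k => ?_, fun D hD =>
      ⟨exists_commutatorBound hn hQ htr hD, exists_eigenvalues hn hQ htr hρ hD,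
        fun p hp => not_isPSummable hn hQ htr hρ hD hp⟩⟩
    · rw [hsub, hsub]
      exact hS.wordSubspace_isOrtho h
    · simp only [hsub]
      exact hS.dense_iSup
    · rw [hsub]
      exact hS.finrank_wordSubspace r k
  -- The infimum is over the empty set: a member would come from a summable equivariant triple.
  · refine sInf_eq_top.2 ?_
    rintro _ ⟨p, hp, -, ρ, hρ, D, hD, hsum⟩
    exact absurd hsum (not_isPSummable hn hQ htr hρ hD hp)
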